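/- Conventions. Orbifolds (possibly Banach, possibly ineffective) are presented by Hausdorff proper étale Lie groupoids; an orbifold vector bundle is a smooth vector bundle over the objects with a smooth fibrewise linear action of the arrows; a functor between orbifolds is an orbifold vector bundle if it is identified with the projection of the total space of one. Virtual orbifolds. Let $N$ be a finite set. A virtual orbifold consists of finite-dimensional smooth orbifolds $X_I$ ($I\subseteq N$), open suborbifolds $X_{I,J}\subseteq X_I$ ($I,J\subseteq N$; $X_{I,I}=X_I$), and for $I\subseteq J$ surjective orbifold vector bundles $\phi_{J,I}:X_{J,I}\to X_{I,J}$ ($\phi_{I,I}=\mathrm{id}$), such that for all $I,J$ $$X_{I\cup J,I\cap J}=X_{I\cup J,I}\cap X_{I\cup J,J},\qquad X_{I\cap J,I\cup J}=X_{I\cap J,I}\cap X_{I\cap J,J},$$ $$\phi_{I\cup J,I\cap J}=\phi_{I,I\cap J}\circ\phi_{I\cup J,I}=\phi_{J,I\cap J}\circ\phi_{I\cup J,J},$$ $$X_{I,J}=\phi_{I\cup J,I}(X_{I\cup J,I\cap J})=\phi_{I,I\cap J}^{-1}(X_{I\cap J,I\cup J}),\qquad X_{J,I}=\phi_{I\cup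 J,J}(X_{I\cup J,I\cap J})=\phi_{J,I\cap J}^{-1}(X_{I\cap J,I\cup J}),$$ the maps $\phi_{I,I\cap J}:X_{I,J}\to X_{I\cap J,I\cup J}$ and $\phi_{J,I\cap J}:X_{J,I}\to X_{I\cap J,I\cup J}$ are orbifold vector bundles, and $X_{I\cup J,I\cap J}=X_{I,J}\times_{X_{I\cap J,I\cup J}}X_{J,I}$. A virtual bundle over it consists of orbifold vector bundles $E_I\to X_I$ with isomorphisms $E_J|_{X_{J,I}}\cong\phi_{J,I}^*(X_{J,I}\oplus E_I|_{X_{I,J}})$ for $I\subseteq J$; a section consists of smooth sections $S_I$ of $E_I$ with $S_J(x,v)=(v,S_I(x))$ for $(x,v)\in X_{J,I}$. Fredholm systems. Let $(\mathcal B,\mathcal F,S)$ be a Fredholm system: $\mathcal F\to\mathcal B$ is a smooth Banach orbifold bundle over a smooth Banach orbifold, $S$ is a smooth section, $M=S^{-1}(0)$ is compact, and for every $x\in M$ the linearization $L_x:T_x\mathcal B\to\mathcal F_x$ is a Fredholm operator of index $d$. For finite rank orbifold vector bundles $\mathcal O_i$ ($i\in I$) and bundle maps $s_i:\mathcal O_i\to\mathcal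 F$ over an open $A\subseteq\mathcal B$, put $\mathcal O_I=\bigoplus_{i\in I}\mathcal O_i$, $s_I=\sum_{i\in I}s_i$, $k_i=\operatorname{rank}\mathcal O_i$ and $\hat S(u,o)=S(u)+s_I(o)$ for $(u,o)\in\mathcal O_I$. A zero $(u,o)$ of $\hat S$ is called regular if the linearization $\hat L_{(u,o)}:T_{(u,o)}\mathcal O_I\to\mathcal F_u$ is surjective and Fredholm of index $d+\sum_{i\in I}k_i$. The pair $(\mathcal O_I,s_I)$ stabilizes the system at $A$ if all zeros of $\hat S$ over $A$ are regular. A local stabilization system $\{(U_i,\mathcal O_i,s_i)\}_{i\in N}$, $N$ finite, consists of open suborbifolds $\tfrac12U_i\subseteq\tfrac34U_i\subseteq U_i$ of $\mathcal B$ with $\overline{\tfrac12U_i}\subseteq\tfrac34U_i$ and $\overline{\tfrac34U_i}\subseteq U_i$, a finite rank orbifold vector bundle $\mathcal O_i\to U_i$, and a smooth bundle map $s_i=\eta_i\iota_i:\mathcal O_i\to\mathcal F|_{U_i}$, where $\iota_i$ is a smooth bundle map and $\eta_i$ is a smooth cut-off function with $\eta_i=1$ on $\tfrac12U_i$ and $\eta_i=0$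 outside $\tfrac34U_i$, such that $(\mathcal O_i,s_i)$ stabilizes the system at $\tfrac12U_i$ for every $i$, and $M\subseteq\bigcup_i\tfrac12U_i$. Proposition. Let $\{(U_i,\mathcal O_i,s_i)\}_{i\in N}$ be a local stabilization system of $(\mathcal B,\mathcal F,S)$. For $I\subseteq N$ let $X_I=\bigcap_{i\in I}U_i\setminus\bigcup_{j\notin I}\overline{\tfrac34U_j}$, let $W_I\subseteq\mathcal O_I|_{X_I}$ be the set of regular zeros of $\hat S=S+s_I$ over $X_I$ (this is the set of all zeros of $\hat S$ over $X_I$ if $(\mathcal O_I,s_I)$ stabilizes the system at $X_I$), and let $\mathfrak o:W_I\to X_I$ be the projection. Then: 1. $\mathcal W=\{W_I\}$ is a virtual orbifold. Each $W_I$ is a smooth suborbifold of $\mathcal O_I|_{X_I}$, of dimension $d+\sum_{i\in I}k_i$ if nonempty, and its space of objects is second countable if that of $\mathcal B$ is. The overlaps are $W_{I,J}=\mathfrak o^{-1}(X_I\cap X_J)\subseteq W_I$, and for $I\subseteq J$ the transition map is $\phi_{J,I}:W_{J,I}\to W_{I,J}$, $(u,o_J)\mapsto(u,o_I)$. It is the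 vector bundle $\mathfrak o^*\mathcal O_{J-I}$ over $W_{I,J}$, through $(u,o_J)\mapsto((u,o_I),o_{J-I})$. 2. The obstruction bundles $\mathfrak o^*\mathcal O_I\to W_I$ form a virtual bundle over $\mathcal W$, whose isomorphisms for $I\subseteq J$ are $\mathcal O_J=\mathcal O_{J-I}\oplus\mathcal O_I$, and $\sigma:(u,o)\mapsto(u,o,o)$ is a section of it. For every $I$ the zeros of $\sigma$ on $W_I$ project onto $M\cap X_I$. -/

import Mathlib

open Set Filter TopologicalSpace Bundle
open scoped Manifold ContDiff Topology

universe v w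

noncomputable section

namespace VirtualOrb

/-- Euclidean space of dimension `n`. -/
abbrev Euc (n : ℕ) : Type := EuclideanSpace ℝ (Fin n)

/-! ### Topological groupoids -/

/-- A topological groupoid; `comp g h` is "first `h`, then `g`". Its orbit space is the quotient of
the objects by the relation of being joined by an arrow. -/
structure TopGroupoid where
  Obj : Type v
  Arr : Type v
  [topObj : TopologicalSpace Obj]
  [topArr : TopologicalSpace Arr]
  src : Arr → Obj
  tgt : Arr → Obj
  one : Obj → Arr
  inv : Arr → Arr
  comp : ∀ g h : Arr, src g = tgt h → Arr
  src_one : ∀ x, src (one x) = x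
  tgt_one : ∀ x, tgt (one x) = x
  src_inv : ∀ g, src (inv g) = tgt g
  tgt_inv : ∀ g, tgt (inv g) = src g
  src_comp : ∀ g h e, src (comp g h e) = src h
  tgt_comp : ∀ g h e, tgt (comp g h e) = tgt g
  comp_assoc : ∀ g h k (hgh : src g = tgt h) (hhk : src h = tgt k),
    comp (comp g h hgh) k ((src_comp g h hgh).trans hhk) =
      comp g (comp h k hhk) (hgh.trans (tgt_comp h k hhk).symm)
  one_comp : ∀ g, comp (one (tgt g)) g (src_one _) = g
  comp_one : ∀ g, comp g (one (src g)) (tgt_one _).symm = g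
  inv_comp : ∀ g, comp (inv g) g (src_inv g) = one (src g)
  comp_inv : ∀ g, comp g (inv g) (tgt_inv g).symm = one (tgt g)
  continuous_src : Continuous src
  continuous_tgt : Continuous tgt
  continuous_one : Continuous one
  continuous_inv : Continuous inv
  continuous_comp : Continuous
    (fun p : {p : Arr × Arr // src p.1 = tgt p.2} => comp p.1.1 p.1.2 p.2)

attribute [instance] TopGroupoid.topObj TopGroupoid.topArr

namespace TopGroupoid

/-- The orbit space of a groupoid (the underlying space of the orbifold it presents). -/
def OrbitSpace (G : TopGroupoid.{v}) : Type v :=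
  Quot (fun x y : G.Obj => ∃ g : G.Arr, G.src g = x ∧ G.tgt g = y)

instance (G : TopGroupoid.{v}) : TopologicalSpace G.OrbitSpace :=
  inferInstanceAs (TopologicalSpace (Quot _))

/-- A set of objects is invariant if it is a union of orbits. -/
def Invariant (G : TopGroupoid.{v}) (A : Set G.Obj) : Prop :=
  ∀ g : G.Arr, G.src g ∈ A ↔ G.tgt g ∈ A

/-- The full subgroupoid on a set of objects. -/
def full (G : TopGroupoid.{v}) (A : Set G.Obj) : TopGroupoid.{v} where
  Obj := {x : G.Obj // x ∈ A}
  Arr := {g : G.Arr // G.src g ∈ A ∧ G.tgt g ∈ A}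
  src g := ⟨G.src g.1, g.2.1⟩
  tgt g := ⟨G.tgt g.1, g.2.2⟩
  one x := ⟨G.one x.1, by rw [G.src_one]; exact x.2, by rw [G.tgt_one]; exact x.2⟩
  inv g := ⟨G.inv g.1, by rw [G.src_inv]; exact g.2.2, by rw [G.tgt_inv]; exact g.2.1⟩
  comp g h e := ⟨G.comp g.1 h.1 (congrArg Subtype.val e),
    by rw [G.src_comp]; exact h.2.1, by rw [G.tgt_comp]; exact g.2.2⟩
  src_one x := Subtype.ext (G.src_one _)
  tgt_one x := Subtype.ext (G.tgt_one _)
  src_inv g := Subtype.ext (G.src_inv _)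
  tgt_inv g := Subtype.ext (G.tgt_inv _)
  src_comp g h e := Subtype.ext (G.src_comp _ _ _)
  tgt_comp g h e := Subtype.ext (G.tgt_comp _ _ _)
  comp_assoc g h k _ _ := Subtype.ext (G.comp_assoc _ _ _ _ _)
  one_comp g := Subtype.ext (G.one_comp _)
  comp_one g := Subtype.ext (G.comp_one _)
  inv_comp g := Subtype.ext (G.inv_comp _)
  comp_inv g := Subtype.ext (G.comp_inv _)
  continuous_src := (G.continuous_src.comp continuous_subtype_val).subtype_mk _
  continuous_tgt := (G.continuous_tgt.comp continuous_subtype_val).subtype_mk _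
  continuous_one := (G.continuous_one.comp continuous_subtype_val).subtype_mk _
  continuous_inv := (G.continuous_inv.comp continuous_subtype_val).subtype_mk _
  continuous_comp := by
    refine Continuous.subtype_mk ?_ _
    exact G.continuous_comp.comp
      (Continuous.subtype_mk
        (((continuous_subtype_val.comp continuous_fst).comp continuous_subtype_val).prodMk
          ((continuous_subtype_val.comp continuous_snd).comp continuous_subtype_val))
        (fun p => congrArg Subtype.val p.2))

/-- The full subgroupoid on an open set of objects. -/
def restrict (G : TopGroupoid.{v}) (U : Opens G.Obj) : TopGroupoid.{v} :=
  G.full (U : Set G.Obj)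

/-- An object lying in an open set, as an object of the full subgroupoid on this set. -/
def mkObj (G : TopGroupoid.{v}) {U : Opens G.Obj} (x : G.Obj) (h : x ∈ U) : (G.restrict U).Obj :=
  ⟨x, h⟩

/-- An open set of objects carries the restricted charts. -/
instance restrictChartedSpace {E : Type*} [TopologicalSpace E] (G : TopGroupoid.{v})
    [ChartedSpace E G.Obj] (U : Opens G.Obj) : ChartedSpace E (G.restrict U).Obj :=
  inferInstanceAs (ChartedSpace E U)

/-- Continuous functors. -/
structure Hom (H G : TopGroupoid.{v}) where
  obj : H.Obj → G.Obj
  arr : H.Arr → G.Arr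
  continuous_obj : Continuous obj
  continuous_arr : Continuous arr
  src_arr : ∀ h, G.src (arr h) = obj (H.src h)
  tgt_arr : ∀ h, G.tgt (arr h) = obj (H.tgt h)
  map_one : ∀ x, arr (H.one x) = G.one (obj x)
  map_comp : ∀ g h (e : H.src g = H.tgt h), arr (H.comp g h e) =
    G.comp (arr g) (arr h) ((src_arr g).trans ((congrArg obj e).trans (tgt_arr h).symm))

/-- The inclusion of a full subgroupoid. -/
def incl (G : TopGroupoid.{v}) (A : Set G.Obj) : Hom (G.full A) G where
  obj := Subtype.val
  arr := Subtype.val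
  continuous_obj := continuous_subtype_val
  continuous_arr := continuous_subtype_val
  src_arr _ := rfl
  tgt_arr _ := rfl
  map_one _ := rfl
  map_comp _ _ _ := rfl

/-- Composition of functors (`k` first). -/
def Hom.comp {K H G : TopGroupoid.{v}} (f : Hom H G) (k : Hom K H) : Hom K G where
  obj := f.obj ∘ k.obj
  arr := f.arr ∘ k.arr
  continuous_obj := f.continuous_obj.comp k.continuous_obj
  continuous_arr := f.continuous_arr.comp k.continuous_arr
  src_arr h := (f.src_arr _).trans (congrArg f.obj (k.src_arr h))
  tgt_arr h := (f.tgt_arr _).trans (congrArg f.obj (k.tgt_arr h))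
  map_one x := (congrArg f.arr (k.map_one x)).trans (f.map_one _)
  map_comp g h e := (congrArg f.arr (k.map_comp g h e)).trans (f.map_comp _ _ _)

end TopGroupoid

open TopGroupoid

/-! ### Orbifolds and orbifold vector bundles -/

/-- Orbifolds modelled on the normed space `E`, presented as proper étale Lie groupoids (isotropy
may act ineffectively): the objects form a Hausdorff smooth manifold modelled on `E`, source (hence
also target) is a local homeomorphism, the local maps `tgt ∘ src⁻¹` are smooth, and
`(src, tgt)` is proper. -/
structure IsOrbifold (E : Type*) [NormedAddCommGroup E] [NormedSpace ℝ E] (G : TopGroupoid.{v})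
    [ChartedSpace E G.Obj] : Prop where
  isManifold : IsManifold 𝓘(ℝ, E) ∞ G.Obj
  t2_obj : T2Space G.Obj
  t2_arr : T2Space G.Arr
  src_localHomeo : IsLocalHomeomorph G.src
  smooth : ∀ g : G.Arr, ∃ f : G.Obj → G.Obj, ContMDiffAt 𝓘(ℝ, E) 𝓘(ℝ, E) ∞ f (G.src g) ∧
    ∀ᶠ h in 𝓝 g, f (G.src h) = G.tgt h
  proper : IsProperMap (fun g : G.Arr => (G.src g, G.tgt g))

/-- A smooth orbifold vector bundle with fibre model `R` over an orbifold presented by `G`: a smooth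
vector bundle over the objects with a smooth fibrewise linear action of the arrows. -/
structure OrbiBundle (E : Type*) [NormedAddCommGroup E] [NormedSpace ℝ E] (G : TopGroupoid.{v})
    [ChartedSpace E G.Obj] (R : Type*) [NormedAddCommGroup R] [NormedSpace ℝ R] where
  Fib : G.Obj → Type w
  [addCommGroup : ∀ x, AddCommGroup (Fib x)]
  [module : ∀ x, Module ℝ (Fib x)]
  [topFib : ∀ x, TopologicalSpace (Fib x)]
  [topTotal : TopologicalSpace (TotalSpace R Fib)]
  [fiberBundle : FiberBundle R Fib]
  [vectorBundle : VectorBundle ℝ R Fib]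
  [smoothBundle : ContMDiffVectorBundle ∞ R Fib 𝓘(ℝ, E)]
  act : ∀ g : G.Arr, Fib (G.src g) →L[ℝ] Fib (G.tgt g)
  act_one : ∀ (x : G.Obj) (a : Fib (G.src (G.one x))),
    (⟨G.tgt (G.one x), act (G.one x) a⟩ : TotalSpace R Fib) = ⟨G.src (G.one x), a⟩
  act_comp : ∀ g h (e : G.src g = G.tgt h) (a : Fib (G.src (G.comp g h e))) (b : Fib (G.src h))
    (c : Fib (G.src g)),
    (⟨G.src (G.comp g h e), a⟩ : TotalSpace R Fib) = ⟨G.src h, b⟩ →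
    (⟨G.tgt h, act h b⟩ : TotalSpace R Fib) = ⟨G.src g, c⟩ →
    (⟨G.tgt (G.comp g h e), act (G.comp g h e) a⟩ : TotalSpace R Fib) = ⟨G.tgt g, act g c⟩
  smooth_act : ∀ g : G.Arr, ∃ Φ : TotalSpace R Fib → TotalSpace R Fib,
    (∀ a, a.proj = G.src g →
      ContMDiffAt (𝓘(ℝ, E).prod 𝓘(ℝ, R)) (𝓘(ℝ, E).prod 𝓘(ℝ, R)) ∞ Φ a) ∧
    ∀ᶠ h in 𝓝 g, ∀ a : Fib (G.src h), Φ ⟨G.src h, a⟩ = ⟨G.tgt h, act h a⟩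

attribute [instance] OrbiBundle.addCommGroup OrbiBundle.module OrbiBundle.topFib
  OrbiBundle.topTotal OrbiBundle.fiberBundle OrbiBundle.vectorBundle OrbiBundle.smoothBundle

/-- The total space of an orbifold vector bundle, at the level of objects. -/
abbrev OrbiBundle.Total {E : Type*} [NormedAddCommGroup E] [NormedSpace ℝ E] {G : TopGroupoid.{v}}
    [ChartedSpace E G.Obj] {R : Type*} [NormedAddCommGroup R] [NormedSpace ℝ R]
    (V : OrbiBundle.{v, w} E G R) : Type (max v w) := TotalSpace R V.Fib

/-- `V.Acts g a b`: the point `a` of the total space lies over `src g`, and `g • a = b`. -/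
def OrbiBundle.Acts {E : Type*} [NormedAddCommGroup E] [NormedSpace ℝ E] {G : TopGroupoid.{v}}
    [ChartedSpace E G.Obj] {R : Type*} [NormedAddCommGroup R] [NormedSpace ℝ R]
    (V : OrbiBundle.{v, w} E G R) (g : G.Arr) (a b : V.Total) : Prop :=
  ∃ x : V.Fib (G.src g), a = ⟨G.src g, x⟩ ∧ b = ⟨G.tgt g, V.act g x⟩

section Acts

variable {E : Type*} [NormedAddCommGroup E] [NormedSpace ℝ E] {G : TopGroupoid.{v}}
  [ChartedSpace E G.Obj] {R : Type*} [NormedAddCommGroup R] [NormedSpace ℝ R]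
  (V : OrbiBundle.{v, w} E G R)

theorem OrbiBundle.exists_fib (x : G.Obj) (a : V.Total) (h : a.proj = x) :
    ∃ y : V.Fib x, a = ⟨x, y⟩ := by
  subst h; exact ⟨a.2, rfl⟩

theorem OrbiBundle.acts_one (a : V.Total) : V.Acts (G.one a.proj) a a := by
  obtain ⟨y, hy⟩ := V.exists_fib (G.src (G.one a.proj)) a (G.src_one _).symm
  exact ⟨y, hy, hy.trans (V.act_one _ y).symm⟩

theorem OrbiBundle.acts_comp {g h : G.Arr} (e : G.src g = G.tgt h) {a b c : V.Total}
    (hab : V.Acts h a b) (hbc : V.Acts g b c) : V.Acts (G.comp g h e) a c := by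
  obtain ⟨x, rfl, rfl⟩ := hab
  obtain ⟨y, hy, rfl⟩ := hbc
  obtain ⟨z, hz⟩ := V.exists_fib (G.src (G.comp g h e)) ⟨G.src h, x⟩ (G.src_comp _ _ _).symm
  exact ⟨z, hz, (V.act_comp g h e z x y hz.symm hy).symm⟩

theorem OrbiBundle.acts_inv {g : G.Arr} {a b : V.Total} (hab : V.Acts g a b) :
    V.Acts (G.inv g) b a := by
  have hb : b.proj = G.src (G.inv g) := by
    obtain ⟨x, rfl, rfl⟩ := hab; exact (G.src_inv g).symm
  have ha : a.proj = G.src g := by obtain ⟨x, rfl, rfl⟩ := hab; rfl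
  obtain ⟨y, hy⟩ := V.exists_fib _ b hb
  have h1 : V.Acts (G.inv g) b ⟨_, V.act (G.inv g) y⟩ := ⟨y, hy, rfl⟩
  have h2 := V.acts_comp (G.src_inv g) hab h1
  have h3 : V.Acts (G.comp (G.inv g) g (G.src_inv g)) a a := by
    rw [G.inv_comp, ← ha]; exact V.acts_one a
  have h4 : (⟨_, V.act (G.inv g) y⟩ : V.Total) = a := by
    obtain ⟨z, hz, hz'⟩ := h2
    obtain ⟨t, ht, ht'⟩ := h3
    have : z = t := by
      rw [hz] at ht
      exact eq_of_heq (TotalSpace.mk.inj ht).2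
    rw [hz', this, ← ht']
  rw [h4] at h1
  exact h1

end Acts

/-- The structure of a (finite rank) orbifold vector bundle on a functor `φ : H → G` between
orbifolds: an identification, over `G`, of `φ` with the projection of the total space of an orbifold
vector bundle `V` over `G`. The arrows of the total space of `V` are the pairs of an arrow `g` of
`G` and a vector over `src g`, which the condition `lift` says for `H`. -/
structure BundleStr {E' : Type*} [NormedAddCommGroup E'] [NormedSpace ℝ E']
    {E : Type*} [NormedAddCommGroup E] [NormedSpace ℝ E]
    {H G : TopGroupoid.{v}} [ChartedSpace E' H.Obj] [ChartedSpace E G.Obj] (φ : Hom H G) where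
  rank : ℕ
  V : OrbiBundle.{v, 0} E G (Euc rank)
  e : Diffeomorph 𝓘(ℝ, E') (𝓘(ℝ, E).prod 𝓘(ℝ, Euc rank)) H.Obj V.Total ∞
  proj_e : ∀ x, (e x).proj = φ.obj x
  lift : ∀ (g : G.Arr) (x : H.Obj), φ.obj x = G.src g → ∃! h : H.Arr, H.src h = x ∧ φ.arr h = g
  equivariant : ∀ h : H.Arr, V.Acts (φ.arr h) (e (H.src h)) (e (H.tgt h))

/-! ### Virtual orbifolds -/

/-- A virtual orbifold structure on a family of orbifolds `X I`, indexed by the subsets `I` of a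
finite set `ι`. Here `dom I J` is the overlap `X_{I,J} ⊆ X_I`, and for `I ⊆ J` the functor `φ` is
the transition map `X_{J,I} → X_{I,J}`. Conditions that are not symmetric in `I` and `J` are
imposed for all ordered pairs; exchanging `I` and `J` gives their other half. -/
structure VirtualOrbifold {ι : Type*} [DecidableEq ι] (X : Finset ι → TopGroupoid.{v}) where
  dim : Finset ι → ℕ
  [charted : ∀ I, ChartedSpace (Euc (dim I)) (X I).Obj]
  isOrbifold : ∀ I, IsOrbifold (Euc (dim I)) (X I)
  /-- the overlaps are open suborbifolds -/
  dom : ∀ I _J : Finset ι, Opens (X I).Obj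
  dom_invariant : ∀ I J, (X I).Invariant (dom I J : Set (X I).Obj)
  φ : ∀ {I J : Finset ι}, I ⊆ J → Hom ((X J).restrict (dom J I)) ((X I).restrict (dom I J))
  surjective_φ : ∀ {I J : Finset ι} (h : I ⊆ J), Function.Surjective (φ h).obj
  dom_self : ∀ I, dom I I = ⊤
  φ_self_obj : ∀ I x, ((φ (Finset.Subset.refl I)).obj x).1 = x.1
  φ_self_arr : ∀ I a, ((φ (Finset.Subset.refl I)).arr a).1 = a.1
  /-- the transition maps are orbifold vector bundles -/
  bundle : ∀ {I J : Finset ι} (h : I ⊆ J),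
    BundleStr.{v} (E' := Euc (dim J)) (E := Euc (dim I)) (φ h)
  /-- `X_{I∪J,I∩J} = X_{I∪J,I} ∩ X_{I∪J,J}` -/
  P1 : ∀ I J, dom (I ∪ J) (I ∩ J) = dom (I ∪ J) I ⊓ dom (I ∪ J) J
  /-- `X_{I∩J,I∪J} = X_{I∩J,I} ∩ X_{I∩J,J}` -/
  P2 : ∀ I J, dom (I ∩ J) (I ∪ J) = dom (I ∩ J) I ⊓ dom (I ∩ J) J
  /-- `φ_{I∪J,I∩J} = φ_{I,I∩J} ∘ φ_{I∪J,I}` on objects; the memberships `h₁`, `h₂` hold by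
  `P1` and `P4`, `P4'` -/
  P3_obj : ∀ (I J : Finset ι) (x : (X (I ∪ J)).Obj) (h : x ∈ dom (I ∪ J) (I ∩ J))
    (h₁ : x ∈ dom (I ∪ J) I)
    (h₂ : ((φ Finset.subset_union_left).obj ⟨x, h₁⟩).1 ∈ dom I (I ∩ J)),
    ((φ Finset.inter_subset_union).obj ⟨x, h⟩).1 =
      ((φ Finset.inter_subset_left).obj
        ⟨((φ Finset.subset_union_left).obj ⟨x, h₁⟩).1, h₂⟩).1
  /-- the same equality on arrows -/
  P3_arr : ∀ (I J : Finset ι) (a : (X (I ∪ J)).Arr)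
    (h : (X (I ∪ J)).src a ∈ dom (I ∪ J) (I ∩ J) ∧ (X (I ∪ J)).tgt a ∈ dom (I ∪ J) (I ∩ J))
    (h₁ : (X (I ∪ J)).src a ∈ dom (I ∪ J) I ∧ (X (I ∪ J)).tgt a ∈ dom (I ∪ J) I)
    (h₂ : (X I).src ((φ Finset.subset_union_left).arr ⟨a, h₁⟩).1 ∈ dom I (I ∩ J) ∧
      (X I).tgt ((φ Finset.subset_union_left).arr ⟨a, h₁⟩).1 ∈ dom I (I ∩ J)),
    ((φ Finset.inter_subset_union).arr ⟨a, h⟩).1 =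
      ((φ Finset.inter_subset_left).arr
        ⟨((φ Finset.subset_union_left).arr ⟨a, h₁⟩).1, h₂⟩).1
  /-- `X_{I,J} = φ_{I∪J,I} (X_{I∪J,I∩J})` -/
  P4 : ∀ (I J : Finset ι) (y : (X I).Obj), y ∈ dom I J ↔
    ∃ x : ((X (I ∪ J)).restrict (dom (I ∪ J) I)).Obj,
      x.1 ∈ dom (I ∪ J) (I ∩ J) ∧ ((φ Finset.subset_union_left).obj x).1 = y
  /-- `X_{I,J} = φ_{I,I∩J}⁻¹ (X_{I∩J,I∪J})` -/
  P4' : ∀ (I J : Finset ι) (y : (X I).Obj), y ∈ dom I J ↔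
    ∃ h : y ∈ dom I (I ∩ J),
      ((φ Finset.inter_subset_left).obj ⟨y, h⟩).1 ∈ dom (I ∩ J) (I ∪ J)
  /-- `φ_{I,I∩J}` restricts to an orbifold vector bundle `X_{I,J} → X_{I∩J,I∪J}` -/
  bundle_inter : ∀ I J : Finset ι,
    ∃ ψ : Hom ((X I).restrict (dom I J)) ((X (I ∩ J)).restrict (dom (I ∩ J) (I ∪ J))),
      (∀ x (h : x.1 ∈ dom I (I ∩ J)),
        (ψ.obj x).1 = ((φ Finset.inter_subset_left).obj ⟨x.1, h⟩).1) ∧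
      (∀ a (h : (X I).src a.1 ∈ dom I (I ∩ J) ∧ (X I).tgt a.1 ∈ dom I (I ∩ J)),
        (ψ.arr a).1 = ((φ Finset.inter_subset_left).arr ⟨a.1, h⟩).1) ∧
      Nonempty (BundleStr.{v} (E' := Euc (dim I)) (E := Euc (dim (I ∩ J))) ψ)
  /-- `X_{I∪J,I∩J} = X_{I,J} ×_{X_{I∩J,I∪J}} X_{J,I}`: the map `(φ_{I∪J,I}, φ_{I∪J,J})` is a smooth
  embedding of `X_{I∪J,I∩J}` into `X_I × X_J` with image the fibre product. (The arrows of the fibre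
  product are then determined by those of the base, as its two factors are bundles.) -/
  fiberProduct : ∀ I J : Finset ι,
    let θ : ((X (I ∪ J)).restrict (dom (I ∪ J) (I ∩ J))).Obj → (X I).Obj × (X J).Obj := fun x =>
      (((φ Finset.subset_union_left).obj ⟨x.1, ((P1 I J).le x.2).1⟩).1,
        ((φ Finset.subset_union_right).obj ⟨x.1, ((P1 I J).le x.2).2⟩).1)
    Topology.IsEmbedding θ ∧
    ContMDiff 𝓘(ℝ, Euc (dim (I ∪ J))) (𝓘(ℝ, Euc (dim I)).prod 𝓘(ℝ, Euc (dim J))) ∞ θ ∧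
    (∀ x, Function.Injective
      (mfderiv 𝓘(ℝ, Euc (dim (I ∪ J))) (𝓘(ℝ, Euc (dim I)).prod 𝓘(ℝ, Euc (dim J))) θ x)) ∧
    Set.range θ = {p | p.1 ∈ dom I J ∧ p.2 ∈ dom J I ∧
      ∃ (h₁ : p.1 ∈ dom I (I ∩ J)) (h₂ : p.2 ∈ dom J (I ∩ J)),
        ((φ Finset.inter_subset_left).obj ⟨p.1, h₁⟩).1 =
          ((φ Finset.inter_subset_right).obj ⟨p.2, h₂⟩).1}

attribute [instance] VirtualOrbifold.charted

/-- A virtual bundle over a virtual orbifold: orbifold vector bundles `E_I → X_I` with isomorphisms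
`E_J|_{X_{J,I}} ≅ φ^*(X_{J,I} ⊕ E_I|_{X_{I,J}})` for `I ⊆ J`, where `X_{J,I}` is regarded as a
bundle over `X_{I,J}`. -/
structure VirtualBundle {ι : Type*} [DecidableEq ι] {X : Finset ι → TopGroupoid.{v}}
    (𝒱 : VirtualOrbifold X) where
  rank : Finset ι → ℕ
  bundle : ∀ I, OrbiBundle.{v, 0} (Euc (𝒱.dim I)) (X I) (Euc (rank I))
  split : ∀ {I J : Finset ι} (h : I ⊆ J) (x : ((X J).restrict (𝒱.dom J I)).Obj),
    (bundle J).Fib x.1 ≃ₗ[ℝ]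
      (𝒱.bundle h).V.Fib ((𝒱.φ h).obj x) × (bundle I).Fib ((𝒱.φ h).obj x).1
  smooth_split_fst : ∀ {I J : Finset ι} (h : I ⊆ J),
    ContMDiff (𝓘(ℝ, Euc (𝒱.dim J)).prod 𝓘(ℝ, Euc (rank J)))
      (𝓘(ℝ, Euc (𝒱.dim I)).prod 𝓘(ℝ, Euc (𝒱.bundle h).rank)) ∞
      (fun a : (⟨{a : (bundle J).Total | a.proj ∈ 𝒱.dom J I}, (𝒱.dom J I).isOpen.preimage
          (FiberBundle.continuous_proj (Euc (rank J)) (bundle J).Fib)⟩ : Opens (bundle J).Total) =>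
        (⟨(𝒱.φ h).obj ⟨a.1.proj, a.2⟩, (split h ⟨a.1.proj, a.2⟩ a.1.2).1⟩ :
          (𝒱.bundle h).V.Total))
  smooth_split_snd : ∀ {I J : Finset ι} (h : I ⊆ J),
    ContMDiff (𝓘(ℝ, Euc (𝒱.dim J)).prod 𝓘(ℝ, Euc (rank J)))
      (𝓘(ℝ, Euc (𝒱.dim I)).prod 𝓘(ℝ, Euc (rank I))) ∞
      (fun a : (⟨{a : (bundle J).Total | a.proj ∈ 𝒱.dom J I}, (𝒱.dom J I).isOpen.preimage
          (FiberBundle.continuous_proj (Euc (rank J)) (bundle J).Fib)⟩ : Opens (bundle J).Total) =>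
        (⟨((𝒱.φ h).obj ⟨a.1.proj, a.2⟩).1, (split h ⟨a.1.proj, a.2⟩ a.1.2).2⟩ :
          (bundle I).Total))
  equivariant : ∀ {I J : Finset ι} (h : I ⊆ J) (g : ((X J).restrict (𝒱.dom J I)).Arr)
    (a : (bundle J).Fib ((X J).src g.1)) (b : (bundle J).Fib ((X J).tgt g.1)),
    (bundle J).Acts g.1 ⟨_, a⟩ ⟨_, b⟩ →
    (𝒱.bundle h).V.Acts ((𝒱.φ h).arr g)
      ⟨_, (split h (((X J).restrict (𝒱.dom J I)).src g) a).1⟩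
      ⟨_, (split h (((X J).restrict (𝒱.dom J I)).tgt g) b).1⟩ ∧
    (bundle I).Acts ((𝒱.φ h).arr g).1
      ⟨_, (split h (((X J).restrict (𝒱.dom J I)).src g) a).2⟩
      ⟨_, (split h (((X J).restrict (𝒱.dom J I)).tgt g) b).2⟩

/-- Sections of a virtual bundle: `S_J (x, v) = (v, S_I x)` on `X_{J,I}` for `I ⊆ J`. -/
structure VirtualSection {ι : Type*} [DecidableEq ι] {X : Finset ι → TopGroupoid.{v}}
    {𝒱 : VirtualOrbifold X} (ℰ : VirtualBundle 𝒱) where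
  sec : ∀ I x, (ℰ.bundle I).Fib x
  smooth : ∀ I, ContMDiff 𝓘(ℝ, Euc (𝒱.dim I))
    (𝓘(ℝ, Euc (𝒱.dim I)).prod 𝓘(ℝ, Euc (ℰ.rank I))) ∞
    (fun x => (⟨x, sec I x⟩ : (ℰ.bundle I).Total))
  equivariant : ∀ I (g : (X I).Arr),
    (ℰ.bundle I).act g (sec I ((X I).src g)) = sec I ((X I).tgt g)
  compat_fst : ∀ {I J : Finset ι} (h : I ⊆ J) (x : ((X J).restrict (𝒱.dom J I)).Obj),
    (⟨(𝒱.φ h).obj x, (ℰ.split h x (sec J x.1)).1⟩ : (𝒱.bundle h).V.Total) = (𝒱.bundle h).e x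
  compat_snd : ∀ {I J : Finset ι} (h : I ⊆ J) (x : ((X J).restrict (𝒱.dom J I)).Obj),
    (ℰ.split h x (sec J x.1)).2 = sec I ((𝒱.φ h).obj x).1

/-! ### Fredholm systems -/

/-- A Fredholm system: a Banach orbifold bundle `bundle` over a Banach orbifold `B`, and a smooth
section `S` with compact moduli space `S⁻¹(0)`, whose linearizations along the moduli space are
Fredholm operators of index `index`. -/
structure FredholmSystem (E : Type*) [NormedAddCommGroup E] [NormedSpace ℝ E]
    (F : Type*) [NormedAddCommGroup F] [NormedSpace ℝ F] where
  B : TopGroupoid.{v}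
  [charted : ChartedSpace E B.Obj]
  isOrbifold : IsOrbifold E B
  bundle : OrbiBundle.{v, v} E B F
  S : ∀ x, bundle.Fib x
  smooth_S : ContMDiff 𝓘(ℝ, E) (𝓘(ℝ, E).prod 𝓘(ℝ, F)) ∞
    (fun x => (⟨x, S x⟩ : bundle.Total))
  equivariant_S : ∀ g : B.Arr, bundle.act g (S (B.src g)) = S (B.tgt g)
  compact_moduli : IsCompact
    ((Quot.mk _ : B.Obj → B.OrbitSpace) '' {x | S x = 0})
  index : ℤ
  /-- The linearization `T_xB → F_x` at a zero `x` is the derivative at `x` of `S`, written in a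
  chart of `B` and a trivialization of the bundle at `x`. -/
  fredholm : ∀ x, S x = 0 →
    let L : E →L[ℝ] F := fderiv ℝ
      (fun y => (trivializationAt F bundle.Fib x
        ⟨(extChartAt 𝓘(ℝ, E) x).symm y, S ((extChartAt 𝓘(ℝ, E) x).symm y)⟩).2)
      (extChartAt 𝓘(ℝ, E) x x)
    L.IsFredholm ∧
      (Module.finrank ℝ L.ker : ℤ) - (Module.finrank ℝ (F ⧸ L.range) : ℤ) = index

attribute [instance] FredholmSystem.charted

/-- The data `(U_i, O_i, s_i)` of a local stabilization system: over each open suborbifold `U i` a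
finite rank orbifold vector bundle `O i` and a bundle map `s i = η i • incl i` into the bundle of the
Fredholm system, where the cut-off function `η i` is `1` on `½U_i` (`Uhalf i`) and `0` outside
`¾U_i` (`Umid i`). -/
structure StabilizationData {E : Type*} [NormedAddCommGroup E] [NormedSpace ℝ E]
    {F : Type*} [NormedAddCommGroup F] [NormedSpace ℝ F] (𝔉 : FredholmSystem.{v} E F)
    (ι : Type*) where
  U : ι → Opens 𝔉.B.Obj
  Umid : ι → Opens 𝔉.B.Obj
  Uhalf : ι → Opens 𝔉.B.Obj
  invariant_U : ∀ i, 𝔉.B.Invariant (U i : Set 𝔉.B.Obj)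
  invariant_Umid : ∀ i, 𝔉.B.Invariant (Umid i : Set 𝔉.B.Obj)
  invariant_Uhalf : ∀ i, 𝔉.B.Invariant (Uhalf i : Set 𝔉.B.Obj)
  closure_Umid : ∀ i, closure (Umid i : Set 𝔉.B.Obj) ⊆ U i
  closure_Uhalf : ∀ i, closure (Uhalf i : Set 𝔉.B.Obj) ⊆ Umid i
  k : ι → ℕ
  O : ∀ i, OrbiBundle.{v, v} E (𝔉.B.restrict (U i)) (Euc (k i))
  incl : ∀ i (u : (𝔉.B.restrict (U i)).Obj), (O i).Fib u →ₗ[ℝ] 𝔉.bundle.Fib u.1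
  smooth_incl : ∀ i, ContMDiff (𝓘(ℝ, E).prod 𝓘(ℝ, Euc (k i))) (𝓘(ℝ, E).prod 𝓘(ℝ, F)) ∞
    (fun a : (O i).Total => (⟨a.proj.1, incl i a.proj a.2⟩ : 𝔉.bundle.Total))
  equivariant_incl : ∀ i (g : (𝔉.B.restrict (U i)).Arr) (a : (O i).Fib (TopGroupoid.src _ g)),
    incl i (TopGroupoid.tgt _ g) ((O i).act g a) =
      𝔉.bundle.act g.1 (incl i (TopGroupoid.src _ g) a)
  η : ι → 𝔉.B.Obj → ℝ
  smooth_η : ∀ i, ContMDiff 𝓘(ℝ, E) 𝓘(ℝ, ℝ) ∞ (η i)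
  invariant_η : ∀ i (g : 𝔉.B.Arr), η i (𝔉.B.src g) = η i (𝔉.B.tgt g)
  η_eq_one : ∀ i, ∀ x ∈ Uhalf i, η i x = 1
  η_eq_zero : ∀ i, ∀ x ∉ Umid i, η i x = 0

namespace StabilizationData

variable {E : Type*} [NormedAddCommGroup E] [NormedSpace ℝ E]
  {F : Type*} [NormedAddCommGroup F] [NormedSpace ℝ F] {𝔉 : FredholmSystem.{v} E F}
  {ι : Type} (𝒮 : StabilizationData 𝔉 ι)

/-- The bundle map `s_i = η_i • incl_i`. -/
def s (i : ι) (u : (𝔉.B.restrict (𝒮.U i)).Obj) : (𝒮.O i).Fib u →ₗ[ℝ] 𝔉.bundle.Fib u.1 :=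
  𝒮.η i u.1 • 𝒮.incl i u

/-- Points `(u, o)` of the bundle `O_I = ⨁_{i ∈ I} O_i` over an open set `A ⊆ ⋂_{i ∈ I} U_i`. -/
structure Pt (I : Finset ι) (A : Opens 𝔉.B.Obj) (hA : ∀ i ∈ I, A ≤ 𝒮.U i) where
  base : A
  vec : ∀ i : I, (𝒮.O i).Fib (𝔉.B.mkObj base.1 (hA i i.2 base.2))

section Pt

variable {𝒮} {I : Finset ι} {A : Opens 𝔉.B.Obj} {hA : ∀ i ∈ I, A ≤ 𝒮.U i}

/-- The component in `O_i` of a point of `O_I`. -/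
def Pt.tot (p : 𝒮.Pt I A hA) (i : I) : (𝒮.O i).Total :=
  ⟨𝔉.B.mkObj p.base.1 (hA i i.2 p.base.2), p.vec i⟩

/-- The topology of the direct sum: that of a fibre product of total spaces. -/
instance : TopologicalSpace (𝒮.Pt I A hA) :=
  TopologicalSpace.induced (fun p => (p.base, p.tot)) inferInstance

/-- `Ŝ(u, o) = S(u) + ∑_{i ∈ I} s_i(o_i)` vanishes at `p = (u, o)`. -/
def Pt.IsZero (p : 𝒮.Pt I A hA) : Prop :=
  𝔉.S p.base.1 + ∑ i : I, 𝒮.s i (𝔉.B.mkObj p.base.1 (hA i i.2 p.base.2)) (p.vec i) = 0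

/-- The map `Ŝ` on `O_I` near the fibre over `u₀`, written in a chart at `u₀` and in
trivializations of the bundles `O_i` and of the bundle of the Fredholm system at `u₀`. -/
def localRep (hA : ∀ i ∈ I, A ≤ 𝒮.U i) (u₀ : A) (z : E × (∀ i : I, Euc (𝒮.k i))) : F :=
  let u : A := (extChartAt 𝓘(ℝ, E) u₀).symm z.1
  (trivializationAt F 𝔉.bundle.Fib u₀.1
    ⟨u.1, 𝔉.S u.1 + ∑ i : I, 𝒮.s i (𝔉.B.mkObj u.1 (hA i i.2 u.2))
      ((trivializationAt (Euc (𝒮.k i)) (𝒮.O i).Fib (𝔉.B.mkObj u₀.1 (hA i i.2 u₀.2))).symm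
        (𝔉.B.mkObj u.1 (hA i i.2 u.2)) (z.2 i))⟩).2

/-- The linearization `L̂_{(u, o)} : T_{(u, o)} O_I → F_u` of `Ŝ` at a zero `p = (u, o)`. -/
def Pt.linearization (p : 𝒮.Pt I A hA) : (E × (∀ i : I, Euc (𝒮.k i))) →L[ℝ] F :=
  fderiv ℝ (localRep hA p.base) (extChartAt 𝓘(ℝ, E) p.base p.base,
    fun i => (trivializationAt (Euc (𝒮.k i)) (𝒮.O i).Fib
      (𝔉.B.mkObj p.base.1 (hA i i.2 p.base.2)) (p.tot i)).2)

/-- The linearization of `Ŝ` at `p` is a surjective Fredholm operator whose index is the index of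
the Fredholm system plus the rank of `O_I`. -/
def Pt.IsRegular (p : 𝒮.Pt I A hA) : Prop :=
  p.linearization.IsFredholm ∧ Function.Surjective p.linearization ∧
    (Module.finrank ℝ p.linearization.ker : ℤ) = 𝔉.index + ∑ i ∈ I, (𝒮.k i : ℤ)

/-- `g • p = q` for an arrow `g` of the base and points `p`, `q` of `O_I`. -/
def Pt.Acts (g : 𝔉.B.Arr) (p q : 𝒮.Pt I A hA) : Prop :=
  ∃ (hs : 𝔉.B.src g = p.base.1) (ht : 𝔉.B.tgt g = q.base.1), ∀ i : I,
    (𝒮.O i).Acts ⟨g, hs ▸ hA i i.2 p.base.2, ht ▸ hA i i.2 q.base.2⟩ (p.tot i) (q.tot i)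

end Pt

/-- The pair `(O_I, s_I)` stabilizes the Fredholm system at `A`. -/
def StabilizesAt (I : Finset ι) (A : Opens 𝔉.B.Obj) (hA : ∀ i ∈ I, A ≤ 𝒮.U i) : Prop :=
  ∀ p : 𝒮.Pt I A hA, p.IsZero → p.IsRegular

/-- The pieces `X_I = ⋂_{i ∈ I} U_i \ ⋃_{j ∉ I} closure (¾U_j)` of the base (`X_∅` lies in
`U_0 = B \ ⋃_i closure (½U_i)` automatically). -/
def piece [Finite ι] (I : Finset ι) : Opens 𝔉.B.Obj :=
  ⟨{x | (∀ i ∈ I, x ∈ 𝒮.U i) ∧ ∀ j ∉ I, x ∉ closure (𝒮.Umid j : Set 𝔉.B.Obj)}, by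
    have h : {x | (∀ i ∈ I, x ∈ 𝒮.U i) ∧ ∀ j ∉ I, x ∉ closure (𝒮.Umid j : Set 𝔉.B.Obj)} =
        (⋂ i ∈ I, (𝒮.U i : Set 𝔉.B.Obj)) ∩
          ⋂ j ∈ {j | j ∉ I}, (closure (𝒮.Umid j : Set 𝔉.B.Obj))ᶜ := by
      ext x; simp
    rw [h]
    exact (isOpen_biInter_finset fun i _ => (𝒮.U i).isOpen).inter
      ((Set.toFinite _).isOpen_biInter fun j _ => isClosed_closure.isOpen_compl)⟩

theorem piece_le [Finite ι] (I : Finset ι) : ∀ i ∈ I, 𝒮.piece I ≤ 𝒮.U i :=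
  fun i hi _ hx => hx.1 i hi

section Groupoid

variable {𝒮} {I : Finset ι} {A : Opens 𝔉.B.Obj} {hA : ∀ i ∈ I, A ≤ 𝒮.U i}

theorem Pt.acts_one (p : 𝒮.Pt I A hA) : Pt.Acts (𝔉.B.one p.base.1) p p :=
  ⟨𝔉.B.src_one _, 𝔉.B.tgt_one _, fun i => (𝒮.O i).acts_one (p.tot i)⟩

theorem Pt.acts_comp {g h : 𝔉.B.Arr} (e : 𝔉.B.src g = 𝔉.B.tgt h) {p q r : 𝒮.Pt I A hA}
    (hpq : Pt.Acts h p q) (hqr : Pt.Acts g q r) : Pt.Acts (𝔉.B.comp g h e) p r := by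
  obtain ⟨hs, ht, H⟩ := hpq
  obtain ⟨hs', ht', H'⟩ := hqr
  exact ⟨(𝔉.B.src_comp _ _ _).trans hs, (𝔉.B.tgt_comp _ _ _).trans ht',
    fun i => (𝒮.O i).acts_comp (g := ⟨g, _⟩) (h := ⟨h, _⟩) (Subtype.ext e) (H i) (H' i)⟩

theorem Pt.acts_inv {g : 𝔉.B.Arr} {p q : 𝒮.Pt I A hA} (hpq : Pt.Acts g p q) :
    Pt.Acts (𝔉.B.inv g) q p := by
  obtain ⟨hs, ht, H⟩ := hpq
  exact ⟨(𝔉.B.src_inv _).trans ht, (𝔉.B.tgt_inv _).trans hs, fun i => (𝒮.O i).acts_inv (H i)⟩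

theorem Pt.continuous_base : Continuous (fun p : 𝒮.Pt I A hA => p.base) :=
  continuous_fst.comp
    (continuous_induced_dom : Continuous (fun p : 𝒮.Pt I A hA => (p.base, p.tot)))

variable (𝒮 I A hA) in
/-- The orbifold `O_I` as a groupoid: the arrows from `p` to `q` are the arrows `g` of the base with
`g • p = q`. -/
def sumGroupoid : TopGroupoid.{v} where
  Obj := 𝒮.Pt I A hA
  Arr := {a : 𝔉.B.Arr × 𝒮.Pt I A hA × 𝒮.Pt I A hA // Pt.Acts a.1 a.2.1 a.2.2}
  src a := a.1.2.1
  tgt a := a.1.2.2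
  one p := ⟨(𝔉.B.one p.base.1, p, p), p.acts_one⟩
  inv a := ⟨(𝔉.B.inv a.1.1, a.1.2.2, a.1.2.1), Pt.acts_inv a.2⟩
  comp a b e := ⟨(𝔉.B.comp a.1.1 b.1.1
      (a.2.1.trans ((congrArg (fun p => p.base.1) e).trans b.2.2.1.symm)), b.1.2.1, a.1.2.2),
    Pt.acts_comp _ b.2 (show Pt.Acts a.1.1 b.1.2.2 a.1.2.2 from e ▸ a.2)⟩
  src_one _ := rfl
  tgt_one _ := rfl
  src_inv _ := rfl
  tgt_inv _ := rfl
  src_comp _ _ _ := rfl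
  tgt_comp _ _ _ := rfl
  comp_assoc a b c _ _ := Subtype.ext (Prod.ext (𝔉.B.comp_assoc _ _ _ _ _) rfl)
  one_comp a := by
    obtain ⟨⟨g, p, q⟩, hs, ht, H⟩ := a
    refine Subtype.ext (Prod.ext ?_ rfl)
    have := 𝔉.B.one_comp g
    simp only [ht] at this
    exact this
  comp_one a := by
    obtain ⟨⟨g, p, q⟩, hs, ht, H⟩ := a
    refine Subtype.ext (Prod.ext ?_ rfl)
    have := 𝔉.B.comp_one g
    simp only [hs] at this
    exact this
  inv_comp a := by
    obtain ⟨⟨g, p, q⟩, hs, ht, H⟩ := a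
    exact Subtype.ext (Prod.ext ((𝔉.B.inv_comp g).trans (congrArg _ hs)) rfl)
  comp_inv a := by
    obtain ⟨⟨g, p, q⟩, hs, ht, H⟩ := a
    exact Subtype.ext (Prod.ext ((𝔉.B.comp_inv g).trans (congrArg _ ht)) rfl)
  continuous_src := continuous_fst.comp (continuous_snd.comp continuous_subtype_val)
  continuous_tgt := continuous_snd.comp (continuous_snd.comp continuous_subtype_val)
  continuous_one := ((𝔉.B.continuous_one.comp
    (continuous_subtype_val.comp Pt.continuous_base)).prodMk
      (continuous_id.prodMk continuous_id)).subtype_mk _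
  continuous_inv := ((𝔉.B.continuous_inv.comp (continuous_fst.comp continuous_subtype_val)).prodMk
    ((continuous_snd.comp (continuous_snd.comp continuous_subtype_val)).prodMk
      (continuous_fst.comp (continuous_snd.comp continuous_subtype_val)))).subtype_mk _
  continuous_comp := by
    refine Continuous.subtype_mk (Continuous.prodMk ?_ (Continuous.prodMk ?_ ?_)) _
    · exact 𝔉.B.continuous_comp.comp (Continuous.subtype_mk (Continuous.prodMk
        (continuous_fst.comp (continuous_subtype_val.comp
          (continuous_fst.comp continuous_subtype_val)))
        (continuous_fst.comp (continuous_subtype_val.comp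
          (continuous_snd.comp continuous_subtype_val))))
        (fun p => p.1.1.2.1.trans ((congrArg (fun q => q.base.1) p.2).trans p.1.2.2.2.1.symm)))
    · exact continuous_fst.comp (continuous_snd.comp (continuous_subtype_val.comp
        (continuous_snd.comp continuous_subtype_val)))
    · exact continuous_snd.comp (continuous_snd.comp (continuous_subtype_val.comp
        (continuous_fst.comp continuous_subtype_val)))

variable (𝒮 I A hA) in
/-- The projection `𝔬 : O_I → B`. -/
def sumProj : Hom (𝒮.sumGroupoid I A hA) 𝔉.B where
  obj p := p.base.1
  arr a := a.1.1
  continuous_obj := continuous_subtype_val.comp Pt.continuous_base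
  continuous_arr := continuous_fst.comp continuous_subtype_val
  src_arr a := a.2.1
  tgt_arr a := a.2.2.1
  map_one _ := rfl
  map_comp _ _ _ := rfl

end Groupoid

/-- `V ≅ 𝔬^* ⨁_{j ∈ K} O_j` as orbifold vector bundles over `G`, for a functor `𝔬 : G → B` with
image in `⋂_{j ∈ K} U_j`: fibrewise linear isomorphisms whose components `V → O_j` are smooth and
equivariant. -/
structure PullbackSum (K : Finset ι) {E' : Type*} [NormedAddCommGroup E'] [NormedSpace ℝ E']
    {G : TopGroupoid.{v}} [ChartedSpace E' G.Obj] {R : Type*} [NormedAddCommGroup R]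
    [NormedSpace ℝ R] (V : OrbiBundle.{v, w} E' G R) (o : Hom G 𝔉.B) where
  mem : ∀ x, ∀ j ∈ K, o.obj x ∈ 𝒮.U j
  iso : ∀ x, V.Fib x ≃ₗ[ℝ] (∀ j : K, (𝒮.O j).Fib (𝔉.B.mkObj (o.obj x) (mem x j j.2)))
  smooth : ∀ j : K, ContMDiff (𝓘(ℝ, E').prod 𝓘(ℝ, R)) (𝓘(ℝ, E).prod 𝓘(ℝ, Euc (𝒮.k j))) ∞
    (fun a : V.Total =>
      (⟨𝔉.B.mkObj (o.obj a.proj) (mem a.proj j j.2), iso a.proj a.2 j⟩ : (𝒮.O j).Total))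
  equivariant : ∀ (g : G.Arr) (a : V.Fib (G.src g)) (b : V.Fib (G.tgt g)),
    V.Acts g ⟨_, a⟩ ⟨_, b⟩ → ∀ j : K,
    (𝒮.O j).Acts ⟨o.arr g, (o.src_arr g).symm ▸ mem _ j j.2, (o.tgt_arr g).symm ▸ mem _ j j.2⟩
      ⟨𝔉.B.mkObj (o.obj (G.src g)) (mem _ j j.2), iso _ a j⟩
      ⟨𝔉.B.mkObj (o.obj (G.tgt g)) (mem _ j j.2), iso _ b j⟩

/-- The component in `O_j` of a point of the total space of `V ≅ 𝔬^* ⨁_{j ∈ K} O_j`. -/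
def PullbackSum.tot {𝒮 : StabilizationData 𝔉 ι} {K : Finset ι} {E' : Type*} [NormedAddCommGroup E']
    [NormedSpace ℝ E'] {G : TopGroupoid.{v}} [ChartedSpace E' G.Obj] {R : Type*}
    [NormedAddCommGroup R] [NormedSpace ℝ R] {V : OrbiBundle.{v, w} E' G R} {o : Hom G 𝔉.B}
    (c : 𝒮.PullbackSum K V o) (a : V.Total) (j : K) : (𝒮.O j).Total :=
  ⟨𝔉.B.mkObj (o.obj a.proj) (c.mem a.proj j j.2), c.iso a.proj a.2 j⟩

theorem Uhalf_le (i : ι) : ∀ j ∈ ({i} : Finset ι), 𝒮.Uhalf i ≤ 𝒮.U j := by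
  intro j hj
  obtain rfl := Finset.mem_singleton.1 hj
  exact fun x hx => 𝒮.closure_Umid j (subset_closure (𝒮.closure_Uhalf j (subset_closure hx)))

/-- The data form a local stabilization system: `(O_i, s_i)` stabilizes the Fredholm system at
`½U_i`, and the sets `½U_i` cover the moduli space. -/
structure IsLocalStabilizationSystem : Prop where
  stabilizes : ∀ i, 𝒮.StabilizesAt {i} (𝒮.Uhalf i) (𝒮.Uhalf_le i)
  covers : ∀ x, 𝔉.S x = 0 → ∃ i, x ∈ 𝒮.Uhalf i

variable [Finite ι]

/-- The virtual neighborhood `W_I` over `X_I`, as a full subgroupoid of `O_I|_{X_I}`: the zeros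
of `Ŝ = S + s_I` at which the linearization is surjective and Fredholm of the expected index. These
are all the zeros if `(O_I, s_I)` stabilizes the system at `X_I`. -/
def W (I : Finset ι) : TopGroupoid.{v} :=
  (𝒮.sumGroupoid I (𝒮.piece I) (𝒮.piece_le I)).full {p | p.IsZero ∧ p.IsRegular}

/-- The projection `𝔬_I : W_I → X_I ⊆ B`. -/
def anchor (I : Finset ι) : Hom (𝒮.W I) 𝔉.B :=
  (𝒮.sumProj I (𝒮.piece I) (𝒮.piece_le I)).comp (TopGroupoid.incl _ _)

variable {𝒮} in
/-- A point of `W_I` as a point of `O_I`. -/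
def pt {I : Finset ι} (x : (𝒮.W I).Obj) : 𝒮.Pt I (𝒮.piece I) (𝒮.piece_le I) := x.1

end StabilizationData

end VirtualOrb

end

/-! Fix `I`. In a chart of the base and trivializations, `Ŝ` is a smooth map of Banach spaces. At a
regular zero its derivative is onto with kernel of finite dimension `n`, hence complemented kernel,
so `Ŝ` paired with a projection to that kernel is a local diffeomorphism onto an open set of `F ×
ℝⁿ` (`exists_slice_of_contDiffOn`). It straightens the zero set to `{0} × ℝⁿ`. Regularity is an open
condition, so zeros near a regular zero are regular, and `W_I` is a submanifold of `O_I`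
(`exists_sliceChart`). The map `Ŝ` is equivariant, and at a zero its derivatives before and after an
arrow, in any trivializations, differ only by isomorphisms on both sides (`Pt.Acts.isRegularOp`).
Hence `W_I` is an invariant subset and inherits an étale proper groupoid from `O_I`
(`isOrbifold_W`).

Now let `I ⊆ J`. The set `X_I` misses the closure of `¾U_j` for `j ∉ I`, so over `X_I` the cut-offs
`η_j` with `j ∈ J - I` vanish on a neighbourhood of each point. There `Ŝ_J` does not depend on
`o_{J-I}`: the point `(u, o_J)` is a zero exactly if `(u, o_I)` is, and the linearization for `J` is
the one for `I` after the projection. One is onto exactly if the other is, and the kernels differ by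
the rank of `O_{J-I}` (`Pt.Agree.isRegular_iff`). So over `X_I ∩ X_J` the vector `o_{J-I}` is free,
which makes `W_{J,I} → W_{I,J}` the bundle `𝔬^* O_{J-I}` (`dropBundle`). The axioms on overlaps come
from `X_I ∩ X_J = X_{I∪J} ∩ X_{I∩J}` (`mem_piece_and_mem_piece`), and the fibre product from gluing
the components indexed by `I` and by `J`.

The obstruction bundles split componentwise. A zero of `σ` has `o = 0`, where `Ŝ = S`. Conversely, a
point of `M ∩ X_I` lies in some `½U_i`, necessarily with `i ∈ I`; there `O_i` alone already makes
the linearization onto, and adding further summands keeps it onto, so `(u, 0)` lies in `W_I`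
(`image_zeros_diagonal`).

Smoothness, convergence and identities are tested throughout on the base point and the components in
the `O_i` (`contMDiffAt_sum`, `contMDiffAt_W`, `W_tendsto_iff`, `W_ext`). -/

noncomputable section

namespace VirtualOrb

/-! ### Surjective operators with finite-dimensional kernel -/

section LinearAlgebra

variable {V : Type*} [NormedAddCommGroup V] [NormedSpace ℝ V]
  {V' : Type*} [NormedAddCommGroup V'] [NormedSpace ℝ V']
  {F : Type*} [NormedAddCommGroup F] [NormedSpace ℝ F]
  {F' : Type*} [NormedAddCommGroup F'] [NormedSpace ℝ F']
  {W : Type*} [AddCommGroup W] [Module ℝ W]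

/-- A surjective operator with kernel of finite dimension `n`. -/
structure IsRegularOp (n : ℕ) (L : V →L[ℝ] F) : Prop where
  surjective : Function.Surjective L
  finite_ker : FiniteDimensional ℝ L.ker
  finrank_ker : Module.finrank ℝ L.ker = n

/-- The open mapping theorem makes a surjection strict, and a finite-dimensional kernel has a closed
complement. Everything else is done with the purely algebraic data of `IsRegularOp`; this is how to
return to Fredholm operators. -/
theorem IsRegularOp.isFredholm [CompleteSpace V] [CompleteSpace F] {n : ℕ} {L : V →L[ℝ] F}
    (h : IsRegularOp n L) : L.IsFredholm where
  isStrictMap := (L.isOpenMap h.surjective).isQuotientMap L.continuous h.surjective |>.isStrictMap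
  isClosed_range := by
    have : (L.range : Set F) = univ := by
      rw [LinearMap.coe_range]; exact h.surjective.range_eq
    rw [this]; exact isClosed_univ
  finite_ker := h.finite_ker
  finite_coker := by
    have : L.range = ⊤ := LinearMap.range_eq_top.2 h.surjective
    rw [this]; exact Submodule.CoFG.top
  closedComplemented_ker :=
    have := h.finite_ker
    Submodule.ClosedComplemented.of_finiteDimensional _

/-- Regularity is preserved under linear equivalences of source and target. -/
theorem IsRegularOp.of_conj {n : ℕ} {L : V →L[ℝ] F} (h : IsRegularOp n L) {L' : V' →L[ℝ] F'}
    (e : V' →ₗ[ℝ] V) (he : Function.Bijective e) (a : F →ₗ[ℝ] F') (ha : Function.Bijective a)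
    (H : ∀ v, L' v = a (L (e v))) : IsRegularOp n L' := by
  have := h.finite_ker
  have hk : ∀ v, v ∈ L'.ker ↔ e v ∈ L.ker := by
    intro v
    simp only [LinearMap.mem_ker, ContinuousLinearMap.coe_coe, H]
    exact map_eq_zero_iff a ha.1
  let ε : L'.ker ≃ₗ[ℝ] L.ker := LinearEquiv.ofBijective
    ((e.comp L'.ker.subtype).codRestrict L.ker fun v => (hk v).1 v.2) (by
      constructor
      · intro v w hvw
        exact Subtype.ext (he.1 (congrArg Subtype.val hvw))
      · rintro ⟨w, hw⟩
        obtain ⟨v, rfl⟩ := he.2 w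
        exact ⟨⟨v, (hk v).2 hw⟩, rfl⟩)
  refine ⟨?_, ε.symm.finiteDimensional, ?_⟩
  · have : (L' : V' → F') = a ∘ L ∘ e := funext H
    rw [this]
    exact ha.2.comp (h.surjective.comp he.2)
  · rw [ε.finrank_eq, h.finrank_ker]

/-- If `L` restricted to the subspace `V'` of `V` is regular, so is `L`, and the kernel grows by the
codimension of `V'`. -/
theorem IsRegularOp.extend {n m : ℕ} {L' : V' →L[ℝ] F} (h : IsRegularOp n L') {L : V →L[ℝ] F}
    (j : V' →ₗ[ℝ] V) (c : V →ₗ[ℝ] W) (hj : Function.Injective j) (hc : Function.Surjective c)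
    (hjc : Function.Exact j c) (H : ∀ v, L (j v) = L' v) [FiniteDimensional ℝ W]
    (hm : Module.finrank ℝ W = m) : IsRegularOp (n + m) L := by
  have := h.finite_ker
  have hj' : ∀ v : L'.ker, j v ∈ L.ker := fun v => by
    simpa only [LinearMap.mem_ker, ContinuousLinearMap.coe_coe, H] using v.2
  let f : L'.ker →ₗ[ℝ] L.ker := (j.comp L'.ker.subtype).codRestrict _ hj'
  let g : L.ker →ₗ[ℝ] W := c.comp L.ker.subtype
  have hf : Function.Injective f := fun v w e => Subtype.ext (hj (congrArg Subtype.val e))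
  have hfg : Function.Exact f g := by
    intro x
    constructor
    · intro hx
      obtain ⟨y, hy⟩ := (hjc x).1 hx
      refine ⟨⟨y, ?_⟩, Subtype.ext hy⟩
      have := x.2
      rw [← hy] at this
      simpa only [LinearMap.mem_ker, ContinuousLinearMap.coe_coe, H] using this
    · rintro ⟨y, rfl⟩
      exact (hjc _).2 ⟨y, rfl⟩
  have hg : Function.Surjective g := by
    intro w
    obtain ⟨v, rfl⟩ := hc w
    -- Correct the lift `v` of `w` to an element of the kernel: subtracting `j v'` with `L' v' = L
    -- v` kills `L v` and does not change the image in `W`. This gives the exact sequence `0 → ker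
    -- L' → ker L → W → 0`, from which the dimension is counted.
    obtain ⟨v', hv'⟩ := h.surjective (L v)
    refine ⟨⟨v - j v', ?_⟩, ?_⟩
    · simp [H, hv']
    · have : c (j v') = 0 := (hjc _).2 ⟨v', rfl⟩
      simp [g, this]
  have hfin : FiniteDimensional ℝ L.ker := by
    have h1 : FiniteDimensional ℝ (LinearMap.ker g) := by
      rw [hfg.linearMap_ker_eq]; infer_instance
    have h2 : FiniteDimensional ℝ (L.ker ⧸ LinearMap.ker g) :=
      (g.quotKerEquivOfSurjective hg).symm.finiteDimensional
    exact Module.Finite.of_submodule_quotient (LinearMap.ker g)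
  refine ⟨fun y => ?_, hfin, ?_⟩
  · obtain ⟨v, hv⟩ := h.surjective y
    exact ⟨j v, (H v).trans hv⟩
  · have h1 := g.finrank_range_add_finrank_ker
    rw [hfg.linearMap_ker_eq, LinearMap.finrank_range_of_inj hf, h.finrank_ker,
      LinearMap.range_eq_top.2 hg, finrank_top, hm] at h1
    omega

/-- If `L` factors through a surjection onto `V'` with finite-dimensional kernel and is regular, so
is the induced operator on `V'`. -/
theorem IsRegularOp.descend {n m : ℕ} {L : V →L[ℝ] F} (h : IsRegularOp n L) {L' : V' →L[ℝ] F}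
    (j : V' →ₗ[ℝ] V) (c : V →ₗ[ℝ] W) (p : V →ₗ[ℝ] V') (hc : Function.Surjective c)
    (hjc : Function.Exact j c) (hpj : ∀ v, p (j v) = v) (H : ∀ v, L v = L' (p v))
    [FiniteDimensional ℝ W] (hm : Module.finrank ℝ W = m) :
    m ≤ n ∧ IsRegularOp (n - m) L' := by
  have := h.finite_ker
  have H' : ∀ v, L (j v) = L' v := fun v => by rw [H, hpj]
  have hj : Function.Injective j := fun v w e => by rw [← hpj v, e, hpj]
  have hj' : ∀ v : L'.ker, j v ∈ L.ker := fun v => by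
    simpa only [LinearMap.mem_ker, ContinuousLinearMap.coe_coe, H'] using v.2
  let f : L'.ker →ₗ[ℝ] L.ker := (j.comp L'.ker.subtype).codRestrict _ hj'
  have hf : Function.Injective f := fun v w e => Subtype.ext (hj (congrArg Subtype.val e))
  -- The dimension of `ker L'` is taken as an unknown; `extend` then goes back to `L` and determines
  -- it. This also yields `m ≤ n`, so that the subtraction in the conclusion is not truncated.
  have h' : IsRegularOp (Module.finrank ℝ L'.ker) L' := by
    refine ⟨fun y => ?_, Module.Finite.of_injective f hf, rfl⟩
    obtain ⟨v, hv⟩ := h.surjective y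
    exact ⟨p v, (H v).symm.trans hv⟩
  have h2 := (h'.extend j c hj hc hjc H' hm).finrank_ker
  rw [h.finrank_ker] at h2
  refine ⟨by omega, ?_⟩
  rwa [show n - m = Module.finrank ℝ L'.ker by omega]

/-- An operator whose pairing with some `P` is bijective is regular. -/
theorem isRegularOp_of_prod {n : ℕ} {L : V →L[ℝ] F} {P : V →L[ℝ] Euc n}
    (hb : Function.Bijective (L.prod P)) : IsRegularOp n L := by
  have h : IsRegularOp n (ContinuousLinearMap.fst ℝ F (Euc n)) := by
    let ε : (ContinuousLinearMap.fst ℝ F (Euc n)).ker ≃ₗ[ℝ] Euc n :=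
      { toFun := fun x => x.1.2
        map_add' := fun _ _ => rfl
        map_smul' := fun _ _ => rfl
        invFun := fun w => ⟨(0, w), rfl⟩
        left_inv := fun x => Subtype.ext (Prod.ext (Eq.symm x.2) rfl)
        right_inv := fun _ => rfl }
    exact ⟨fun y => ⟨(y, 0), rfl⟩, ε.symm.finiteDimensional, by rw [ε.finrank_eq]; simp⟩
  -- `L` is the first projection of `F × ℝⁿ` after the bijection `(L, P)`.
  exact h.of_conj (L.prod P).toLinearMap hb LinearMap.id Function.bijective_id fun _ => rfl

end LinearAlgebra

/-! ### The inverse function theorem at a regular point -/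

section Slice

variable {V : Type*} [NormedAddCommGroup V] [NormedSpace ℝ V] [CompleteSpace V]
  {F : Type*} [NormedAddCommGroup F] [NormedSpace ℝ F] [CompleteSpace F]

/-- A regular operator splits off its kernel. -/
theorem IsRegularOp.exists_equiv {n : ℕ} {L : V →L[ℝ] F} (h : IsRegularOp n L) :
    ∃ (P : V →L[ℝ] Euc n) (e : V ≃L[ℝ] F × Euc n), (e : V →L[ℝ] F × Euc n) = L.prod P := by
  have := h.finite_ker
  obtain ⟨p, hp⟩ := Submodule.ClosedComplemented.of_finiteDimensional L.ker
  let ε : L.ker ≃L[ℝ] Euc n := ContinuousLinearEquiv.ofFinrankEq (by simp [h.finrank_ker])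
  let P : V →L[ℝ] Euc n := (ε : L.ker →L[ℝ] Euc n).comp p
  have hinj : (L.prod P).ker = ⊥ := by
    refine LinearMap.ker_eq_bot'.2 fun v hv => ?_
    have h1 : L v = 0 := congrArg Prod.fst hv
    have h2 : ε (p v) = 0 := congrArg Prod.snd hv
    have h3 : p v = 0 := by simpa using h2
    have := hp ⟨v, h1⟩
    rw [h3] at this
    exact (congrArg Subtype.val this).symm
  have hsurj : (L.prod P).range = ⊤ := by
    refine LinearMap.range_eq_top.2 ?_
    rintro ⟨y, w⟩
    obtain ⟨v, hv⟩ := h.surjective y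
    -- Adding a kernel vector leaves `L v` alone, and `ε⁻¹ w - p v` is the one which moves the
    -- kernel component of `v` to `ε⁻¹ w`.
    have hk : ((ε.symm w - p v : L.ker) : V) ∈ L.ker := (ε.symm w - p v : L.ker).2
    refine ⟨v + (ε.symm w - p v : L.ker), Prod.ext ?_ ?_⟩
    · change L (v + (ε.symm w - p v : L.ker)) = y
      rw [map_add, hv, show L ((ε.symm w - p v : L.ker) : V) = 0 from hk, add_zero]
    · change ε (p (v + (ε.symm w - p v : L.ker))) = w
      rw [map_add, hp]
      simp
  exact ⟨P, ContinuousLinearEquiv.ofBijective (L.prod P) hinj hsurj,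
    ContinuousLinearEquiv.coe_ofBijective _ _ _⟩

/-- A smooth map with regular derivative at a point is, near this point, the first component of a
diffeomorphism to `F × ℝⁿ`. -/
theorem exists_slice_of_contDiffOn {n : ℕ} {f : V → F} {U : Set V} (hU : IsOpen U) {z₀ : V}
    (hz₀ : z₀ ∈ U) (hf : ContDiffOn ℝ ∞ f U) (hreg : IsRegularOp n (fderiv ℝ f z₀)) :
    ∃ Θ : OpenPartialHomeomorph V (F × Euc n), z₀ ∈ Θ.source ∧ Θ.source ⊆ U ∧
      ContDiffOn ℝ ∞ Θ Θ.source ∧ ContDiffOn ℝ ∞ Θ.symm Θ.target ∧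
      (∀ z ∈ Θ.source, (Θ z).1 = f z) ∧ ∀ z ∈ Θ.source, IsRegularOp n (fderiv ℝ f z) := by
  obtain ⟨P, e, he⟩ := hreg.exists_equiv
  let θ : V → F × Euc n := fun z => (f z, P z)
  have hfat : ∀ z ∈ U, ContDiffAt ℝ ∞ f z := fun z hz => (hf z hz).contDiffAt (hU.mem_nhds hz)
  have hθat : ∀ z ∈ U, ContDiffAt ℝ ∞ θ z := fun z hz => (hfat z hz).prodMk P.contDiff.contDiffAt
  have hθd : ∀ z ∈ U, HasFDerivAt θ ((fderiv ℝ f z).prod P) z := fun z hz =>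
    (((hfat z hz).differentiableAt (by simp)).hasFDerivAt).prodMk P.hasFDerivAt
  have hd0 : HasFDerivAt θ (e : V →L[ℝ] F × Euc n) z₀ := by rw [he]; exact hθd z₀ hz₀
  let Θ₀ := (hθat z₀ hz₀).toOpenPartialHomeomorph θ hd0 (by simp)
  have hΘ₀ : (Θ₀ : V → F × Euc n) = θ := ContDiffAt.toOpenPartialHomeomorph_coe _ _ _
  have hcont : ContinuousOn (fun z => (fderiv ℝ f z).prod P) U := by
    have h1 : ContinuousOn (fderiv ℝ f) U := hf.continuousOn_fderiv_of_isOpen hU (by simp)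
    have : ∀ z, (fderiv ℝ f z).prod P =
      ContinuousLinearMap.prodₗᵢ ℝ (fderiv ℝ f z, P) := fun _ => rfl
    simp only [this]
    exact (ContinuousLinearMap.prodₗᵢ ℝ).continuous.comp_continuousOn
      (h1.prodMk continuousOn_const)
  -- Invertible operators form an open set, so `(Df, P)` is still invertible near `z₀`. On this set
  -- the local inverse is smooth and `Df` is regular; the chart is shrunk to it for both reasons.
  let O : Set V := U ∩ (fun z => (fderiv ℝ f z).prod P) ⁻¹'
    range (ContinuousLinearEquiv.toContinuousLinearMap : (V ≃L[ℝ] F × Euc n) → _)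
  have hO : IsOpen O := hcont.isOpen_inter_preimage hU ContinuousLinearEquiv.isOpen
  have hz₀O : z₀ ∈ O := ⟨hz₀, e, he⟩
  refine ⟨Θ₀.restr O, ?_, ?_, ?_, ?_, ?_, ?_⟩
  · rw [OpenPartialHomeomorph.restr_source, hO.interior_eq]
    exact ⟨ContDiffAt.mem_toOpenPartialHomeomorph_source _ _ _, hz₀O⟩
  all_goals
    have hsrc : (Θ₀.restr O).source = Θ₀.source ∩ O := by
      rw [OpenPartialHomeomorph.restr_source, hO.interior_eq]
  · rw [hsrc]; exact fun z hz => hz.2.1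
  · intro z hz
    rw [hsrc] at hz
    rw [OpenPartialHomeomorph.restr_apply, hΘ₀]
    exact (hθat z hz.2.1).contDiffWithinAt
  · intro y hy
    have hs : (Θ₀.restr O).symm y ∈ Θ₀.source ∩ O := by
      rw [← hsrc]; exact (Θ₀.restr O).map_target hy
    obtain ⟨ε, hε⟩ := hs.2.2
    refine ((Θ₀.restr O).contDiffAt_symm (f₀' := ε) hy ?_ ?_).contDiffWithinAt
    · rw [OpenPartialHomeomorph.restr_apply, hΘ₀, hε]; exact hθd _ hs.2.1
    · rw [OpenPartialHomeomorph.restr_apply, hΘ₀]; exact hθat _ hs.2.1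
  · intro z hz
    rw [OpenPartialHomeomorph.restr_apply, hΘ₀]
  · intro z hz
    rw [hsrc] at hz
    obtain ⟨ε, hε⟩ := hz.2.2
    refine isRegularOp_of_prod (P := P) ?_
    change Function.Bijective ((fun z => (fderiv ℝ f z).prod P) z)
    rw [← hε]
    exact ε.bijective

end Slice

end VirtualOrb
end

noncomputable section

namespace VirtualOrb

/-! ### Slice charts and the manifold structure of a level set -/

section SliceManifold

variable {V : Type*} [NormedAddCommGroup V] [NormedSpace ℝ V]
  {F : Type*} [NormedAddCommGroup F] [NormedSpace ℝ F]
  {H : Type*} [TopologicalSpace H] {I : ModelWithCorners ℝ V H}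
  {M : Type*} [TopologicalSpace M] [ChartedSpace H M]

/-- Level sets of submersions have slice charts. -/
theorem exists_slice [CompleteSpace V] [CompleteSpace F] [I.Boundaryless] [IsManifold I ∞ M]
    {n : ℕ} {g : M → F} {O : Set M} (hO : IsOpen O)
    {m₀ : M} (hm₀ : m₀ ∈ O) (hg : ContMDiffOn I 𝓘(ℝ, F) ∞ g O)
    (hreg : IsRegularOp (V := V) (F := F) n (mfderiv I 𝓘(ℝ, F) g m₀)) :
    ∃ Θ : OpenPartialHomeomorph M (F × Euc n), m₀ ∈ Θ.source ∧ Θ.source ⊆ O ∧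
      ContMDiffOn I 𝓘(ℝ, F × Euc n) ∞ Θ Θ.source ∧
      ContMDiffOn 𝓘(ℝ, F × Euc n) I ∞ Θ.symm Θ.target ∧
      (∀ m ∈ Θ.source, (Θ m).1 = g m) ∧
      ∀ m ∈ Θ.source, IsRegularOp (V := V) (F := F) n (mfderiv I 𝓘(ℝ, F) g m) := by
  have : IsManifold I 1 M := IsManifold.of_le (n := ∞) (by simp)
  -- The extended chart as a partial homeomorphism with open target, possible as the model has no
  -- boundary; it transports the problem to `V`.
  let χ : OpenPartialHomeomorph M V :=
    (chartAt H m₀).trans I.toHomeomorph.toOpenPartialHomeomorph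
  have hχ : (χ : M → V) = extChartAt I m₀ := rfl
  have hχs : χ.source = (chartAt H m₀).source := by simp [χ]
  have hχs' : χ.source = (extChartAt I m₀).source := by rw [hχs, extChartAt_source]
  have hχt : χ.target = (extChartAt I m₀).target := by
    simp only [χ, mfld_simps, I.range_eq_univ]
    rfl
  have hsm : ContMDiffOn I 𝓘(ℝ, V) ∞ χ χ.source := by
    rw [hχs]; exact contMDiffOn_extChartAt
  have hsm' : ContMDiffOn 𝓘(ℝ, V) I ∞ χ.symm χ.target := by
    rw [hχt]; exact contMDiffOn_extChartAt_symm m₀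
  let f : V → F := g ∘ χ.symm
  let U : Set V := χ.target ∩ χ.symm ⁻¹' O
  have hU : IsOpen U := χ.symm.isOpen_inter_preimage hO
  have hf : ContMDiffOn 𝓘(ℝ, V) 𝓘(ℝ, F) ∞ f U :=
    hg.comp (hsm'.mono inter_subset_left) fun z hz => hz.2
  have hfd : ContDiffOn ℝ ∞ f U := hf.contDiffOn
  have hmem : ∀ m ∈ χ.source, m ∈ O → χ m ∈ U := fun m hm hmO =>
    ⟨χ.map_source hm, by simpa only [mem_preimage, χ.left_inv hm] using hmO⟩
  -- The derivative of `g` is that of its coordinate expression up to an isomorphism of the source.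
  -- This carries regularity into the chart at `m₀` and back to `M` at every point of the slice.
  have hder : ∀ m ∈ χ.source, m ∈ O → ∃ A : V →L[ℝ] V, Function.Bijective A ∧
      ∀ v, (mfderiv I 𝓘(ℝ, F) g m : V →L[ℝ] F) v = fderiv ℝ f (χ m) (A v) := by
    intro m hm hmO
    have hm' : m ∈ (extChartAt I m₀).source := by rwa [← hχs']
    obtain ⟨e, he⟩ := isInvertible_mfderiv_extChartAt hm'
    refine ⟨mfderiv I 𝓘(ℝ, V) (extChartAt I m₀) m, by rw [← he]; exact e.bijective, fun v => ?_⟩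
    have heq : g =ᶠ[𝓝 m] f ∘ χ := by
      filter_upwards [χ.open_source.mem_nhds hm] with q hq
      simp only [f, Function.comp, χ.left_inv hq]
    have h1 : MDifferentiableAt 𝓘(ℝ, V) 𝓘(ℝ, F) f (χ m) :=
      ((hf _ (hmem m hm hmO)).contMDiffAt (hU.mem_nhds (hmem m hm hmO))).mdifferentiableAt
        (by simp)
    have h2 : MDifferentiableAt I 𝓘(ℝ, V) χ m :=
      ((hsm _ hm).contMDiffAt (χ.open_source.mem_nhds hm)).mdifferentiableAt (by simp)
    rw [heq.mfderiv_eq, mfderiv_comp m h1 h2, mfderiv_eq_fderiv]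
    rfl
  have hm₀s : m₀ ∈ χ.source := by rw [hχs]; exact mem_chart_source H m₀
  obtain ⟨A₀, hA₀, hA₀'⟩ := hder m₀ hm₀s hm₀
  let ε : V ≃ₗ[ℝ] V := LinearEquiv.ofBijective A₀.toLinearMap hA₀
  have hreg' : IsRegularOp n (fderiv ℝ f (χ m₀)) := by
    refine hreg.of_conj ε.symm.toLinearMap ε.symm.bijective LinearMap.id Function.bijective_id
      fun v => ?_
    have := hA₀' (ε.symm v)
    refine Eq.trans ?_ this.symm
    exact congrArg _ (ε.apply_symm_apply v).symm
  obtain ⟨Θ₀, h0, h1, h2, h3, h4, h5⟩ := exists_slice_of_contDiffOn hU (hmem m₀ hm₀s hm₀) hfd hreg'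
  have hmaps : ∀ m ∈ (χ.trans Θ₀).source, m ∈ χ.source ∧ m ∈ O ∧ χ m ∈ Θ₀.source := by
    intro m hm
    rw [OpenPartialHomeomorph.trans_source] at hm
    refine ⟨hm.1, ?_, hm.2⟩
    have := (h1 hm.2).2
    rwa [mem_preimage, χ.left_inv hm.1] at this
  refine ⟨χ.trans Θ₀, ?_, fun m hm => (hmaps m hm).2.1, ?_, ?_, ?_, ?_⟩
  · rw [OpenPartialHomeomorph.trans_source]; exact ⟨hm₀s, h0⟩
  · exact h2.contMDiffOn.comp (hsm.mono fun m hm => (hmaps m hm).1) fun m hm => (hmaps m hm).2.2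
  · rw [OpenPartialHomeomorph.trans_target]
    exact hsm'.comp (h3.contMDiffOn.mono inter_subset_left) fun y hy => hy.2
  · intro m hm
    obtain ⟨a, -, b⟩ := hmaps m hm
    rw [OpenPartialHomeomorph.trans_apply, h4 _ b]
    simp only [f, Function.comp, χ.left_inv a]
  · intro m hm
    obtain ⟨a, b, c⟩ := hmaps m hm
    obtain ⟨A, hA, hA'⟩ := hder m a b
    exact (h5 _ c).of_conj A.toLinearMap hA LinearMap.id Function.bijective_id hA'

/-- A slice chart at `p` for the image of `j : Z → M`: a diffeomorphism from an open set of `M` to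
an open set of `F × ℝⁿ` which straightens the image of `j` to `{0} × ℝⁿ`. -/
structure SliceChart (I : ModelWithCorners ℝ V H) (F : Type*) [NormedAddCommGroup F]
    [NormedSpace ℝ F] (n : ℕ) {Z : Type*} (j : Z → M) (p : Z) where
  chart : OpenPartialHomeomorph M (F × Euc n)
  mem_source : j p ∈ chart.source
  smooth : ContMDiffOn I 𝓘(ℝ, F × Euc n) ∞ chart chart.source
  smooth_symm : ContMDiffOn 𝓘(ℝ, F × Euc n) I ∞ chart.symm chart.target
  slice : ∀ m ∈ chart.source, m ∈ range j ↔ (chart m).1 = 0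

variable {n : ℕ} {Z : Type*} [TopologicalSpace Z] {j : Z → M}

open Classical in
/-- The chart of `Z` given by a slice chart. -/
def SliceChart.toChart (hj : Topology.IsEmbedding j) {p : Z} (c : SliceChart I F n j p) :
    OpenPartialHomeomorph Z (Euc n) where
  toFun q := (c.chart (j q)).2
  -- On the target the slice condition puts the ambient point in the range of `j`; the value `p` is
  -- a default off the target.
  invFun y := if h : c.chart.symm (0, y) ∈ range j then h.choose else p
  source := j ⁻¹' c.chart.source
  target := {y | ((0 : F), y) ∈ c.chart.target}
  map_source' q hq := by
    have h1 := (c.slice _ hq).1 ⟨q, rfl⟩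
    have h2 := c.chart.map_source hq
    change ((0 : F), (c.chart (j q)).2) ∈ c.chart.target
    rw [← h1]
    exact h2
  map_target' y hy := by
    have h1 := c.chart.map_target hy
    have h2 : c.chart.symm (0, y) ∈ range j :=
      (c.slice _ h1).2 (by rw [c.chart.right_inv hy])
    rw [dif_pos h2, mem_preimage, h2.choose_spec]
    exact h1
  left_inv' q hq := by
    have h1 : ((0 : F), (c.chart (j q)).2) = c.chart (j q) :=
      Prod.ext ((c.slice _ hq).1 ⟨q, rfl⟩).symm rfl
    have h2 : c.chart.symm (0, (c.chart (j q)).2) = j q := by rw [h1, c.chart.left_inv hq]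
    have h3 : c.chart.symm (0, (c.chart (j q)).2) ∈ range j := ⟨q, h2.symm⟩
    rw [dif_pos h3]
    exact hj.injective (h3.choose_spec.trans h2)
  right_inv' y hy := by
    have h1 := c.chart.map_target hy
    have h2 : c.chart.symm (0, y) ∈ range j :=
      (c.slice _ h1).2 (by rw [c.chart.right_inv hy])
    rw [dif_pos h2, h2.choose_spec, c.chart.right_inv hy]
  open_source := c.chart.open_source.preimage hj.continuous
  open_target := c.chart.open_target.preimage (Continuous.prodMk_right 0)
  continuousOn_toFun := continuous_snd.comp_continuousOn
    (c.chart.continuousOn.comp hj.continuous.continuousOn fun _ hq => hq)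
  continuousOn_invFun := by
    -- Continuity into `Z` is tested after the embedding `j`, where the choice in the inverse
    -- disappears.
    rw [hj.continuousOn_iff]
    refine (c.chart.continuousOn_symm.comp
      (Continuous.prodMk_right (0 : F)).continuousOn fun y hy => hy).congr fun y hy => ?_
    have h1 := c.chart.map_target hy
    have h2 : c.chart.symm (0, y) ∈ range j :=
      (c.slice _ h1).2 (by rw [c.chart.right_inv hy])
    simp only [Function.comp, dif_pos h2, h2.choose_spec]

/-- Injectivity is not needed: the chosen preimage is by definition mapped by `j` to the ambient
point. Every smoothness statement about the inverse chart is reduced to the ambient inverse through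
this identity. -/
theorem SliceChart.toChart_symm (hj : Topology.IsEmbedding j) {p : Z} (c : SliceChart I F n j p)
    {y : Euc n} (hy : y ∈ (c.toChart hj).target) :
    j ((c.toChart hj).symm y) = c.chart.symm (0, y) := by
  have h1 := c.chart.map_target hy
  have h2 : c.chart.symm (0, y) ∈ range j :=
    (c.slice _ h1).2 (by rw [c.chart.right_inv hy])
  have h3 : (c.toChart hj).symm y = h2.choose := dif_pos h2
  rw [h3, h2.choose_spec]

/-- The charted space given by slice charts. -/
@[reducible]
def sliceChartedSpace (hj : Topology.IsEmbedding j) (c : ∀ p, SliceChart I F n j p) :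
    ChartedSpace (Euc n) Z where
  atlas := range fun p => (c p).toChart hj
  chartAt p := (c p).toChart hj
  mem_chart_source p := (c p).mem_source
  chart_mem_atlas p := ⟨p, rfl⟩

variable (hj : Topology.IsEmbedding j) (c : ∀ p, SliceChart I F n j p)

theorem SliceChart.contMDiffOn_symm {p : Z} (c : SliceChart I F n j p) :
    ContMDiffOn 𝓘(ℝ, Euc n) I ∞ (fun y => c.chart.symm (0, y)) (c.toChart hj).target :=
  c.smooth_symm.comp (contDiff_prodMk_right (0 : F)).contMDiff.contMDiffOn fun _ hy => hy

/-- A change of charts is `y ↦ (0, y)`, followed by the ambient change of slice charts, followed by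
the second projection. -/
theorem slice_isManifold :
    @IsManifold ℝ _ (Euc n) _ _ (Euc n) _ 𝓘(ℝ, Euc n) ∞ Z _ (sliceChartedSpace hj c) := by
  let _ := sliceChartedSpace hj c
  refine isManifold_of_contDiffOn _ _ _ ?_
  rintro _ _ ⟨p, rfl⟩ ⟨q, rfl⟩
  simp only [modelWithCornersSelf_coe, modelWithCornersSelf_coe_symm, Function.comp_id,
    Function.id_comp, range_id, inter_univ, preimage_id]
  rw [← contMDiffOn_iff_contDiffOn]
  have h1 := ((c p).contMDiffOn_symm hj).mono
    (inter_subset_left : ((c p).toChart hj).target ∩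
      ((c p).toChart hj).symm ⁻¹' ((c q).toChart hj).source ⊆ _)
  have h2 : MapsTo (fun y => (c p).chart.symm ((0 : F), y)) (((c p).toChart hj).target ∩
      ((c p).toChart hj).symm ⁻¹' ((c q).toChart hj).source) (c q).chart.source := by
    intro y hy
    have := hy.2
    change j (((c p).toChart hj).symm y) ∈ (c q).chart.source at this
    rwa [(c p).toChart_symm hj hy.1] at this
  have h3 := contDiff_snd.contMDiff.comp_contMDiffOn ((c q).smooth.comp h1 h2)
  rw [OpenPartialHomeomorph.trans_source, OpenPartialHomeomorph.symm_source]
  refine h3.congr fun y hy => ?_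
  change ((c q).chart (j (((c p).toChart hj).symm y))).2 = _
  rw [(c p).toChart_symm hj hy.1]
  rfl

/-- Near `p`, `j` is the chart of `Z` followed by `y ↦ (0, y)` and the ambient inverse chart. -/
theorem slice_contMDiff_incl :
    @ContMDiff ℝ _ (Euc n) _ _ (Euc n) _ 𝓘(ℝ, Euc n) Z _ (sliceChartedSpace hj c) V _ _ H _ I M _ _
      ∞ j := by
  let _ := sliceChartedSpace hj c
  have := slice_isManifold hj c
  intro p
  have h1 : ContMDiffOn 𝓘(ℝ, Euc n) 𝓘(ℝ, Euc n) ∞ ((c p).toChart hj) ((c p).toChart hj).source :=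
    contMDiffOn_chart
  have h2 := ((c p).contMDiffOn_symm hj).comp h1 fun q hq => ((c p).toChart hj).map_source hq
  have h3 : p ∈ ((c p).toChart hj).source := (c p).mem_source
  refine ((h2.congr fun q hq => ?_) p h3).contMDiffAt
    (((c p).toChart hj).open_source.mem_nhds h3)
  simp only [Function.comp]
  rw [← (c p).toChart_symm hj (((c p).toChart hj).map_source hq), ((c p).toChart hj).left_inv hq]

/-- Maps into `Z` are smooth if they are smooth as maps to `M`. -/
theorem slice_contMDiffAt {E' : Type*} [NormedAddCommGroup E'] [NormedSpace ℝ E'] {H' : Type*}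
    [TopologicalSpace H'] {I' : ModelWithCorners ℝ E' H'} {N : Type*} [TopologicalSpace N]
    [ChartedSpace H' N] {f : N → Z} {x : N} (hf : ContMDiffAt I' I ∞ (j ∘ f) x) :
    @ContMDiffAt ℝ _ E' _ _ H' _ I' N _ _ (Euc n) _ _ (Euc n) _ 𝓘(ℝ, Euc n) Z _
      (sliceChartedSpace hj c) ∞ f x := by
  let _ := sliceChartedSpace hj c
  have := slice_isManifold hj c
  have hcont : ContinuousAt f x := hj.continuousAt_iff.2 hf.continuousAt
  rw [contMDiffAt_iff_target]
  refine ⟨hcont, ?_⟩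
  have h1 : j (f x) ∈ (c (f x)).chart.source := (c (f x)).mem_source
  have h2 := ((c (f x)).smooth _ h1).contMDiffAt ((c (f x)).chart.open_source.mem_nhds h1)
  exact contDiff_snd.contMDiff.contMDiffAt.comp x (h2.comp x hf)

/-- The inclusion of `Z` is an immersion, in the form: a tangent vector killed by all smooth
functions of `j` vanishes. -/
theorem slice_immersion (p : Z) (ξ : Euc n)
    (hξ : ∀ g : M → Euc n, ContMDiffAt I 𝓘(ℝ, Euc n) ∞ g (j p) →
      @mfderiv ℝ _ (Euc n) _ _ (Euc n) _ 𝓘(ℝ, Euc n) Z _ (sliceChartedSpace hj c)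
        (Euc n) _ _ (Euc n) _ 𝓘(ℝ, Euc n) (Euc n) _ _ (g ∘ j) p ξ = 0) : ξ = 0 := by
  let _ := sliceChartedSpace hj c
  have := slice_isManifold hj c
  have : IsManifold 𝓘(ℝ, Euc n) 1 Z := IsManifold.of_le (n := ∞) (by simp)
  obtain ⟨e, he⟩ := isInvertible_mfderiv_extChartAt (I := 𝓘(ℝ, Euc n)) (mem_extChartAt_source p)
  have h1 : j p ∈ (c p).chart.source := (c p).mem_source
  have h2 := ((c p).smooth _ h1).contMDiffAt ((c p).chart.open_source.mem_nhds h1)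
  -- The test function is the second component of the slice chart at `p`: its composite with `j` is
  -- the chart of `Z` at `p`, whose derivative is invertible.
  have h3 := hξ (fun m => ((c p).chart m).2) (contDiff_snd.contMDiff.contMDiffAt.comp _ h2)
  have h4 : mfderiv 𝓘(ℝ, Euc n) 𝓘(ℝ, Euc n) (extChartAt 𝓘(ℝ, Euc n) p) p ξ = 0 := h3
  rw [← he] at h4
  exact e.map_eq_zero_iff.1 h4

end SliceManifold

end VirtualOrb
end

noncomputable section

namespace VirtualOrb
open TopGroupoid

/-! ### The action of arrows on an orbifold bundle, as a relation on the total space -/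

section Acts

variable {E : Type*} [NormedAddCommGroup E] [NormedSpace ℝ E] {G : TopGroupoid.{v}}
  [ChartedSpace E G.Obj] {R : Type*} [NormedAddCommGroup R] [NormedSpace ℝ R]
  {V : OrbiBundle.{v, w} E G R}

theorem OrbiBundle.Acts.proj_src {g : G.Arr} {a b : V.Total} (h : V.Acts g a b) :
    a.proj = G.src g := by
  obtain ⟨x, rfl, rfl⟩ := h; rfl

theorem OrbiBundle.Acts.proj_tgt {g : G.Arr} {a b : V.Total} (h : V.Acts g a b) :
    b.proj = G.tgt g := by
  obtain ⟨x, rfl, rfl⟩ := h; rfl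

theorem OrbiBundle.Acts.unique {g : G.Arr} {a b b' : V.Total} (h : V.Acts g a b)
    (h' : V.Acts g a b') : b = b' := by
  obtain ⟨x, rfl, rfl⟩ := h
  obtain ⟨y, hy, rfl⟩ := h'
  obtain rfl : x = y := eq_of_heq (TotalSpace.mk.inj hy).2
  rfl

theorem OrbiBundle.acts_act (g : G.Arr) (x : V.Fib (G.src g)) : V.Acts g ⟨_, x⟩ ⟨_, V.act g x⟩ :=
  ⟨x, rfl, rfl⟩

/-- The action of an arrow with given source and target. -/
def OrbiBundle.actTo (V : OrbiBundle.{v, w} E G R) (g : G.Arr) {x y : G.Obj} (hs : G.src g = x)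
    (ht : G.tgt g = y) : V.Fib x →L[ℝ] V.Fib y :=
  hs ▸ ht ▸ V.act g

theorem OrbiBundle.acts_actTo (g : G.Arr) {x y : G.Obj} (hs : G.src g = x) (ht : G.tgt g = y)
    (a : V.Fib x) : V.Acts g ⟨x, a⟩ ⟨y, V.actTo g hs ht a⟩ := by
  subst hs ht
  exact V.acts_act g a

theorem OrbiBundle.Acts.eq_actTo {g : G.Arr} {x y : G.Obj} (hs : G.src g = x) (ht : G.tgt g = y)
    {a : V.Fib x} {b : V.Fib y} (h : V.Acts g ⟨x, a⟩ ⟨y, b⟩) : b = V.actTo g hs ht a :=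
  eq_of_heq (TotalSpace.mk.inj (h.unique (V.acts_actTo g hs ht a))).2

end Acts

/-! ### Direct sums of pulled-back bundles: the vector bundle -/

section PullbackSum

variable {E : Type*} [NormedAddCommGroup E] [NormedSpace ℝ E]
  {E' : Type*} [NormedAddCommGroup E'] [NormedSpace ℝ E']
  {G : TopGroupoid.{v}} [ChartedSpace E' G.Obj]
  {κ : Type} [Fintype κ] {H : κ → TopGroupoid.{v}} [∀ j, ChartedSpace E (H j).Obj] {k : κ → ℕ}

/-- The decomposition of a Euclidean space as a product. -/
def eucSplit (k : κ → ℕ) : Euc (∑ j, k j) ≃L[ℝ] ∀ j, Euc (k j) :=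
  ContinuousLinearEquiv.ofFinrankEq (by rw [Module.finrank_pi_fintype]; simp)

/-- Block diagonal endomorphisms. -/
def blockDiag (k : κ → ℕ) : (∀ j, Euc (k j) →L[ℝ] Euc (k j)) →L[ℝ]
    (Euc (∑ j, k j) →L[ℝ] Euc (∑ j, k j)) :=
  LinearMap.toContinuousLinearMap
    { toFun := fun A => (eucSplit k).symm.toContinuousLinearMap.comp
        ((ContinuousLinearMap.piMap A).comp (eucSplit k).toContinuousLinearMap)
      map_add' := fun A B => by
        ext1 v
        refine (eucSplit k).injective ?_
        ext j
        simp
      map_smul' := fun c A => by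
        ext1 v
        refine (eucSplit k).injective ?_
        ext j
        simp }

theorem eucSplit_blockDiag (A : ∀ j, Euc (k j) →L[ℝ] Euc (k j)) (v : Euc (∑ j, k j)) (j : κ) :
    eucSplit k (blockDiag k A v) j = A j (eucSplit k v j) := by
  have : blockDiag k A v = (eucSplit k).symm (fun j => A j (eucSplit k v j)) := rfl
  rw [this, ContinuousLinearEquiv.apply_symm_apply]

variable (O : ∀ j, OrbiBundle.{v, w} E (H j) (Euc (k j))) (o : ∀ j, Hom G (H j))
  (ho : ∀ j, ContMDiff 𝓘(ℝ, E') 𝓘(ℝ, E) ∞ (o j).obj)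

/-- The trivialization of `O j` at `o j x`. -/
abbrev sumTriv (j : κ) (x : G.Obj) :
    Trivialization (Euc (k j)) (π (Euc (k j)) (O j).Fib) :=
  trivializationAt (Euc (k j)) (O j).Fib ((o j).obj x)

/-- The transition functions are block diagonal with the smooth transition functions of the `O j` as
blocks, and `blockDiag` is continuous linear. The lemma precedes the bundle core because the core
already needs their continuity. -/
theorem contMDiffOn_blockDiag {E' : Type*} [NormedAddCommGroup E'] [NormedSpace ℝ E']
    {G : TopGroupoid.{v}} [ChartedSpace E' G.Obj] {κ : Type} [Fintype κ] {H : κ → TopGroupoid.{v}}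
    [∀ j, ChartedSpace E (H j).Obj] {k : κ → ℕ} (O : ∀ j, OrbiBundle.{v, w} E (H j) (Euc (k j)))
    (o : ∀ j, Hom G (H j)) (ho : ∀ j, ContMDiff 𝓘(ℝ, E') 𝓘(ℝ, E) ∞ (o j).obj) (x x' : G.Obj) :
    ContMDiffOn 𝓘(ℝ, E') 𝓘(ℝ, Euc (∑ j, k j) →L[ℝ] Euc (∑ j, k j)) ∞
      (fun y => blockDiag k fun j =>
        ((sumTriv O o j x).coordChangeL ℝ (sumTriv O o j x') ((o j).obj y) :
          Euc (k j) →L[ℝ] Euc (k j)))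
      ({y | ∀ j, (o j).obj y ∈ (sumTriv O o j x).baseSet} ∩
        {y | ∀ j, (o j).obj y ∈ (sumTriv O o j x').baseSet}) := by
  refine (blockDiag k).contMDiff.comp_contMDiffOn (contMDiffOn_pi_space.2 fun j => ?_)
  exact (ho j).contMDiffOn.coordChangeL (fun y hy => hy.1 j) (fun y hy => hy.2 j)

/-- The bundle `⨁ j, (o j)^* O j` in terms of transition functions. -/
def sumCore : VectorBundleCore ℝ G.Obj (Euc (∑ j, k j)) G.Obj where
  baseSet x := {y | ∀ j, (o j).obj y ∈ (sumTriv O o j x).baseSet}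
  isOpen_baseSet x := by
    have : {y | ∀ j, (o j).obj y ∈ (sumTriv O o j x).baseSet} =
        ⋂ j, (o j).obj ⁻¹' (sumTriv O o j x).baseSet := by ext; simp
    rw [this]
    exact isOpen_iInter_of_finite fun j =>
      (sumTriv O o j x).open_baseSet.preimage (o j).continuous_obj
  -- The trivializations are indexed by the objects themselves: the fibre over `x` is read in the
  -- trivializations of the `O j` at the points `o j x`.
  indexAt := id
  mem_baseSet_at x j := mem_baseSet_trivializationAt _ _ _
  coordChange x x' y := blockDiag k fun j =>
    ((sumTriv O o j x).coordChangeL ℝ (sumTriv O o j x') ((o j).obj y) :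
      Euc (k j) →L[ℝ] Euc (k j))
  coordChange_self x y hy v := by
    refine (eucSplit k).injective (funext fun j => ?_)
    rw [eucSplit_blockDiag, ContinuousLinearEquiv.coe_coe,
      Trivialization.coordChangeL_apply _ _ ⟨hy j, hy j⟩]
    exact (sumTriv O o j x).apply_mk_symm (hy j) _ ▸ rfl
  continuousOn_coordChange x x' := (contMDiffOn_blockDiag O o ho x x').continuousOn
  coordChange_comp x x' x'' y hy v := by
    refine (eucSplit k).injective (funext fun j => ?_)
    simp only [eucSplit_blockDiag, ContinuousLinearEquiv.coe_coe]
    rw [Trivialization.coordChangeL_apply _ _ ⟨hy.1.2 j, hy.2 j⟩,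
      Trivialization.coordChangeL_apply _ _ ⟨hy.1.1 j, hy.1.2 j⟩,
      Trivialization.coordChangeL_apply _ _ ⟨hy.1.1 j, hy.2 j⟩,
      Trivialization.symm_apply_apply_mk _ (hy.1.2 j)]

instance : (sumCore O o ho).IsContMDiff 𝓘(ℝ, E') ∞ :=
  ⟨contMDiffOn_blockDiag O o ho⟩

/-- The fibres of the sum of the pull-backs. -/
def sumIso (x : G.Obj) : (sumCore O o ho).Fiber x ≃ₗ[ℝ] ∀ j, (O j).Fib ((o j).obj x) :=
  LinearEquiv.trans (show (sumCore O o ho).Fiber x ≃ₗ[ℝ] ∀ j, Euc (k j) from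
      (eucSplit k).toLinearEquiv)
    (LinearEquiv.piCongrRight fun j => ((sumTriv O o j x).linearEquivAt ℝ ((o j).obj x)
      (mem_baseSet_trivializationAt _ _ _)).symm)

/-- The components of a point of the sum of the pull-backs. -/
def sumTot (a : TotalSpace (Euc (∑ j, k j)) (sumCore O o ho).Fiber) (j : κ) : (O j).Total :=
  ⟨(o j).obj a.proj, sumIso O o ho a.proj a.2 j⟩

variable {O o ho}

/-- Since `sumIso` is injective, identities in the sum can be checked on base points and components,
away from the dependent types of the fibres. -/
theorem sumTot_ext {a b : TotalSpace (Euc (∑ j, k j)) (sumCore O o ho).Fiber}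
    (h : a.proj = b.proj) (h' : ∀ j, sumTot O o ho a j = sumTot O o ho b j) : a = b := by
  obtain ⟨x, a⟩ := a
  obtain ⟨y, b⟩ := b
  obtain rfl : x = y := h
  have : a = b := (sumIso O o ho x).injective (funext fun j =>
    eq_of_heq (TotalSpace.mk.inj (h' j)).2)
  rw [this]

/-- The block of index `j` of the transition function from `a.proj` to `x` is the coordinate change
of `O j`, which turns the coordinates of the component at its own base point into those at `o j x`.
Both the smooth structure and the topology of the sum are read off from the `O j` by means of this
formula. -/
theorem eucSplit_localTriv (x : G.Obj) (a : TotalSpace (Euc (∑ j, k j)) (sumCore O o ho).Fiber)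
    (ha : a.proj ∈ (sumCore O o ho).baseSet x) (j : κ) :
    eucSplit k ((sumCore O o ho).localTriv x a).2 j =
      (sumTriv O o j x (sumTot O o ho a j)).2 := by
  refine (eucSplit_blockDiag (k := k) _ _ j).trans ?_
  rw [ContinuousLinearEquiv.coe_coe]
  exact Trivialization.coordChangeL_apply _ _ ⟨mem_baseSet_trivializationAt _ _ _, ha j⟩ _

section Smooth

variable {E'' : Type*} [NormedAddCommGroup E''] [NormedSpace ℝ E''] {H'' : Type*}
  [TopologicalSpace H''] {I'' : ModelWithCorners ℝ E'' H''} {N : Type*} [TopologicalSpace N]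
  [ChartedSpace H'' N]

/-- A map to the sum of the pull-backs is smooth if its components are. -/
theorem contMDiffAt_sum {f : N → TotalSpace (Euc (∑ j, k j)) (sumCore O o ho).Fiber} {x : N}
    (h : ContMDiffAt I'' 𝓘(ℝ, E') ∞ (fun y => (f y).proj) x)
    (h' : ∀ j, ContMDiffAt I'' (𝓘(ℝ, E).prod 𝓘(ℝ, Euc (k j))) ∞
      (fun y => sumTot O o ho (f y) j) x) :
    ContMDiffAt I'' (𝓘(ℝ, E').prod 𝓘(ℝ, Euc (∑ j, k j))) ∞ f x := by
  rw [contMDiffAt_totalSpace]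
  refine ⟨h, ?_⟩
  have h1 : ContMDiffAt I'' 𝓘(ℝ, ∀ j, Euc (k j)) ∞
      (fun y => eucSplit k ((sumCore O o ho).localTriv (f x).proj (f y)).2) x := by
    refine contMDiffAt_pi_space.2 fun j => ?_
    have h2 := (contMDiffAt_totalSpace.1 (h' j)).2
    refine h2.congr_of_eventuallyEq ?_
    have h3 : (sumCore O o ho).baseSet (f x).proj ∈ 𝓝 (f x).proj :=
      ((sumCore O o ho).isOpen_baseSet _).mem_nhds ((sumCore O o ho).mem_baseSet_at _)
    filter_upwards [h.continuousAt h3] with y hy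
    exact eucSplit_localTriv _ _ hy j
  have h4 := ((eucSplit k).symm.contDiff (n := ∞)).contMDiff.contMDiffAt.comp x h1
  refine h4.congr_of_eventuallyEq (Eventually.of_forall fun y => ?_)
  simp only [Function.comp, ContinuousLinearEquiv.symm_apply_apply]
  rfl

theorem contMDiff_sumTot (j : κ) : ContMDiff (𝓘(ℝ, E').prod 𝓘(ℝ, Euc (∑ j, k j)))
    (𝓘(ℝ, E).prod 𝓘(ℝ, Euc (k j))) ∞ (fun a => sumTot O o ho a j) := by
  intro a
  rw [contMDiffAt_totalSpace]
  have h0 := contMDiff_proj (n := ∞) (F := Euc (∑ j, k j)) (IB := 𝓘(ℝ, E')) (sumCore O o ho).Fiber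
  refine ⟨((ho j).comp h0) a, ?_⟩
  have h1 : ContMDiffAt (𝓘(ℝ, E').prod 𝓘(ℝ, Euc (∑ j, k j))) 𝓘(ℝ, Euc (∑ j, k j)) ∞
      (fun b => ((sumCore O o ho).localTriv a.proj b).2) a :=
    (contMDiffAt_totalSpace.1 (contMDiffAt_id (x := a))).2
  have h2 := ((eucSplit k).contDiff (n := ∞)).contMDiff.contMDiffAt.comp a h1
  have h3 := contMDiffAt_pi_space.1 h2 j
  refine h3.congr_of_eventuallyEq ?_
  have h3 : (sumCore O o ho).baseSet a.proj ∈ 𝓝 a.proj :=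
    ((sumCore O o ho).isOpen_baseSet _).mem_nhds ((sumCore O o ho).mem_baseSet_at _)
  filter_upwards [h0.continuous.continuousAt h3] with b hb
  exact (eucSplit_localTriv _ _ hb j).symm

end Smooth

end PullbackSum

end VirtualOrb
end

noncomputable section

namespace VirtualOrb
open TopGroupoid

/-! ### Direct sums of pulled-back bundles: arrows and topology -/

section PullbackSum

variable {E : Type*} [NormedAddCommGroup E] [NormedSpace ℝ E]
  {E' : Type*} [NormedAddCommGroup E'] [NormedSpace ℝ E']
  {G : TopGroupoid.{v}} [ChartedSpace E' G.Obj]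
  {κ : Type} [Fintype κ] {H : κ → TopGroupoid.{v}} [∀ j, ChartedSpace E (H j).Obj] {k : κ → ℕ}
  (O : ∀ j, OrbiBundle.{v, w} E (H j) (Euc (k j))) (o : ∀ j, Hom G (H j))
  (ho : ∀ j, ContMDiff 𝓘(ℝ, E') 𝓘(ℝ, E) ∞ (o j).obj)

/-- The action of the arrows on the sum of the pull-backs, as a linear map. -/
def sumActₗ (g : G.Arr) : (sumCore O o ho).Fiber (G.src g) →ₗ[ℝ] (sumCore O o ho).Fiber (G.tgt g) :=
  (sumIso O o ho (G.tgt g)).symm.toLinearMap ∘ₗ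
    (LinearMap.pi fun j => ((O j).actTo ((o j).arr g) ((o j).src_arr g)
      ((o j).tgt_arr g)).toLinearMap ∘ₗ LinearMap.proj j) ∘ₗ
    (sumIso O o ho (G.src g)).toLinearMap

/-- The action of the arrows on the sum of the pull-backs. -/
def sumAct (g : G.Arr) : (sumCore O o ho).Fiber (G.src g) →L[ℝ] (sumCore O o ho).Fiber (G.tgt g) :=
  show Euc (∑ j, k j) →L[ℝ] Euc (∑ j, k j) from
    LinearMap.toContinuousLinearMap
      (show Euc (∑ j, k j) →ₗ[ℝ] Euc (∑ j, k j) from sumActₗ O o ho g)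

variable {O o ho}

theorem sumTot_mk (x : G.Obj) (v : ∀ j, (O j).Fib ((o j).obj x)) (j : κ) :
    sumTot O o ho ⟨x, (sumIso O o ho x).symm v⟩ j = ⟨(o j).obj x, v j⟩ := by
  change (⟨_, sumIso O o ho x ((sumIso O o ho x).symm v) j⟩ : (O j).Total) = _
  rw [LinearEquiv.apply_symm_apply]

theorem acts_sumTot (g : G.Arr) (a : (sumCore O o ho).Fiber (G.src g)) (j : κ) :
    (O j).Acts ((o j).arr g) (sumTot O o ho ⟨_, a⟩ j)
      (sumTot O o ho ⟨_, sumAct O o ho g a⟩ j) := by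
  have : sumTot O o ho ⟨_, sumAct O o ho g a⟩ j = ⟨(o j).obj (G.tgt g), (O j).actTo ((o j).arr g)
      ((o j).src_arr g) ((o j).tgt_arr g) (sumIso O o ho _ a j)⟩ :=
    sumTot_mk (G.tgt g) (fun j => (O j).actTo ((o j).arr g)
      ((o j).src_arr g) ((o j).tgt_arr g) (sumIso O o ho _ a j)) j
  rw [this]
  exact (O j).acts_actTo _ _ _ _

/-- An arrow moves a given vector of `O j` to a unique vector, so the result in the sum is
determined by its components. The groupoid identities of the action follow from those of the `O j`.
-/
theorem sumAct_eq {g : G.Arr} {a : (sumCore O o ho).Fiber (G.src g)}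
    {b : TotalSpace (Euc (∑ j, k j)) (sumCore O o ho).Fiber} (hb : b.proj = G.tgt g)
    (h : ∀ j, (O j).Acts ((o j).arr g) (sumTot O o ho ⟨_, a⟩ j) (sumTot O o ho b j)) :
    (⟨G.tgt g, sumAct O o ho g a⟩ : TotalSpace (Euc (∑ j, k j)) (sumCore O o ho).Fiber) = b :=
  sumTot_ext hb.symm fun j => (acts_sumTot g a j).unique (h j)

/-- Near `g` the base and each `O j` carry smooth maps `f` and `Φ j` implementing the arrows. The `Φ
j` can be assembled to a point of the sum only where they lie over the same point `f x`; this is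
true over the sources of the arrows near `g`. -/
theorem sum_smooth_act (hG : IsOrbifold E' G) (g : G.Arr) :
    ∃ Φ : TotalSpace (Euc (∑ j, k j)) (sumCore O o ho).Fiber →
        TotalSpace (Euc (∑ j, k j)) (sumCore O o ho).Fiber,
      (∀ a, a.proj = G.src g → ContMDiffAt (𝓘(ℝ, E').prod 𝓘(ℝ, Euc (∑ j, k j)))
        (𝓘(ℝ, E').prod 𝓘(ℝ, Euc (∑ j, k j))) ∞ Φ a) ∧
      ∀ᶠ h in 𝓝 g, ∀ a : (sumCore O o ho).Fiber (G.src h),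
        Φ ⟨G.src h, a⟩ = ⟨G.tgt h, sumAct O o ho h a⟩ := by
  classical
  obtain ⟨f, hf, hf'⟩ := hG.smooth g
  choose Φ hΦ hΦ' using fun j => (O j).smooth_act ((o j).arr g)
  have hev : ∀ᶠ h in 𝓝 g, f (G.src h) = G.tgt h ∧ ∀ j, ∀ (t t' : (O j).Total),
      (O j).Acts ((o j).arr h) t t' → Φ j t = t' := by
    refine hf'.and (eventually_all.2 fun j => ?_)
    filter_upwards [(o j).continuous_arr.continuousAt.eventually (hΦ' j)] with h hh t t' htt'
    obtain ⟨x, rfl, rfl⟩ := htt'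
    exact hh x
  -- The component `0` is a default where `Φ j` does not lie over `o j (f x)`; such points stay away
  -- from the fibre over `src g`.
  let Ψ : TotalSpace (Euc (∑ j, k j)) (sumCore O o ho).Fiber →
      TotalSpace (Euc (∑ j, k j)) (sumCore O o ho).Fiber := fun a =>
    ⟨f a.proj, (sumIso O o ho (f a.proj)).symm fun j =>
      if h : (Φ j (sumTot O o ho a j)).proj = (o j).obj (f a.proj) then
        ((O j).exists_fib _ _ h).choose else 0⟩
  have key : ∀ h : G.Arr, (f (G.src h) = G.tgt h ∧ ∀ j, ∀ (t t' : (O j).Total),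
      (O j).Acts ((o j).arr h) t t' → Φ j t = t') → ∀ a, a.proj = G.src h → ∀ j,
      sumTot O o ho (Ψ a) j = Φ j (sumTot O o ho a j) := by
    rintro h ⟨h1, h2⟩ ⟨x, a⟩ hx j
    obtain rfl : x = G.src h := hx
    have h3 := h2 j _ _ (acts_sumTot h a j)
    have h4 : (Φ j (sumTot O o ho ⟨G.src h, a⟩ j)).proj = (o j).obj (f (G.src h)) := by
      rw [h3, h1]; rfl
    refine (sumTot_mk _ _ _).trans ?_
    rw [dif_pos h4]
    exact ((O j).exists_fib _ _ h4).choose_spec.symm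
  refine ⟨Ψ, fun a ha => ?_, ?_⟩
  · have h0 := contMDiff_proj (n := ∞) (F := Euc (∑ j, k j)) (IB := 𝓘(ℝ, E'))
      (sumCore O o ho).Fiber
    refine contMDiffAt_sum ?_ fun j => ?_
    · rw [← ha] at hf
      exact hf.comp a (h0 a)
    · have h1 : ContMDiffAt (𝓘(ℝ, E').prod 𝓘(ℝ, Euc (∑ j, k j)))
          (𝓘(ℝ, E).prod 𝓘(ℝ, Euc (k j))) ∞ (fun b => Φ j (sumTot O o ho b j)) a := by
        refine (hΦ j (sumTot O o ho a j) ?_).comp a (contMDiff_sumTot j a)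
        change (o j).obj a.proj = _
        rw [ha, (o j).src_arr]
      refine h1.congr_of_eventuallyEq ?_
      -- The source map is open, so every point near `src g` is the source of an arrow near `g`, and
      -- there the components of `Ψ` are the `Φ j`.
      have h2 := hG.src_localHomeo.isOpenMap.image_mem_nhds hev
      rw [← ha] at h2
      filter_upwards [h0.continuous.continuousAt h2] with b hb
      obtain ⟨h, hh, hb⟩ := hb
      exact key h hh b hb.symm j
  · filter_upwards [hev] with h hh a
    refine sumTot_ext hh.1 fun j => ?_
    rw [key h hh _ rfl j]
    exact hh.2 j _ _ (acts_sumTot h a j)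

variable (O o ho)

/-- The orbifold vector bundle `⨁ j, (o j)^* O j`. -/
def pullbackSum (hG : IsOrbifold E' G) : OrbiBundle.{v, 0} E' G (Euc (∑ j, k j)) where
  Fib := (sumCore O o ho).Fiber
  act := sumAct O o ho
  act_one x a := by
    refine sumAct_eq ((G.src_one x).trans (G.tgt_one x).symm) fun j => ?_
    rw [(o j).map_one]
    have h := (O j).acts_one (sumTot O o ho ⟨_, a⟩ j)
    have h' : (sumTot O o ho ⟨_, a⟩ j).proj = (o j).obj x := congrArg (o j).obj (G.src_one x)
    rwa [h'] at h
  act_comp g h e a b c hab hbc := by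
    refine sumAct_eq (G.tgt_comp g h e).symm fun j => ?_
    rw [(o j).map_comp, hab]
    refine (O j).acts_comp _ (acts_sumTot h b j) ?_
    rw [hbc]
    exact acts_sumTot g c j
  smooth_act := sum_smooth_act hG

theorem pullbackSum_acts (hG : IsOrbifold E' G) {g : G.Arr} {a b : (pullbackSum O o ho hG).Total}
    (ha : a.proj = G.src g) (hb : b.proj = G.tgt g)
    (h : ∀ j, (O j).Acts ((o j).arr g) (sumTot O o ho a j) (sumTot O o ho b j)) :
    (pullbackSum O o ho hG).Acts g a b := by
  obtain ⟨x, a⟩ := a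
  obtain rfl : x = G.src g := ha
  exact ⟨a, rfl, (sumAct_eq hb h).symm⟩

theorem OrbiBundle.Acts.sumTot {hG : IsOrbifold E' G} {g : G.Arr}
    {a b : (pullbackSum O o ho hG).Total} (h : (pullbackSum O o ho hG).Acts g a b) (j : κ) :
    (O j).Acts ((o j).arr g) (sumTot O o ho a j) (sumTot O o ho b j) := by
  obtain ⟨x, rfl, rfl⟩ := h
  exact acts_sumTot g x j

theorem continuous_sumTot (j : κ) : Continuous (fun a => sumTot O o ho a j) :=
  (contMDiff_sumTot (E' := E') j).continuous

/-- The topology of the sum of the pull-backs is the one of the fibre product. -/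
theorem sum_isInducing : Topology.IsInducing
    (fun a : TotalSpace (Euc (∑ j, k j)) (sumCore O o ho).Fiber => (a.proj, sumTot O o ho a)) := by
  have hp : Continuous (fun a : TotalSpace (Euc (∑ j, k j)) (sumCore O o ho).Fiber => a.proj) :=
    FiberBundle.continuous_proj (Euc (∑ j, k j)) (sumCore O o ho).Fiber
  refine Topology.isInducing_iff_nhds.2 fun a => le_antisymm ?_ ?_
  · exact (hp.prodMk (continuous_pi fun j => continuous_sumTot O o ho j)).continuousAt.le_comap
  -- Convergence of base point and components implies convergence in the local trivialization at
  -- `a`, hence in the total space. It is stated for arbitrary filters so that it applies to the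
  -- neighbourhood filter pulled back from the fibre product.
  · have htend : ∀ f : Filter (TotalSpace (Euc (∑ j, k j)) (sumCore O o ho).Fiber),
        Tendsto (fun a => a.proj) f (𝓝 a.proj) →
        (∀ j, Tendsto (fun b => sumTot O o ho b j) f (𝓝 (sumTot O o ho a j))) → f ≤ 𝓝 a := by
      intro f h1 h2
      have h3 : (sumCore O o ho).baseSet a.proj ∈ 𝓝 a.proj :=
        ((sumCore O o ho).isOpen_baseSet _).mem_nhds ((sumCore O o ho).mem_baseSet_at _)
      let e := (sumCore O o ho).localTriv a.proj
      have ha : a ∈ e.source := (sumCore O o ho).mem_baseSet_at _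
      have h4 : Tendsto (fun b => eucSplit k (e b).2) f (𝓝 (eucSplit k (e a).2)) := by
        refine tendsto_pi_nhds.2 fun j => ?_
        have h5 : sumTot O o ho a j ∈ (sumTriv O o j a.proj).source :=
          (sumTriv O o j a.proj).mem_source.2 (mem_baseSet_trivializationAt _ _ _)
        have h6 := (((sumTriv O o j a.proj).continuousAt h5).snd.tendsto.comp (h2 j))
        rw [show eucSplit k (e a).2 j = (sumTriv O o j a.proj (sumTot O o ho a j)).2 from
          eucSplit_localTriv _ _ ((sumCore O o ho).mem_baseSet_at _) j]
        refine h6.congr' ?_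
        filter_upwards [h1 h3] with b hb
        exact (eucSplit_localTriv _ _ hb j).symm
      have h5 : Tendsto (fun b => (e b).2) f (𝓝 (e a).2) := by
        have := ((eucSplit k).symm.continuous.tendsto _).comp h4
        simpa only [Function.comp_def, ContinuousLinearEquiv.symm_apply_apply] using this
      have h6 : Tendsto e f (𝓝 (e a)) := by
        have := h1.prodMk_nhds h5
        exact this
      have h7 := (e.toOpenPartialHomeomorph.continuousAt_symm
        (e.toOpenPartialHomeomorph.map_source ha)).tendsto.comp h6
      have h8 : e.toOpenPartialHomeomorph.symm (e a) = a :=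
        e.toOpenPartialHomeomorph.left_inv ha
      refine (Tendsto.congr' ?_ h7 : Tendsto id f (𝓝 _)).trans (le_of_eq (congrArg 𝓝 h8))
      filter_upwards [h1 h3] with b hb
      exact e.toOpenPartialHomeomorph.left_inv hb
    have hc : Tendsto (fun b => (b.proj, sumTot O o ho b))
        (comap (fun b => (b.proj, sumTot O o ho b)) (𝓝 (a.proj, sumTot O o ho a)))
        (𝓝 (a.proj, sumTot O o ho a)) := tendsto_comap
    exact htend _ ((continuous_fst.tendsto _).comp hc) fun j =>
      ((continuous_apply j).tendsto _).comp ((continuous_snd.tendsto _).comp hc)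

end PullbackSum

/-! ### Separation and countability of total spaces -/

section TotalSpace

variable {B : Type*} [TopologicalSpace B] {F : Type*} [TopologicalSpace F] {X : B → Type*}
  [∀ x, TopologicalSpace (X x)] [TopologicalSpace (TotalSpace F X)] [FiberBundle F X]

/-- Points over different base points are separated in the base; points of one fibre lie in a common
trivialization and are separated there. -/
theorem totalSpace_t2 [T2Space B] [T2Space F] : T2Space (TotalSpace F X) := by
  refine ⟨fun a b hab => ?_⟩
  by_cases h : a.proj = b.proj
  · let e := trivializationAt F X a.proj
    have ha : a ∈ e.source := FiberBundle.mem_trivializationAt_proj_source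
    have hb : b ∈ e.source := by
      rw [e.mem_source, ← h, ← e.mem_source]; exact ha
    have h2 : e a ≠ e b := fun h => hab (e.injOn ha hb h)
    obtain ⟨u, v, hu, hv, hau, hbv, huv⟩ := t2_separation h2
    refine ⟨e.source ∩ e ⁻¹' u, e.source ∩ e ⁻¹' v,
      e.toOpenPartialHomeomorph.isOpen_inter_preimage hu,
      e.toOpenPartialHomeomorph.isOpen_inter_preimage hv, ⟨ha, hau⟩, ⟨hb, hbv⟩, ?_⟩
    exact ((huv.preimage e).mono inter_subset_right inter_subset_right)
  · obtain ⟨u, v, hu, hv, hau, hbv, huv⟩ := t2_separation h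
    exact ⟨_, _, hu.preimage (FiberBundle.continuous_proj F X),
      hv.preimage (FiberBundle.continuous_proj F X), hau, hbv, huv.preimage _⟩

/-- By the Lindelöf property of the base, countably many trivializations cover the total space. -/
theorem totalSpace_secondCountable [SecondCountableTopology B] [SecondCountableTopology F] :
    SecondCountableTopology (TotalSpace F X) := by
  obtain ⟨s, hs, hs'⟩ := isOpen_iUnion_countable
    (fun b : B => (trivializationAt F X b).baseSet) fun b => (trivializationAt F X b).open_baseSet
  have hc : Countable s := hs
  have hsc : ∀ b : s, SecondCountableTopology (trivializationAt F X b.1).source := fun b =>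
    (trivializationAt F X b.1).toOpenPartialHomeomorph.secondCountableTopology_source
  refine secondCountableTopology_of_countable_cover
    (U := fun b : s => (trivializationAt F X b.1).source)
    (fun b => (trivializationAt F X b.1).open_source) ?_
  · refine eq_univ_of_forall fun a => ?_
    have : a.proj ∈ ⋃ b ∈ s, (trivializationAt F X b).baseSet := by
      rw [hs']
      exact mem_iUnion.2 ⟨a.proj, mem_baseSet_trivializationAt F X _⟩
    obtain ⟨b, hb, hab⟩ := mem_iUnion₂.1 this
    exact mem_iUnion.2 ⟨⟨b, hb⟩, (trivializationAt F X b).mem_source.2 hab⟩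

end TotalSpace

end VirtualOrb
end

/-! ### Étale proper groupoids: open, full and invariant subgroupoids -/

noncomputable section

namespace VirtualOrb
open TopGroupoid

/-- A continuous section `σ` over an open `T` with image an open set `S` is a two-sided inverse of
`f` on `S`. Since `σ` is only needed on the subtype `T`, no default arrows have to be produced
outside of it. -/
theorem isLocalHomeomorph_of_section {X Y : Type*} [TopologicalSpace X] [TopologicalSpace Y]
    {f : X → Y} (hf : Continuous f)
    (h : ∀ x, ∃ (S : Set X) (T : Set Y) (σ : T → X), IsOpen S ∧ IsOpen T ∧ x ∈ S ∧ Continuous σ ∧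
      (∀ y : T, σ y ∈ S ∧ f (σ y) = y) ∧ ∀ x ∈ S, ∃ h : f x ∈ T, σ ⟨f x, h⟩ = x) :
    IsLocalHomeomorph f := by
  refine isLocalHomeomorph_iff_isOpenEmbedding_restrict.2 fun x => ?_
  obtain ⟨S, T, σ, hS, hT, hx, hσ, h1, h2⟩ := h x
  refine ⟨S, hS.mem_nhds hx, ?_⟩
  let e : S ≃ₜ T :=
    { toFun := fun a => ⟨f a, (h2 a a.2).1⟩
      invFun := fun b => ⟨σ b, (h1 b).1⟩
      left_inv := fun a => Subtype.ext (h2 a a.2).2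
      right_inv := fun b => Subtype.ext (h1 b).2
      continuous_toFun := (hf.comp continuous_subtype_val).subtype_mk _
      continuous_invFun := hσ.subtype_mk _ }
  exact hT.isOpenEmbedding_subtypeVal.comp e.isOpenEmbedding

namespace TopGroupoid

variable {G B : TopGroupoid.{v}}

theorem comp_congr {g g' h h' : G.Arr} (e : G.src g = G.tgt h) (hg : g = g') (hh : h = h') :
    G.comp g h e = G.comp g' h' (hg ▸ hh ▸ e) := by
  subst hg hh; rfl

/-- Associativity applied to the composite of the double inverse of `g`, its inverse, and `g`. -/
theorem inv_inv (g : G.Arr) : G.inv (G.inv g) = g := by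
  have e1 : G.src (G.inv (G.inv g)) = G.tgt (G.inv g) := G.src_inv _
  have e2 : G.comp (G.inv (G.inv g)) (G.inv g) e1 = G.one (G.tgt g) := by
    rw [G.inv_comp, G.src_inv]
  have e3 := G.comp_assoc (G.inv (G.inv g)) (G.inv g) g e1 (G.src_inv g)
  have e4 : G.comp (G.inv g) g (G.src_inv g) = G.one (G.src (G.inv (G.inv g))) := by
    rw [G.inv_comp, G.src_inv, G.tgt_inv]
  rw [G.comp_congr _ e2 rfl, G.comp_congr _ rfl e4, G.one_comp, G.comp_one] at e3
  exact e3.symm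

/-- The property of being étale and proper passes to full subgroupoids on invariant sets. -/
theorem full_src_isLocalHomeomorph {A : Set G.Obj} (hA : G.Invariant A)
    (h : IsLocalHomeomorph G.src) : IsLocalHomeomorph (G.full A).src := by
  refine isLocalHomeomorph_of_section (G.full A).continuous_src fun a => ?_
  obtain ⟨e, ha, he⟩ := h a.1
  have he' : ∀ {x}, x ∈ e.target → G.src (e.symm x) = x := fun {x} hx => by
    rw [he, e.right_inv hx]
  refine ⟨{b | b.1 ∈ e.source}, {x | x.1 ∈ e.target}, fun x => ⟨e.symm x.1.1, ?_⟩,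
    e.open_source.preimage continuous_subtype_val, e.open_target.preimage continuous_subtype_val,
    ha, ?_, ?_, ?_⟩
  · have h1 : G.src (e.symm x.1.1) ∈ A := by rw [he' x.2]; exact x.1.2
    exact ⟨h1, (hA _).1 h1⟩
  · exact Continuous.subtype_mk (e.continuousOn_symm.comp_continuous
      (continuous_subtype_val.comp continuous_subtype_val) fun x => x.2) _
  · exact fun y => ⟨e.map_target y.2, Subtype.ext (he' y.2)⟩
  · intro b hb
    have h2 : G.src b.1 = e b.1 := congrFun he _
    have h1 : G.src b.1 ∈ e.target := h2 ▸ e.map_source hb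
    exact ⟨h1, Subtype.ext ((congrArg e.symm h2).trans (e.left_inv hb))⟩

/-- A limit arrow exists in the whole groupoid, and its source and target are the given limits,
which are objects of the subgroupoid. So the limit arrow belongs to the full subgroupoid for any
`A`. -/
theorem full_proper {A : Set G.Obj} (h : IsProperMap fun g : G.Arr => (G.src g, G.tgt g)) :
    IsProperMap fun g : (G.full A).Arr => ((G.full A).src g, (G.full A).tgt g) := by
  refine isProperMap_iff_ultrafilter.2
    ⟨(G.full A).continuous_src.prodMk (G.full A).continuous_tgt, fun 𝒰 y hy => ?_⟩
  have hc : Continuous fun y : (G.full A).Obj × (G.full A).Obj => (y.1.1, y.2.1) :=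
    (continuous_subtype_val.comp continuous_fst).prodMk (continuous_subtype_val.comp continuous_snd)
  have h1 : Tendsto (fun g : G.Arr => (G.src g, G.tgt g)) (𝒰.map Subtype.val) (𝓝 (y.1.1, y.2.1)) :=
    (hc.tendsto y).comp hy
  obtain ⟨g, hg, hg'⟩ := (isProperMap_iff_ultrafilter.1 h).2 h1
  have hs : G.src g = y.1.1 := congrArg Prod.fst hg
  have ht : G.tgt g = y.2.1 := congrArg Prod.snd hg
  refine ⟨⟨g, by rw [hs]; exact y.1.2, by rw [ht]; exact y.2.2⟩,
    Prod.ext (Subtype.ext hs) (Subtype.ext ht), ?_⟩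
  exact tendsto_id'.1 (tendsto_subtype_rng.2 hg')

/-- Functors with values in an open suborbifold. -/
def Hom.codRestrict (f : Hom G B) (U : Opens B.Obj) (h : ∀ x, f.obj x ∈ U) :
    Hom G (B.restrict U) where
  obj x := ⟨f.obj x, h x⟩
  arr a := ⟨f.arr a, by rw [f.src_arr]; exact h _, by rw [f.tgt_arr]; exact h _⟩
  continuous_obj := f.continuous_obj.subtype_mk _
  continuous_arr := f.continuous_arr.subtype_mk _
  src_arr a := Subtype.ext (f.src_arr a)
  tgt_arr a := Subtype.ext (f.tgt_arr a)
  map_one x := Subtype.ext (f.map_one x)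
  map_comp g h e := Subtype.ext (f.map_comp g h e)

/-- The closure of an invariant set is invariant. -/
theorem Invariant.closure {A : Set G.Obj} (hA : G.Invariant A) (h : IsOpenMap G.src) :
    G.Invariant (closure A) := by
  have h1 : ∀ g, G.tgt g ∈ _root_.closure A → G.src g ∈ _root_.closure A := by
    intro g hg
    rw [mem_closure_iff_nhds] at hg ⊢
    intro t ht
    -- Inversion is a homeomorphism, so the target map is open as well; it carries the arrows
    -- starting near `src g` onto a neighbourhood of `tgt g`, which meets `A`.
    have hinv : IsOpenMap G.inv := (Homeomorph.mk ⟨G.inv, G.inv, G.inv_inv, G.inv_inv⟩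
      G.continuous_inv G.continuous_inv).isOpenMap
    have ho : IsOpenMap G.tgt := by
      have : G.tgt = G.src ∘ G.inv := funext fun g => (G.src_inv g).symm
      rw [this]; exact h.comp hinv
    have h3 : G.tgt '' (G.src ⁻¹' t) ∈ 𝓝 (G.tgt g) :=
      ho.image_mem_nhds (G.continuous_src.continuousAt ht)
    obtain ⟨y, ⟨k, hk, rfl⟩, hy⟩ := hg _ h3
    exact ⟨G.src k, hk, (hA k).2 hy⟩
  intro g
  refine ⟨fun hg => ?_, h1 g⟩
  have := h1 (G.inv g)
  rw [G.tgt_inv, G.src_inv] at this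
  exact this hg

end TopGroupoid

section Restrict

variable {E : Type*} [NormedAddCommGroup E] [NormedSpace ℝ E] {G B : TopGroupoid.{v}}
  [ChartedSpace E G.Obj] {E' : Type*} [NormedAddCommGroup E'] [NormedSpace ℝ E']
  [ChartedSpace E' B.Obj]

theorem contMDiffAt_codRestrict {N : Type*} [TopologicalSpace N] {H' : Type*} [TopologicalSpace H']
    {I' : ModelWithCorners ℝ E' H'} [ChartedSpace H' N] {U : Opens G.Obj}
    {f : N → (G.restrict U).Obj} {x : N}
    (hf : ContMDiffAt I' 𝓘(ℝ, E) ∞ (fun y => (f y).1) x) : ContMDiffAt I' 𝓘(ℝ, E) ∞ f x :=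
  (ContMDiffAt.subtypeVal_comp_iff U f x).1 hf

theorem contMDiff_restrict_val (U : Opens G.Obj) :
    ContMDiff 𝓘(ℝ, E) 𝓘(ℝ, E) ∞ (fun x : (G.restrict U).Obj => x.1) :=
  contMDiff_subtype_val (U := U)

/-- Open full subgroupoids of orbifolds are orbifolds. -/
theorem IsOrbifold.restrict (hG : IsOrbifold E G) (U : Opens G.Obj) :
    IsOrbifold E (G.restrict U) where
  isManifold := by
    have := hG.isManifold
    exact inferInstanceAs (IsManifold 𝓘(ℝ, E) ∞ U)
  t2_obj := by
    have := hG.t2_obj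
    exact inferInstanceAs (T2Space {x : G.Obj // x ∈ (U : Set G.Obj)})
  t2_arr := by
    have := hG.t2_arr
    exact inferInstanceAs
      (T2Space {g : G.Arr // G.src g ∈ (U : Set G.Obj) ∧ G.tgt g ∈ (U : Set G.Obj)})
  src_localHomeo := by
    have hv : IsLocalHomeomorph (Subtype.val : (G.restrict U).Obj → G.Obj) :=
      U.isOpen.isOpenEmbedding_subtypeVal.isLocalHomeomorph
    refine IsLocalHomeomorph.of_comp (g := Subtype.val) ?_ hv (G.restrict U).continuous_src
    have ho : IsOpen {g : G.Arr | G.src g ∈ (U : Set G.Obj) ∧ G.tgt g ∈ (U : Set G.Obj)} :=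
      (U.isOpen.preimage G.continuous_src).inter (U.isOpen.preimage G.continuous_tgt)
    exact hG.src_localHomeo.comp ho.isOpenEmbedding_subtypeVal.isLocalHomeomorph
  smooth g := by
    classical
    obtain ⟨f, hf, hf'⟩ := hG.smooth g.1
    -- The default value is harmless: `f` maps `src g` to `tgt g` in `U`, so it stays in `U` nearby.
    let f' : (G.restrict U).Obj → (G.restrict U).Obj := fun x =>
      if h : f x.1 ∈ U then ⟨f x.1, h⟩ else (G.restrict U).tgt g
    have hfg : f (G.src g.1) = G.tgt g.1 := hf'.self_of_nhds
    refine ⟨f', contMDiffAt_codRestrict ?_, ?_⟩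
    · have h1 : ContMDiffAt 𝓘(ℝ, E) 𝓘(ℝ, E) ∞ (fun x : (G.restrict U).Obj => f x.1)
          ((G.restrict U).src g) :=
        ContMDiffAt.comp (x := (G.restrict U).src g) (g := f) hf (contMDiff_restrict_val U _)
      refine h1.congr_of_eventuallyEq ?_
      have h2 : (U : Set G.Obj) ∈ 𝓝 (f ((G.restrict U).src g).1) := by
        change (U : Set G.Obj) ∈ 𝓝 (f (G.src g.1))
        rw [hfg]; exact U.isOpen.mem_nhds g.2.2
      filter_upwards [h1.continuousAt h2] with x hx
      have hx' : f x.1 ∈ U := hx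
      exact congrArg Subtype.val (dif_pos hx')
    · have h3 : Tendsto (fun h : (G.restrict U).Arr => h.1) (𝓝 g) (𝓝 g.1) :=
        continuous_subtype_val.continuousAt
      filter_upwards [h3.eventually hf'] with h hh
      have hx' : f (G.src h.1) ∈ U := by rw [hh]; exact h.2.2
      exact (dif_pos hx').trans (Subtype.ext hh)
  proper := full_proper hG.proper

end Restrict

/-! ### The local action of arrows on total spaces -/

section Action

variable {E : Type*} [NormedAddCommGroup E] [NormedSpace ℝ E] {G : TopGroupoid.{v}}
  [ChartedSpace E G.Obj] {R : Type*} [NormedAddCommGroup R] [NormedSpace ℝ R]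
  {V : OrbiBundle.{v, w} E G R}

theorem OrbiBundle.exists_smooth_act (V : OrbiBundle.{v, w} E G R) (g : G.Arr) :
    ∃ Φ : V.Total → V.Total,
      (∀ a, a.proj = G.src g →
        ContMDiffAt (𝓘(ℝ, E).prod 𝓘(ℝ, R)) (𝓘(ℝ, E).prod 𝓘(ℝ, R)) ∞ Φ a) ∧
      ∀ᶠ h in 𝓝 g, ∀ a b, V.Acts h a b → Φ a = b := by
  obtain ⟨Φ, hΦ, hΦ'⟩ := V.smooth_act g
  refine ⟨Φ, hΦ, hΦ'.mono fun h hh a b hab => ?_⟩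
  obtain ⟨x, rfl, rfl⟩ := hab
  exact hh x

/-- The sources of the arrows near `g` with property `p` fill a neighbourhood of `f x`, as the
source map is open. -/
theorem eventually_exists_arr (hs : IsOpenMap G.src) {X : Type*} [TopologicalSpace X]
    {f : X → G.Obj} {x : X} (hf : ContinuousAt f x) {g : G.Arr} (hg : G.src g = f x)
    {p : G.Arr → Prop} (hp : ∀ᶠ h in 𝓝 g, p h) : ∀ᶠ y in 𝓝 x, ∃ h, p h ∧ G.src h = f y := by
  have h1 := hs.image_mem_nhds hp
  rw [hg] at h1
  filter_upwards [hf h1] with y hy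
  obtain ⟨h, hh, hy⟩ := hy
  exact ⟨h, hh, hy⟩

/-- Near `g₀` all arrows act by one and the same map `Φ` of the total space, which is continuous
over `src g₀`; eventually `b` is `Φ ∘ a`. -/
theorem OrbiBundle.tendsto_of_acts {α : Type*} {l : Filter α} {g : α → G.Arr} {g₀ : G.Arr}
    {a b : α → V.Total} {a₀ b₀ : V.Total} (hg : Tendsto g l (𝓝 g₀)) (ha : Tendsto a l (𝓝 a₀))
    (h : ∀ x, V.Acts (g x) (a x) (b x)) (h₀ : V.Acts g₀ a₀ b₀) : Tendsto b l (𝓝 b₀) := by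
  obtain ⟨Φ, hΦ, hΦ'⟩ := V.exists_smooth_act g₀
  have h1 : Φ a₀ = b₀ := hΦ'.self_of_nhds _ _ h₀
  have h2 := (hΦ a₀ h₀.proj_src).continuousAt.tendsto.comp ha
  rw [h1] at h2
  refine h2.congr' ?_
  filter_upwards [hg.eventually hΦ'] with x hx
  exact hx _ _ (h x)

/-- An arrow acts near a point of the total space by a local diffeomorphism. -/
theorem OrbiBundle.exists_local_diffeo (hs : IsOpenMap G.src) (V : OrbiBundle.{v, w} E G R)
    {g : G.Arr} {a b : V.Total} (hab : V.Acts g a b) : ∃ ψ ψ' : V.Total → V.Total,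
      ContMDiffAt (𝓘(ℝ, E).prod 𝓘(ℝ, R)) (𝓘(ℝ, E).prod 𝓘(ℝ, R)) ∞ ψ a ∧
      ContMDiffAt (𝓘(ℝ, E).prod 𝓘(ℝ, R)) (𝓘(ℝ, E).prod 𝓘(ℝ, R)) ∞ ψ' b ∧
      ψ a = b ∧ ψ' b = a ∧ ψ' ∘ ψ =ᶠ[𝓝 a] id ∧ ψ ∘ ψ' =ᶠ[𝓝 b] id ∧
      ∀ p : G.Arr → Prop, (∀ᶠ h in 𝓝 g, p h) → ∀ᶠ m in 𝓝 a, ∃ h, p h ∧ V.Acts h m (ψ m) := by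
  have key : ∀ {g : G.Arr} {a b : V.Total} {Φ : V.Total → V.Total}, V.Acts g a b →
      (∀ᶠ h in 𝓝 g, ∀ a b, V.Acts h a b → Φ a = b) → ∀ p : G.Arr → Prop, (∀ᶠ h in 𝓝 g, p h) →
      ∀ᶠ m in 𝓝 a, ∃ h, p h ∧ V.Acts h m (Φ m) := by
    intro g a b Φ hab hΦ p hp
    have hc : ContinuousAt (fun m : V.Total => m.proj) a :=
      (FiberBundle.continuous_proj R V.Fib).continuousAt
    filter_upwards [eventually_exists_arr hs hc hab.proj_src.symm (hΦ.and hp)] with m hm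
    obtain ⟨h, ⟨h1, h2⟩, h3⟩ := hm
    obtain ⟨y, rfl⟩ := V.exists_fib _ m h3.symm
    have h4 := V.acts_act h y
    exact ⟨h, h2, by rwa [h1 _ _ h4]⟩
  obtain ⟨ψ, h1, h2⟩ := V.exists_smooth_act g
  obtain ⟨ψ', h1', h2'⟩ := V.exists_smooth_act (G.inv g)
  have hba := V.acts_inv hab
  refine ⟨ψ, ψ', h1 a hab.proj_src, h1' b hba.proj_src, h2.self_of_nhds _ _ hab,
    h2'.self_of_nhds _ _ hba, ?_, ?_, key hab h2⟩
  · filter_upwards [key hab h2 _ (G.continuous_inv.continuousAt.eventually h2')] with m hm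
    obtain ⟨h, h3, h4⟩ := hm
    exact h3 _ _ (V.acts_inv h4)
  -- Inverses of arrows near `g⁻¹` are near `g`, so they act by `ψ`.
  · have h5 : ∀ᶠ h in 𝓝 (G.inv g), ∀ a b, V.Acts (G.inv h) a b → ψ a = b := by
      have h6 := G.continuous_inv.continuousAt (x := G.inv g)
      rw [ContinuousAt, G.inv_inv] at h6
      exact h6.eventually h2
    filter_upwards [key hba h2' _ h5] with m hm
    obtain ⟨h, h3, h4⟩ := hm
    exact h3 _ _ (V.acts_inv h4)

end Action

end VirtualOrb
end

/-! ### The groupoid `O_I` is étale and proper -/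

noncomputable section

namespace VirtualOrb
open TopGroupoid

namespace StabilizationData

variable {E : Type*} [NormedAddCommGroup E] [NormedSpace ℝ E]
  {F : Type*} [NormedAddCommGroup F] [NormedSpace ℝ F] {𝔉 : FredholmSystem.{v} E F}
  {ι : Type} {𝒮 : StabilizationData 𝔉 ι}

section Groupoid

variable {I : Finset ι} {A : Opens 𝔉.B.Obj} {hA : ∀ i ∈ I, A ≤ 𝒮.U i}

theorem Pt.ext_tot {p q : 𝒮.Pt I A hA} (h : p.base.1 = q.base.1) (h' : ∀ i, p.tot i = q.tot i) :
    p = q := by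
  obtain ⟨x, a⟩ := p
  obtain ⟨y, b⟩ := q
  obtain rfl : x = y := Subtype.ext h
  have : a = b := funext fun i => eq_of_heq (TotalSpace.mk.inj (h' i)).2
  rw [this]

theorem Pt.isEmbedding : Topology.IsEmbedding (fun p : 𝒮.Pt I A hA => (p.base, p.tot)) :=
  ⟨⟨rfl⟩, fun _ _ h => Pt.ext_tot (congrArg (fun x => x.1.1) h)
    fun i => congrFun (congrArg Prod.snd h) i⟩

theorem Pt.continuous_tot (i : I) : Continuous (fun p : 𝒮.Pt I A hA => p.tot i) :=
  (continuous_apply i).comp (continuous_snd.comp Pt.isEmbedding.continuous)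

theorem Pt.tendsto_iff {α : Type*} {l : Filter α} {a : α → 𝒮.Pt I A hA} {p : 𝒮.Pt I A hA} :
    Tendsto a l (𝓝 p) ↔ Tendsto (fun x => (a x).base.1) l (𝓝 p.base.1) ∧
      ∀ i, Tendsto (fun x => (a x).tot i) l (𝓝 (p.tot i)) := by
  rw [Pt.isEmbedding.tendsto_nhds_iff]
  constructor
  · intro h
    exact ⟨(continuous_subtype_val.tendsto _).comp ((continuous_fst.tendsto _).comp h),
      tendsto_pi_nhds.1 ((continuous_snd.tendsto _).comp h)⟩
  · rintro ⟨h1, h2⟩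
    exact (tendsto_subtype_rng.2 h1).prodMk_nhds (tendsto_pi_nhds.2 h2)

/-- The point `g • p`. -/
def Pt.move (g : 𝔉.B.Arr) (p : 𝒮.Pt I A hA) (hs : 𝔉.B.src g = p.base.1) (ht : 𝔉.B.tgt g ∈ A) :
    𝒮.Pt I A hA where
  base := ⟨𝔉.B.tgt g, ht⟩
  vec i := (𝒮.O i).actTo ⟨g, hs ▸ hA i i.2 p.base.2, hA i i.2 ht⟩
    (x := 𝔉.B.mkObj p.base.1 (hA i i.2 p.base.2)) (y := 𝔉.B.mkObj (𝔉.B.tgt g) (hA i i.2 ht))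
    (Subtype.ext hs) rfl (p.vec i)

theorem Pt.acts_move (g : 𝔉.B.Arr) (p : 𝒮.Pt I A hA) (hs : 𝔉.B.src g = p.base.1)
    (ht : 𝔉.B.tgt g ∈ A) : Pt.Acts g p (p.move g hs ht) :=
  ⟨hs, rfl, fun i => (𝒮.O i).acts_actTo _ _ _ _⟩

theorem Pt.Acts.unique {g : 𝔉.B.Arr} {p q q' : 𝒮.Pt I A hA} (h : Pt.Acts g p q)
    (h' : Pt.Acts g p q') : q = q' := by
  obtain ⟨hs, ht, H⟩ := h
  obtain ⟨hs', ht', H'⟩ := h'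
  exact Pt.ext_tot (ht.symm.trans ht') fun i => (H i).unique (H' i)

theorem Pt.tendsto_of_acts {α : Type*} {l : Filter α} {g : α → 𝔉.B.Arr} {g₀ : 𝔉.B.Arr}
    {a b : α → 𝒮.Pt I A hA} {a₀ b₀ : 𝒮.Pt I A hA} (hg : Tendsto g l (𝓝 g₀))
    (ha : Tendsto a l (𝓝 a₀)) (h : ∀ x, Pt.Acts (g x) (a x) (b x)) (h₀ : Pt.Acts g₀ a₀ b₀) :
    Tendsto b l (𝓝 b₀) := by
  obtain ⟨hs, ht, H⟩ := h₀
  refine Pt.tendsto_iff.2 ⟨?_, fun i => ?_⟩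
  · have := (𝔉.B.continuous_tgt.tendsto _).comp hg
    rw [ht] at this
    exact this.congr fun x => (h x).2.1
  · refine (𝒮.O i).tendsto_of_acts (g := fun x => ⟨g x, _⟩) (g₀ := ⟨g₀, _⟩)
      (tendsto_subtype_rng.2 hg) ((Pt.tendsto_iff.1 ha).2 i) (fun x => (h x).2.2 i) (H i)

theorem Pt.t2Space : T2Space (𝒮.Pt I A hA) := by
  have h1 : T2Space 𝔉.B.Obj := 𝔉.isOrbifold.t2_obj
  have h2 : ∀ i : I, T2Space (𝒮.O i).Total := fun i => by
    have : T2Space (𝔉.B.restrict (𝒮.U i)).Obj := (𝔉.isOrbifold.restrict (𝒮.U i)).t2_obj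
    exact totalSpace_t2
  exact Pt.isEmbedding.t2Space

/-- An arrow of `O_I` is a base arrow together with its starting point. A local section of the
source map of the base therefore lifts: from `p` follow the base arrow chosen at the base point of
`p`, as long as its target stays in `A`. -/
theorem sumGroupoid_src_isLocalHomeomorph :
    IsLocalHomeomorph (𝒮.sumGroupoid I A hA).src := by
  refine isLocalHomeomorph_of_section (𝒮.sumGroupoid I A hA).continuous_src ?_
  rintro ⟨⟨g₀, p₀, q₀⟩, h₀⟩
  obtain ⟨e, hg₀, he⟩ := 𝔉.isOrbifold.src_localHomeo g₀
  have he' : ∀ {x}, x ∈ e.target → 𝔉.B.src (e.symm x) = x := fun {x} hx => by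
    rw [he, e.right_inv hx]
  have hb : Continuous (fun p : 𝒮.Pt I A hA => p.base.1) :=
    continuous_subtype_val.comp Pt.continuous_base
  let D : Set 𝔉.B.Obj := e.target ∩ e.symm ⁻¹' (𝔉.B.tgt ⁻¹' A)
  have hD : IsOpen D :=
    e.symm.isOpen_inter_preimage (A.isOpen.preimage 𝔉.B.continuous_tgt)
  let T : Set (𝒮.Pt I A hA) := (fun p => p.base.1) ⁻¹' D
  have hact : ∀ y : T, Pt.Acts (e.symm y.1.base.1) y.1
      (y.1.move (e.symm y.1.base.1) (he' y.2.1) y.2.2) := fun y => Pt.acts_move _ _ _ _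
  have hsc : Continuous (fun y : T => e.symm y.1.base.1) :=
    e.continuousOn_symm.comp_continuous (hb.comp continuous_subtype_val) fun y => y.2.1
  refine ⟨{a | a.1.1 ∈ e.source}, T, fun y => ⟨(e.symm y.1.base.1, y.1, _), hact y⟩, ?_, ?_, hg₀,
    ?_, ?_, ?_⟩
  · exact e.open_source.preimage (continuous_fst.comp continuous_subtype_val)
  · exact hD.preimage hb
  · refine Continuous.subtype_mk (hsc.prodMk (continuous_subtype_val.prodMk ?_)) _
    refine continuous_iff_continuousAt.2 fun y => ?_
    exact Pt.tendsto_of_acts (hsc.tendsto y) (continuous_subtype_val.tendsto y) hact (hact y)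
  · exact fun y => ⟨e.map_target y.2.1, rfl⟩
  · rintro ⟨⟨g, p, q⟩, hs, ht, H⟩ hg
    change g ∈ e.source at hg
    have h1 : e.symm p.base.1 = g := by rw [← hs, he, e.left_inv hg]
    have h2 : p ∈ T := by
      refine ⟨?_, ?_⟩
      · change p.base.1 ∈ e.target
        rw [← hs, he]; exact e.map_source hg
      · change 𝔉.B.tgt (e.symm p.base.1) ∈ A
        rw [h1, ht]; exact q.base.2
    refine ⟨h2, Subtype.ext (Prod.ext h1 (Prod.ext rfl ?_))⟩
    have h3 : Pt.Acts (e.symm p.base.1) p q := by rw [h1]; exact ⟨hs, ht, H⟩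
    exact (hact ⟨p, h2⟩).unique h3

/-- Properness of the base provides a limit `g` of the base arrows. The targets converge both to `g
• p`, by continuity of the action, and to `q`; the Hausdorff property gives `g • p = q`. -/
theorem sumGroupoid_proper : IsProperMap fun a : (𝒮.sumGroupoid I A hA).Arr =>
    ((𝒮.sumGroupoid I A hA).src a, (𝒮.sumGroupoid I A hA).tgt a) := by
  refine isProperMap_iff_ultrafilter.2 ⟨(𝒮.sumGroupoid I A hA).continuous_src.prodMk
    (𝒮.sumGroupoid I A hA).continuous_tgt, ?_⟩
  rintro 𝒰 ⟨p, q⟩ hy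
  have hp : Tendsto (fun a : (𝒮.sumGroupoid I A hA).Arr => a.1.2.1) 𝒰 (𝓝 p) :=
    (continuous_fst.tendsto _).comp hy
  have hq : Tendsto (fun a : (𝒮.sumGroupoid I A hA).Arr => a.1.2.2) 𝒰 (𝓝 q) :=
    (continuous_snd.tendsto _).comp hy
  have h1 : Tendsto (fun g : 𝔉.B.Arr => (𝔉.B.src g, 𝔉.B.tgt g))
      (𝒰.map fun a : (𝒮.sumGroupoid I A hA).Arr => a.1.1) (𝓝 (p.base.1, q.base.1)) := by
    refine (Tendsto.congr (fun a => ?_)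
      ((Pt.tendsto_iff.1 hp).1.prodMk_nhds (Pt.tendsto_iff.1 hq).1) :
      Tendsto ((fun g : 𝔉.B.Arr => (𝔉.B.src g, 𝔉.B.tgt g)) ∘
        fun a : (𝒮.sumGroupoid I A hA).Arr => a.1.1) 𝒰 _)
    exact Prod.ext a.2.1.symm a.2.2.1.symm
  obtain ⟨g, hg, hg'⟩ := (isProperMap_iff_ultrafilter.1 𝔉.isOrbifold.proper).2 h1
  have hs : 𝔉.B.src g = p.base.1 := congrArg Prod.fst hg
  have ht : 𝔉.B.tgt g = q.base.1 := congrArg Prod.snd hg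
  have h2 := p.acts_move g hs (ht ▸ q.base.2)
  have h3 : Tendsto (fun a : (𝒮.sumGroupoid I A hA).Arr => a.1.1) 𝒰 (𝓝 g) := hg'
  have h4 := Pt.tendsto_of_acts h3 hp (fun a => a.2) h2
  have := Pt.t2Space (𝒮 := 𝒮) (hA := hA)
  have h5 := tendsto_nhds_unique h4 hq
  rw [h5] at h2
  refine ⟨⟨(g, p, q), h2⟩, rfl, ?_⟩
  exact tendsto_id'.1 (tendsto_subtype_rng.2 (h3.prodMk_nhds (hp.prodMk_nhds hq)))

end Groupoid

end StabilizationData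

end VirtualOrb
end

/-! ### The total space of `O_I` as a manifold, and `Ŝ` as a smooth map on it -/

noncomputable section

namespace VirtualOrb
open TopGroupoid

/-- The inverse local trivialization of the sum is, component by component, the inverse
trivialization of `O j`. The latter occurs in `localRep`, the former in the charts of the manifold.
-/
theorem sumIso_coordChange {E : Type*} [NormedAddCommGroup E] [NormedSpace ℝ E]
    {E' : Type*} [NormedAddCommGroup E'] [NormedSpace ℝ E'] {G : TopGroupoid.{v}}
    [ChartedSpace E' G.Obj] {κ : Type} [Fintype κ] {H : κ → TopGroupoid.{v}}
    [∀ j, ChartedSpace E (H j).Obj] {k : κ → ℕ} (O : ∀ j, OrbiBundle.{v, w} E (H j) (Euc (k j)))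
    (o : ∀ j, Hom G (H j)) (ho : ∀ j, ContMDiff 𝓘(ℝ, E') 𝓘(ℝ, E) ∞ (o j).obj) {x u : G.Obj}
    (hu : u ∈ (sumCore O o ho).baseSet x) (y : ∀ j, Euc (k j)) (j : κ) :
    sumIso O o ho u ((sumCore O o ho).coordChange x u u ((eucSplit k).symm y)) j =
      (sumTriv O o j x).symm ((o j).obj u) (y j) := by
  have hu' := mem_baseSet_trivializationAt (Euc (k j)) (O j).Fib ((o j).obj u)
  let L := (trivializationAt (Euc (k j)) (O j).Fib ((o j).obj u)).linearEquivAt ℝ ((o j).obj u) hu'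
  have h1 : eucSplit k ((sumCore O o ho).coordChange x u u ((eucSplit k).symm y)) j =
      L ((sumTriv O o j x).symm ((o j).obj u) (y j)) := by
    refine (eucSplit_blockDiag (k := k) _ _ j).trans ?_
    rw [ContinuousLinearEquiv.apply_symm_apply, ContinuousLinearEquiv.coe_coe,
      Trivialization.coordChangeL_apply _ _ ⟨hu j, hu'⟩]
    rfl
  exact (congrArg L.symm h1).trans (L.symm_apply_apply _)

namespace StabilizationData

variable {E : Type*} [NormedAddCommGroup E] [NormedSpace ℝ E]
  {F : Type*} [NormedAddCommGroup F] [NormedSpace ℝ F] {𝔉 : FredholmSystem.{v} E F}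
  {ι : Type} (𝒮 : StabilizationData 𝔉 ι)

section Ambient

variable (I : Finset ι) (A : Opens 𝔉.B.Obj) (hA : ∀ i ∈ I, A ≤ 𝒮.U i)

/-- The inclusion of `A` into `U i`. -/
def baseHom (i : I) : Hom (𝔉.B.restrict A) (𝔉.B.restrict (𝒮.U i)) :=
  (TopGroupoid.incl 𝔉.B (A : Set 𝔉.B.Obj)).codRestrict (𝒮.U i) fun x => hA i i.2 x.2

theorem contMDiff_baseHom (i : I) : ContMDiff 𝓘(ℝ, E) 𝓘(ℝ, E) ∞ (𝒮.baseHom I A hA i).obj :=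
  fun _ => contMDiffAt_codRestrict (contMDiff_restrict_val A _)

/-- The orbifold vector bundle `O_I` over `A`. -/
def ambBundle : OrbiBundle.{v, 0} E (𝔉.B.restrict A) (Euc (∑ i : I, 𝒮.k i)) :=
  pullbackSum (fun i : I => 𝒮.O i) (𝒮.baseHom I A hA) (𝒮.contMDiff_baseHom I A hA)
    (𝔉.isOrbifold.restrict A)

/-- The total space of `O_I` over `A`, as a manifold. -/
abbrev Amb : Type v := TotalSpace (Euc (∑ i : I, 𝒮.k i))
  (sumCore (fun i : I => 𝒮.O i) (𝒮.baseHom I A hA) (𝒮.contMDiff_baseHom I A hA)).Fiber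

/-- The model with corners of the total space of `O_I`. -/
abbrev ambModel : ModelWithCorners ℝ (E × Euc (∑ i : I, 𝒮.k i))
    (ModelProd E (Euc (∑ i : I, 𝒮.k i))) :=
  𝓘(ℝ, E).prod 𝓘(ℝ, Euc (∑ i : I, 𝒮.k i))

variable {I A hA} {𝒮}

theorem amb_isManifold : IsManifold (𝒮.ambModel I) ∞ (𝒮.Amb I A hA) := by
  have := (𝔉.isOrbifold.restrict A).isManifold
  infer_instance

/-- The component in `O i` of a point of the total space of `O_I`. -/
abbrev Amb.tot (a : 𝒮.Amb I A hA) (i : I) : (𝒮.O i).Total :=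
  sumTot (fun i : I => 𝒮.O i) (𝒮.baseHom I A hA) (𝒮.contMDiff_baseHom I A hA) a i

/-- The point of the manifold `O_I` given by `p`. -/
def Pt.pack (p : 𝒮.Pt I A hA) : 𝒮.Amb I A hA :=
  ⟨𝔉.B.mkObj p.base.1 p.base.2, (sumIso (fun i : I => 𝒮.O i) (𝒮.baseHom I A hA)
    (𝒮.contMDiff_baseHom I A hA) (𝔉.B.mkObj p.base.1 p.base.2)).symm p.vec⟩

/-- The point of `O_I` given by a point of the manifold. -/
def Amb.unpack (a : 𝒮.Amb I A hA) : 𝒮.Pt I A hA :=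
  ⟨a.proj, sumIso (fun i : I => 𝒮.O i) (𝒮.baseHom I A hA) (𝒮.contMDiff_baseHom I A hA) a.proj a.2⟩

theorem Pt.tot_pack (p : 𝒮.Pt I A hA) (i : I) : Amb.tot p.pack i = p.tot i :=
  sumTot_mk (O := fun i : I => 𝒮.O i) (o := 𝒮.baseHom I A hA)
    (ho := 𝒮.contMDiff_baseHom I A hA) (𝔉.B.mkObj p.base.1 p.base.2) p.vec i

theorem Pt.unpack_pack (p : 𝒮.Pt I A hA) : Amb.unpack p.pack = p :=
  Pt.ext_tot rfl fun i => p.tot_pack i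

/-- Both topologies are induced by the same map, to the base point and the components; see
`sum_isInducing`. -/
theorem Pt.isEmbedding_pack : Topology.IsEmbedding (Pt.pack : 𝒮.Pt I A hA → 𝒮.Amb I A hA) := by
  refine ⟨?_, fun p q h => by rw [← p.unpack_pack, h, q.unpack_pack]⟩
  have h1 := sum_isInducing (fun i : I => 𝒮.O i) (𝒮.baseHom I A hA) (𝒮.contMDiff_baseHom I A hA)
  refine h1.of_comp_iff.1 ?_
  have h2 : (fun a : 𝒮.Amb I A hA => (a.proj, Amb.tot a)) ∘ Pt.pack =
      fun p : 𝒮.Pt I A hA => (p.base, p.tot) :=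
    funext fun p => Prod.ext rfl (funext fun i => p.tot_pack i)
  change Topology.IsInducing ((fun a : 𝒮.Amb I A hA => (a.proj, Amb.tot a)) ∘ Pt.pack)
  rw [h2]
  exact Pt.isEmbedding.isInducing

/-- The value of `Ŝ` at a point of `O_I`. -/
def Pt.hat (p : 𝒮.Pt I A hA) : 𝔉.bundle.Total :=
  ⟨p.base.1, 𝔉.S p.base.1 + ∑ i : I, 𝒮.s i (𝔉.B.mkObj p.base.1 (hA i i.2 p.base.2)) (p.vec i)⟩

theorem Pt.isZero_iff (p : 𝒮.Pt I A hA) : p.IsZero ↔ p.hat.2 = 0 := Iff.rfl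

/-- The map `Ŝ` in the trivialization at `u₀`. -/
def gRep (I : Finset ι) (A : Opens 𝔉.B.Obj) (hA : ∀ i ∈ I, A ≤ 𝒮.U i) (u₀ : 𝔉.B.Obj)
    (a : 𝒮.Amb I A hA) : F :=
  (trivializationAt F 𝔉.bundle.Fib u₀ (Amb.unpack a).hat).2

theorem trivialization_hat {u₀ : 𝔉.B.Obj} (p : 𝒮.Pt I A hA)
    (hp : p.base.1 ∈ (trivializationAt F 𝔉.bundle.Fib u₀).baseSet) :
    (trivializationAt F 𝔉.bundle.Fib u₀ p.hat).2 =
      (trivializationAt F 𝔉.bundle.Fib u₀ ⟨p.base.1, 𝔉.S p.base.1⟩).2 +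
      ∑ i : I, 𝒮.η i p.base.1 • (trivializationAt F 𝔉.bundle.Fib u₀
        ⟨p.base.1, 𝒮.incl i (p.tot i).proj (p.tot i).2⟩).2 := by
  let e := trivializationAt F 𝔉.bundle.Fib u₀
  let L := e.linearEquivAt ℝ p.base.1 hp
  exact (map_add L _ _).trans (congrArg₂ (· + ·) rfl
    ((map_sum L _ _).trans (Finset.sum_congr rfl fun i _ => map_smul L _ _)))

/-- Trivializations are linear on fibres, so locally `Ŝ` becomes the sum of `S` and the terms `η_i •
incl_i`, each a composite of smooth maps with the projection or a component. -/
theorem contMDiff_hat : ContMDiff (𝒮.ambModel I) (𝓘(ℝ, E).prod 𝓘(ℝ, F)) ∞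
    (fun a : 𝒮.Amb I A hA => (Amb.unpack a).hat) := by
  intro a
  have h0 := contMDiff_proj (n := ∞) (F := Euc (∑ i : I, 𝒮.k i)) (IB := 𝓘(ℝ, E))
      (sumCore (fun i : I => 𝒮.O i) (𝒮.baseHom I A hA) (𝒮.contMDiff_baseHom I A hA)).Fiber
  have h1 : ContMDiff (𝒮.ambModel I) 𝓘(ℝ, E) ∞ (fun a : 𝒮.Amb I A hA => a.proj.1) :=
    (contMDiff_restrict_val A).comp h0
  rw [contMDiffAt_totalSpace]
  refine ⟨h1 a, ?_⟩
  have h2 : ContMDiffAt (𝒮.ambModel I) 𝓘(ℝ, F) ∞ (fun b : 𝒮.Amb I A hA =>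
      (trivializationAt F 𝔉.bundle.Fib a.proj.1 ⟨b.proj.1, 𝔉.S b.proj.1⟩).2) a :=
    (contMDiffAt_totalSpace.1 ((𝔉.smooth_S.comp h1) a)).2
  have h3 : ∀ i : I, ContMDiffAt (𝒮.ambModel I) 𝓘(ℝ, F) ∞ (fun b : 𝒮.Amb I A hA =>
      𝒮.η i b.proj.1 • (trivializationAt F 𝔉.bundle.Fib a.proj.1
        ⟨b.proj.1, 𝒮.incl i (Amb.tot b i).proj (Amb.tot b i).2⟩).2) a := by
    intro i
    have h4 : ContMDiff (𝒮.ambModel I) (𝓘(ℝ, E).prod 𝓘(ℝ, Euc (𝒮.k i))) ∞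
      (fun b : 𝒮.Amb I A hA => Amb.tot b i) := contMDiff_sumTot i
    exact (((𝒮.smooth_η i).comp h1) a).smul
      (contMDiffAt_totalSpace.1 (((𝒮.smooth_incl i).comp h4) a)).2
  refine (h2.add (ContMDiffAt.sum (t := Finset.univ) fun i _ => h3 i)).congr_of_eventuallyEq ?_
  have h5 := h1.continuous.continuousAt.eventually
    ((trivializationAt F 𝔉.bundle.Fib a.proj.1).open_baseSet.mem_nhds
      (mem_baseSet_trivializationAt F 𝔉.bundle.Fib a.proj.1))
  filter_upwards [h5] with b hb
  exact trivialization_hat (Amb.unpack b) hb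

theorem contMDiffOn_gRep (u₀ : 𝔉.B.Obj) : ContMDiffOn (𝒮.ambModel I) 𝓘(ℝ, F) ∞
    (𝒮.gRep I A hA u₀)
    {a | a.proj.1 ∈ (trivializationAt F 𝔉.bundle.Fib u₀).baseSet} := by
  intro a ha
  have h := contMDiff_hat a
  rw [(trivializationAt F 𝔉.bundle.Fib u₀).contMDiffAt_iff] at h
  · exact h.2.contMDiffWithinAt
  · exact (trivializationAt F 𝔉.bundle.Fib u₀).mem_source.2 ha

theorem isOpen_gRep_domain (u₀ : 𝔉.B.Obj) : IsOpen {a : 𝒮.Amb I A hA |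
    a.proj.1 ∈ (trivializationAt F 𝔉.bundle.Fib u₀).baseSet} :=
  (trivializationAt F 𝔉.bundle.Fib u₀).open_baseSet.preimage (continuous_subtype_val.comp
    (FiberBundle.continuous_proj (Euc (∑ i : I, 𝒮.k i))
      (sumCore (fun i : I => 𝒮.O i) (𝒮.baseHom I A hA) (𝒮.contMDiff_baseHom I A hA)).Fiber))

theorem contMDiffAt_gRep {u₀ : 𝔉.B.Obj} {a : 𝒮.Amb I A hA}
    (ha : a.proj.1 ∈ (trivializationAt F 𝔉.bundle.Fib u₀).baseSet) :
    ContMDiffAt (𝒮.ambModel I) 𝓘(ℝ, F) ∞ (𝒮.gRep I A hA u₀) a :=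
  (contMDiffOn_gRep u₀ a ha).contMDiffAt ((isOpen_gRep_domain u₀).mem_nhds ha)

/-- The derivative of `Ŝ` in the trivialization at `u₀`. -/
def dRep (u₀ : 𝔉.B.Obj) (a : 𝒮.Amb I A hA) : (E × Euc (∑ i : I, 𝒮.k i)) →L[ℝ] F :=
  mfderiv (𝒮.ambModel I) 𝓘(ℝ, F) (𝒮.gRep I A hA u₀) a

/-- The linear change of coordinates between the two models of `O_I`. -/
def ambEquiv (𝒮 : StabilizationData 𝔉 ι) (I : Finset ι) :
    (E × (∀ i : I, Euc (𝒮.k i))) ≃L[ℝ] E × Euc (∑ i : I, 𝒮.k i) :=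
  (ContinuousLinearEquiv.refl ℝ E).prodCongr (eucSplit fun i : I => 𝒮.k i).symm

/-- The coordinates of `p` in which its linearization is computed. -/
def Pt.coord (p : 𝒮.Pt I A hA) : E × (∀ i : I, Euc (𝒮.k i)) :=
  (extChartAt 𝓘(ℝ, E) p.base p.base,
    fun i => (trivializationAt (Euc (𝒮.k i)) (𝒮.O i).Fib
      (𝔉.B.mkObj p.base.1 (hA i i.2 p.base.2)) (p.tot i)).2)

theorem Pt.ambEquiv_coord (p : 𝒮.Pt I A hA) :
    𝒮.ambEquiv I p.coord = extChartAt (𝒮.ambModel I) p.pack p.pack := by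
  let C := sumCore (fun i : I => 𝒮.O i) (𝒮.baseHom I A hA) (𝒮.contMDiff_baseHom I A hA)
  rw [FiberBundle.extChartAt]
  refine Prod.ext rfl ?_
  refine (eucSplit fun i : I => 𝒮.k i).injective ?_
  refine ((eucSplit fun i : I => 𝒮.k i).apply_symm_apply _).trans (funext fun i => Eq.symm ?_)
  refine (eucSplit_localTriv (O := fun i : I => 𝒮.O i) (o := 𝒮.baseHom I A hA)
    (ho := 𝒮.contMDiff_baseHom I A hA) p.pack.proj p.pack (C.mem_baseSet_at _) i).trans ?_
  rw [show sumTot (fun i : I => 𝒮.O i) (𝒮.baseHom I A hA) (𝒮.contMDiff_baseHom I A hA) p.pack i =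
    p.tot i from p.tot_pack i]
  rfl

/-- The linearization is defined in the coordinates `E × ∏ ℝ^{k_i}`, the charts of the manifold take
values in `E × ℝ^{∑ k_i}`. The two expressions of `Ŝ` agree up to this linear identification
wherever the base point stays in the domains of the trivializations at `p`. -/
theorem localRep_eventuallyEq (p : 𝒮.Pt I A hA) : localRep hA p.base =ᶠ[𝓝 p.coord]
    (𝒮.gRep I A hA p.base.1 ∘ (extChartAt (𝒮.ambModel I) p.pack).symm) ∘ 𝒮.ambEquiv I := by
  let C := sumCore (fun i : I => 𝒮.O i) (𝒮.baseHom I A hA) (𝒮.contMDiff_baseHom I A hA)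
  have hc : ContinuousAt (fun z : E × (∀ i : I, Euc (𝒮.k i)) =>
      (extChartAt 𝓘(ℝ, E) p.base).symm z.1) p.coord :=
    ContinuousAt.comp (f := Prod.fst) (continuousAt_extChartAt_symm p.base) continuousAt_fst
  have hm : C.baseSet p.pack.proj ∈ 𝓝 ((extChartAt 𝓘(ℝ, E) p.base).symm p.coord.1) := by
    rw [Pt.coord, extChartAt_to_inv]
    exact (C.isOpen_baseSet _).mem_nhds (C.mem_baseSet_at p.pack.proj)
  filter_upwards [hc hm] with z hz
  rw [Function.comp_apply, Function.comp_apply, FiberBundle.extChartAt]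
  let u : (𝔉.B.restrict A).Obj := (extChartAt 𝓘(ℝ, E) p.base).symm z.1
  have h3 : ∀ i, sumIso (fun i : I => 𝒮.O i) (𝒮.baseHom I A hA) (𝒮.contMDiff_baseHom I A hA) u
      (C.coordChange p.pack.proj u u ((eucSplit fun i : I => 𝒮.k i).symm z.2)) i = _ :=
    sumIso_coordChange (fun i : I => 𝒮.O i) (𝒮.baseHom I A hA) (𝒮.contMDiff_baseHom I A hA)
      hz z.2
  change (trivializationAt F 𝔉.bundle.Fib p.base.1 (Pt.hat (hA := hA) ⟨u, _⟩)).2 =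
    (trivializationAt F 𝔉.bundle.Fib p.base.1 (Pt.hat (hA := hA) ⟨u, sumIso
      (fun i : I => 𝒮.O i) (𝒮.baseHom I A hA) (𝒮.contMDiff_baseHom I A hA) u
      (C.coordChange p.pack.proj u u ((eucSplit fun i : I => 𝒮.k i).symm z.2))⟩)).2
  rw [show sumIso (fun i : I => 𝒮.O i) (𝒮.baseHom I A hA) (𝒮.contMDiff_baseHom I A hA) u
      (C.coordChange p.pack.proj u u ((eucSplit fun i : I => 𝒮.k i).symm z.2)) = _ from
      funext h3]
  rfl

theorem Pt.mdifferentiableAt_gRep (p : 𝒮.Pt I A hA) :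
    MDifferentiableAt (𝒮.ambModel I) 𝓘(ℝ, F) (𝒮.gRep I A hA p.base.1) p.pack :=
  (contMDiffAt_gRep (mem_baseSet_trivializationAt F 𝔉.bundle.Fib
    p.base.1)).mdifferentiableAt (by simp)

/-- Up to a linear isomorphism of the source the linearization is the manifold derivative of `Ŝ` in
a trivialization, so that the chain rule on manifolds becomes available for it. -/
theorem Pt.linearization_eq (p : 𝒮.Pt I A hA) : p.linearization =
    (dRep p.base.1 p.pack).comp (𝒮.ambEquiv I).toContinuousLinearMap := by
  have h2 : dRep p.base.1 p.pack = fderiv ℝ (𝒮.gRep I A hA p.base.1 ∘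
      (extChartAt (𝒮.ambModel I) p.pack).symm) (extChartAt (𝒮.ambModel I) p.pack p.pack) := by
    rw [dRep, p.mdifferentiableAt_gRep.mfderiv]
    have : range (𝒮.ambModel I) = univ := (𝒮.ambModel I).range_eq_univ
    rw [this, fderivWithin_univ]
    rfl
  change fderiv ℝ (localRep hA p.base) p.coord = _
  rw [(localRep_eventuallyEq p).fderiv_eq, h2, ← p.ambEquiv_coord,
    (𝒮.ambEquiv I).comp_right_fderiv]

theorem Pt.differentiableAt_localRep (p : 𝒮.Pt I A hA) :
    DifferentiableAt ℝ (localRep hA p.base) p.coord := by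
  refine DifferentiableAt.congr_of_eventuallyEq ?_ (localRep_eventuallyEq p)
  have h1 := p.mdifferentiableAt_gRep.differentiableWithinAt_writtenInExtChartAt
  have h2 : range (𝒮.ambModel I) = univ := (𝒮.ambModel I).range_eq_univ
  rw [h2, differentiableWithinAt_univ, ← p.ambEquiv_coord] at h1
  exact DifferentiableAt.comp p.coord h1 (𝒮.ambEquiv I).differentiableAt

end Ambient

end StabilizationData

end VirtualOrb
end

/-! ### Invariance of regularity under arrows and changes of trivialization -/

noncomputable section

namespace VirtualOrb
open TopGroupoid

/-- The chain rule with derivatives read as maps of the model spaces; this permits an intermediate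
point that is only known up to a propositional equality. -/
theorem mfderiv_comp_apply_of_eq' {V V' V'' : Type*} [NormedAddCommGroup V] [NormedSpace ℝ V]
    [NormedAddCommGroup V'] [NormedSpace ℝ V'] [NormedAddCommGroup V''] [NormedSpace ℝ V'']
    {H H' H'' : Type*} [TopologicalSpace H] [TopologicalSpace H'] [TopologicalSpace H'']
    {I : ModelWithCorners ℝ V H} {I' : ModelWithCorners ℝ V' H'} {I'' : ModelWithCorners ℝ V'' H''}
    {M M' M'' : Type*} [TopologicalSpace M] [ChartedSpace H M] [TopologicalSpace M']
    [ChartedSpace H' M'] [TopologicalSpace M''] [ChartedSpace H'' M''] {g : M' → M''} {f : M → M'}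
    {x : M} {y : M'} (hg : MDifferentiableAt I' I'' g y) (hf : MDifferentiableAt I I' f x)
    (hy : f x = y) (v : V) : (mfderiv I I'' (g ∘ f) x : V →L[ℝ] V'') v =
      (mfderiv I' I'' g y : V' →L[ℝ] V'') ((mfderiv I I' f x : V →L[ℝ] V') v) := by
  subst hy
  exact DFunLike.congr_fun (mfderiv_comp x hg hf) v

/-- The derivative of a family of maps of a vector space preserving zero, along a map vanishing at
the given point. -/
theorem mfderiv_fiberwise {V : Type*} [NormedAddCommGroup V] [NormedSpace ℝ V]
    {F : Type*} [NormedAddCommGroup F] [NormedSpace ℝ F]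
    {H : Type*} [TopologicalSpace H] {I : ModelWithCorners ℝ V H}
    {M : Type*} [TopologicalSpace M] [ChartedSpace H M] {g : M → F} {α : M × F → F} {x : M}
    (hα : MDifferentiableAt (I.prod 𝓘(ℝ, F)) 𝓘(ℝ, F) α (x, 0))
    (hg : MDifferentiableAt I 𝓘(ℝ, F) g x) (hg0 : g x = 0) (h0 : ∀ᶠ m in 𝓝 x, α (m, 0) = 0)
    (A : F →L[ℝ] F) (hA : ∀ v, α (x, v) = A v) (ξ : V) :
    (mfderiv I 𝓘(ℝ, F) (fun m => α (m, g m)) x : V →L[ℝ] F) ξ =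
      A ((mfderiv I 𝓘(ℝ, F) g x : V →L[ℝ] F) ξ) := by
  -- As `α (m, 0) = 0`, the derivative of `α` in the direction of `M` vanishes at `(x, 0)`; only the
  -- fibre direction contributes. This is why the derivative of a section at a zero does not depend
  -- on the trivialization.
  have h2 : mfderiv I 𝓘(ℝ, F) (fun z => α (z, (0 : F))) x = 0 := by
    have h3 : (fun z => α (z, (0 : F))) =ᶠ[𝓝 x] fun _ => 0 := h0
    rw [h3.mfderiv_eq]
    exact mfderiv_const
  have h3 : mfderiv 𝓘(ℝ, F) 𝓘(ℝ, F) (fun z => α (x, z)) 0 = A := by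
    have : (fun z => α (x, z)) = A := funext hA
    rw [this, mfderiv_eq_fderiv]
    exact A.fderiv
  have h4 : ∀ v : TangentSpace (I.prod 𝓘(ℝ, F)) (x, (0 : F)),
      mfderiv (I.prod 𝓘(ℝ, F)) 𝓘(ℝ, F) α (x, 0) v = A v.2 := fun v => by
    rw [mfderiv_prod_eq_add_apply hα]
    refine (congrArg₂ (· + ·) (DFunLike.congr_fun h2 v.1) (DFunLike.congr_fun h3 v.2)).trans ?_
    exact zero_add _
  have h5 : mfderiv I (I.prod 𝓘(ℝ, F)) (fun m => (m, g m)) x =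
      (mfderiv I I id x).prod (mfderiv I 𝓘(ℝ, F) g x) :=
    mfderiv_prodMk mdifferentiableAt_id hg
  refine (mfderiv_comp_apply_of_eq' (f := fun m => (m, g m)) hα (mdifferentiableAt_id.prodMk hg)
    (by rw [hg0]) ξ).trans ((h4 _).trans ?_)
  exact congrArg A (congrArg Prod.snd (DFunLike.congr_fun h5 ξ))

theorem mfderiv_leftInverse {V : Type*} [NormedAddCommGroup V] [NormedSpace ℝ V]
    {H : Type*} [TopologicalSpace H] {I : ModelWithCorners ℝ V H}
    {M : Type*} [TopologicalSpace M] [ChartedSpace H M] {ψ ψ' : M → M} {a b : M}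
    (h : MDifferentiableAt I I ψ a) (h' : MDifferentiableAt I I ψ' b) (hab : ψ a = b)
    (hψ : ψ' ∘ ψ =ᶠ[𝓝 a] id) (v : V) :
    (mfderiv I I ψ' b : V →L[ℝ] V) ((mfderiv I I ψ a : V →L[ℝ] V) v) = v := by
  rw [← mfderiv_comp_apply_of_eq' h' h hab, hψ.mfderiv_eq, mfderiv_id]
  rfl

namespace StabilizationData

variable {E : Type*} [NormedAddCommGroup E] [NormedSpace ℝ E]
  {F : Type*} [NormedAddCommGroup F] [NormedSpace ℝ F] {𝔉 : FredholmSystem.{v} E F}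
  {ι : Type} {𝒮 : StabilizationData 𝔉 ι}

section Regular

variable {I : Finset ι} {A : Opens 𝔉.B.Obj} {hA : ∀ i ∈ I, A ≤ 𝒮.U i}

/-- The map `Ŝ` is equivariant. -/
theorem Pt.Acts.hat {g : 𝔉.B.Arr} {p q : 𝒮.Pt I A hA} (h : Pt.Acts g p q) :
    𝔉.bundle.Acts g p.hat q.hat := by
  obtain ⟨hs, ht, H⟩ := h
  have h1 : 𝔉.S q.base.1 = 𝔉.bundle.actTo g hs ht (𝔉.S p.base.1) := by
    refine OrbiBundle.Acts.eq_actTo hs ht ?_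
    rw [← hs, ← ht, ← 𝔉.equivariant_S]
    exact 𝔉.bundle.acts_act _ _
  have h2 : ∀ i : I, 𝒮.s i (𝔉.B.mkObj q.base.1 (hA i i.2 q.base.2)) (q.vec i) =
      𝔉.bundle.actTo g hs ht (𝒮.s i (𝔉.B.mkObj p.base.1 (hA i i.2 p.base.2)) (p.vec i)) := by
    intro i
    have h3 : 𝒮.η i q.base.1 = 𝒮.η i p.base.1 := by rw [← hs, ← ht, 𝒮.invariant_η]
    have h4 : 𝒮.incl i (𝔉.B.mkObj q.base.1 (hA i i.2 q.base.2)) (q.vec i) =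
        𝔉.bundle.actTo g hs ht
          (𝒮.incl i (𝔉.B.mkObj p.base.1 (hA i i.2 p.base.2)) (p.vec i)) := by
      refine OrbiBundle.Acts.eq_actTo hs ht ?_
      obtain ⟨x, hx, hy⟩ := H i
      have hx' : (⟨p.base.1, 𝒮.incl i (𝔉.B.mkObj p.base.1 (hA i i.2 p.base.2)) (p.vec i)⟩ :
          𝔉.bundle.Total) = ⟨𝔉.B.src g, 𝒮.incl i _ x⟩ := congrArg
        (fun a : (𝒮.O i).Total => (⟨a.proj.1, 𝒮.incl i a.proj a.2⟩ : 𝔉.bundle.Total)) hx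
      have hy' : (⟨q.base.1, 𝒮.incl i (𝔉.B.mkObj q.base.1 (hA i i.2 q.base.2)) (q.vec i)⟩ :
          𝔉.bundle.Total) = ⟨𝔉.B.tgt g, 𝒮.incl i _ ((𝒮.O i).act _ x)⟩ := congrArg
        (fun a : (𝒮.O i).Total => (⟨a.proj.1, 𝒮.incl i a.proj a.2⟩ : 𝔉.bundle.Total)) hy
      exact ⟨_, hx', hy'.trans (congrArg _ (𝒮.equivariant_incl i _ x))⟩
    exact (congrArg₂ (· • ·) h3 h4).trans (map_smul (𝔉.bundle.actTo g hs ht) _ _).symm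
  have h5 : q.hat = ⟨q.base.1, 𝔉.bundle.actTo g hs ht p.hat.2⟩ := by
    refine congrArg (TotalSpace.mk q.base.1) ?_
    refine Eq.trans ?_ ((map_add (𝔉.bundle.actTo g hs ht) _ _).trans
      (congrArg₂ (· + ·) rfl (map_sum _ _ _))).symm
    exact congrArg₂ (· + ·) h1 (Finset.sum_congr rfl fun i _ => h2 i)
  rw [h5]
  exact 𝔉.bundle.acts_actTo g hs ht _

theorem Pt.Acts.ambBundle {g : 𝔉.B.Arr} {p q : 𝒮.Pt I A hA} (h : Pt.Acts g p q) :
    (𝒮.ambBundle I A hA).Acts ⟨g, h.1 ▸ p.base.2, h.2.1 ▸ q.base.2⟩ p.pack q.pack := by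
  refine pullbackSum_acts _ _ _ (𝔉.isOrbifold.restrict A) (Subtype.ext h.1.symm)
    (Subtype.ext h.2.1.symm) fun i => ?_
  have h1 := h.2.2 i
  rw [← p.tot_pack, ← q.tot_pack] at h1
  exact h1

theorem acts_unpack {g : (𝔉.B.restrict A).Arr} {a b : 𝒮.Amb I A hA}
    (h : (𝒮.ambBundle I A hA).Acts g a b) : Pt.Acts g.1 (Amb.unpack a) (Amb.unpack b) :=
  ⟨congrArg Subtype.val h.proj_src.symm, congrArg Subtype.val h.proj_tgt.symm,
    fun i => OrbiBundle.Acts.sumTot _ _ _ h i⟩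

theorem bijective_actTo {E : Type*} [NormedAddCommGroup E] [NormedSpace ℝ E] {G : TopGroupoid.{v}}
    [ChartedSpace E G.Obj] {R : Type*} [NormedAddCommGroup R] [NormedSpace ℝ R]
    (V : OrbiBundle.{v, w} E G R) (g : G.Arr) {x y : G.Obj} (hs : G.src g = x)
    (ht : G.tgt g = y) : Function.Bijective (V.actTo g hs ht) := by
  have hs' : G.src (G.inv g) = y := (G.src_inv g).trans ht
  have ht' : G.tgt (G.inv g) = x := (G.tgt_inv g).trans hs
  have h1 : ∀ a, V.actTo (G.inv g) hs' ht' (V.actTo g hs ht a) = a := fun a =>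
    (OrbiBundle.Acts.eq_actTo hs' ht' (V.acts_inv (V.acts_actTo g hs ht a))).symm
  have h2 : ∀ a, V.actTo g hs ht (V.actTo (G.inv g) hs' ht' a) = a := fun a => by
    have := V.acts_inv (V.acts_actTo (G.inv g) hs' ht' a)
    rw [G.inv_inv] at this
    exact (OrbiBundle.Acts.eq_actTo hs ht this).symm
  exact ⟨Function.LeftInverse.injective h1, Function.RightInverse.surjective h2⟩

/-- Regularity is preserved by the arrows, and does not depend on the trivialization. -/
theorem Pt.Acts.isRegularOp {g : 𝔉.B.Arr} {p q : 𝒮.Pt I A hA} (h : Pt.Acts g p q)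
    (hp : p.IsZero) {u₀ u₁ : 𝔉.B.Obj}
    (h₀ : p.base.1 ∈ (trivializationAt F 𝔉.bundle.Fib u₀).baseSet)
    (h₁ : q.base.1 ∈ (trivializationAt F 𝔉.bundle.Fib u₁).baseSet) {n : ℕ}
    (hn : IsRegularOp n (dRep u₀ p.pack)) : IsRegularOp n (dRep u₁ q.pack) := by
  have hAo := 𝔉.isOrbifold.restrict A
  have := amb_isManifold (𝒮 := 𝒮) (hA := hA)
  let e₀ := trivializationAt F 𝔉.bundle.Fib u₀
  let e₁ := trivializationAt F 𝔉.bundle.Fib u₁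
  let IM := 𝒮.ambModel I
  obtain ⟨ψ, ψ', hψ, hψ', hψp, hψq, hψψ, hψψ', hact⟩ :=
    (𝒮.ambBundle I A hA).exists_local_diffeo hAo.src_localHomeo.isOpenMap h.ambBundle
  change 𝒮.Amb I A hA → 𝒮.Amb I A hA at ψ ψ'
  change ContMDiffAt IM IM ∞ ψ p.pack at hψ
  change ContMDiffAt IM IM ∞ ψ' q.pack at hψ'
  obtain ⟨Φ, hΦ, hΦ'⟩ := 𝔉.bundle.exists_smooth_act g
  have hev : ∀ᶠ h in 𝓝 (⟨g, h.1 ▸ p.base.2, h.2.1 ▸ q.base.2⟩ : (𝔉.B.restrict A).Arr),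
      ∀ a b, 𝔉.bundle.Acts h.1 a b → Φ a = b :=
    (continuous_subtype_val.continuousAt (x := (⟨g, h.1 ▸ p.base.2, h.2.1 ▸ q.base.2⟩ :
      (𝔉.B.restrict A).Arr))).eventually hΦ'
  have hm := hact _ hev
  have hproj : Continuous (fun a : 𝒮.Amb I A hA => a.proj.1) :=
    continuous_subtype_val.comp (FiberBundle.continuous_proj (Euc (∑ i : I, 𝒮.k i))
      (sumCore (fun i : I => 𝒮.O i) (𝒮.baseHom I A hA) (𝒮.contMDiff_baseHom I A hA)).Fiber)
  -- The action of the arrows near `g` on the fibres of the Fredholm bundle, read in the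
  -- trivializations at `u₀` and `u₁`.
  let α : 𝒮.Amb I A hA × F → F := fun z =>
    (e₁ (Φ (e₀.toOpenPartialHomeomorph.symm (z.1.proj.1, z.2)))).2
  have hbase₀ : ∀ᶠ m : 𝒮.Amb I A hA in 𝓝 p.pack, m.proj.1 ∈ e₀.baseSet :=
    hproj.continuousAt.eventually (e₀.open_baseSet.mem_nhds h₀)
  have hbase₁ : ∀ᶠ m : 𝒮.Amb I A hA in 𝓝 p.pack, (ψ m).proj.1 ∈ e₁.baseSet := by
    have h1 : ContinuousAt (fun m => (ψ m).proj.1) p.pack :=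
      hproj.continuousAt.comp hψ.continuousAt
    refine h1.eventually (e₁.open_baseSet.mem_nhds ?_)
    exact (congrArg (fun a : 𝒮.Amb I A hA => a.proj.1) hψp ▸ h₁ : (ψ p.pack).proj.1 ∈ e₁.baseSet)
  -- Equivariance of `Ŝ` in coordinates; `ψ` is the action of the same arrows on `O_I`.
  have hg : (𝒮.gRep I A hA u₁) ∘ ψ =ᶠ[𝓝 p.pack] fun m => α (m, 𝒮.gRep I A hA u₀ m) := by
    filter_upwards [hm, hbase₀] with m hm hb
    obtain ⟨k, hk, hk'⟩ := hm
    have h1 := (acts_unpack hk').hat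
    have h2 : e₀.toOpenPartialHomeomorph.symm (m.proj.1, 𝒮.gRep I A hA u₀ m) =
        (Amb.unpack m).hat := by
      have h3 : (Amb.unpack m).hat ∈ e₀.source := e₀.mem_source.2 hb
      have h4 : (m.proj.1, 𝒮.gRep I A hA u₀ m) = e₀ (Amb.unpack m).hat :=
        Prod.ext (e₀.coe_fst h3).symm rfl
      rw [h4]
      exact e₀.toOpenPartialHomeomorph.left_inv h3
    change (e₁ (Amb.unpack (ψ m)).hat).2 = (e₁ (Φ _)).2
    rw [h2, hk _ _ h1]
  have hsymm : ∀ {u : 𝔉.B.Obj}, u ∈ e₀.baseSet → ∀ v, e₀.toOpenPartialHomeomorph.symm (u, v) =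
      ⟨u, e₀.symm u v⟩ := fun hu v => (e₀.mk_symm hu v).symm
  have hα0 : ∀ᶠ m in 𝓝 p.pack, α (m, 0) = 0 := by
    filter_upwards [hm, hbase₀, hbase₁] with m hm hb hb'
    obtain ⟨k, hk, hk'⟩ := hm
    have h1 := acts_unpack hk'
    have h2 := 𝔉.bundle.acts_actTo k.1 h1.1 h1.2.1 0
    change (e₁ (Φ (e₀.toOpenPartialHomeomorph.symm (m.proj.1, 0)))).2 = 0
    have h3 : e₀.symm m.proj.1 (0 : F) = 0 := map_zero (e₀.linearEquivAt ℝ m.proj.1 hb).symm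
    rw [hsymm hb, h3]
    refine (congrArg (fun a => (e₁ a).2) (hk _ _ h2)).trans ?_
    rw [map_zero]
    exact map_zero (e₁.linearEquivAt ℝ (ψ m).proj.1 hb')
  let B : F →L[ℝ] F := ((e₁.continuousLinearEquivAt ℝ q.base.1 h₁).toContinuousLinearMap.comp
    (𝔉.bundle.actTo g h.1 h.2.1)).comp
      (e₀.continuousLinearEquivAt ℝ p.base.1 h₀).symm.toContinuousLinearMap
  have hB : Function.Bijective B :=
    ((e₁.continuousLinearEquivAt ℝ q.base.1 h₁).bijective.comp
      (bijective_actTo 𝔉.bundle g h.1 h.2.1)).comp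
        (e₀.continuousLinearEquivAt ℝ p.base.1 h₀).symm.bijective
  have hαB : ∀ v, α (p.pack, v) = B v := by
    intro v
    have h2 := 𝔉.bundle.acts_actTo g h.1 h.2.1 (e₀.symm p.base.1 v)
    have h3 := hΦ'.self_of_nhds _ _ h2
    change (e₁ (Φ (e₀.toOpenPartialHomeomorph.symm (p.base.1, v)))).2 = _
    rw [hsymm h₀, h3]
    rfl
  have hαs : ContMDiffAt (IM.prod 𝓘(ℝ, F)) 𝓘(ℝ, F) ∞ α (p.pack, 0) := by
    have h1 : ContMDiff IM 𝓘(ℝ, E) ∞ (fun a : 𝒮.Amb I A hA => a.proj.1) :=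
      (contMDiff_restrict_val A).comp (contMDiff_proj _)
    have h2 : ContMDiffAt (IM.prod 𝓘(ℝ, F)) (𝓘(ℝ, E).prod 𝓘(ℝ, F)) ∞
        (fun z : 𝒮.Amb I A hA × F => (z.1.proj.1, z.2)) (p.pack, 0) :=
      ((h1.comp contMDiff_fst).prodMk contMDiff_snd) _
    have h3 : ContMDiffAt (𝓘(ℝ, E).prod 𝓘(ℝ, F)) (𝓘(ℝ, E).prod 𝓘(ℝ, F)) ∞
        e₀.toOpenPartialHomeomorph.symm (p.base.1, 0) :=
      (e₀.contMDiffOn_symm _ (e₀.mem_target.2 h₀)).contMDiffAt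
        (e₀.open_target.mem_nhds (e₀.mem_target.2 h₀))
    have h4 := h3.comp (p.pack, (0 : F)) h2
    have h5 : ContMDiffAt (𝓘(ℝ, E).prod 𝓘(ℝ, F)) (𝓘(ℝ, E).prod 𝓘(ℝ, F)) ∞ Φ
        (e₀.toOpenPartialHomeomorph.symm (p.base.1, 0)) := by
      refine hΦ _ ?_
      rw [hsymm h₀]; exact h.1.symm
    have h6 := h5.comp (p.pack, (0 : F)) h4
    have h7 : Φ (e₀.toOpenPartialHomeomorph.symm (p.base.1, 0)) ∈ e₁.source := by
      have h2 := 𝔉.bundle.acts_actTo g h.1 h.2.1 (e₀.symm p.base.1 0)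
      have h3 := hΦ'.self_of_nhds _ _ h2
      rw [hsymm h₀, h3]
      exact e₁.mem_source.2 h₁
    exact ((e₁.contMDiffAt_iff (f := Φ ∘ e₀.toOpenPartialHomeomorph.symm ∘
      fun z : 𝒮.Amb I A hA × F => (z.1.proj.1, z.2)) (x₀ := (p.pack, (0 : F))) h7).1 h6).2
  have hpz : 𝒮.gRep I A hA u₀ p.pack = 0 := by
    have h1 : (Amb.unpack p.pack).hat = ⟨p.base.1, 0⟩ := by
      rw [p.unpack_pack]; exact congrArg (TotalSpace.mk p.base.1) hp
    change (e₀ (Amb.unpack p.pack).hat).2 = 0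
    rw [h1]
    exact map_zero (e₀.linearEquivAt ℝ p.base.1 h₀)
  have hgd : MDifferentiableAt IM 𝓘(ℝ, F) (𝒮.gRep I A hA u₀) p.pack :=
    (contMDiffAt_gRep h₀).mdifferentiableAt (by simp)
  have hψd : MDifferentiableAt IM IM ψ p.pack := hψ.mdifferentiableAt (by simp)
  let D : (E × Euc (∑ i : I, 𝒮.k i)) →L[ℝ] (E × Euc (∑ i : I, 𝒮.k i)) := mfderiv IM IM ψ p.pack
  let D' : (E × Euc (∑ i : I, 𝒮.k i)) →L[ℝ] (E × Euc (∑ i : I, 𝒮.k i)) := mfderiv IM IM ψ' q.pack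
  have hD'D : ∀ v, D' (D v) = v := mfderiv_leftInverse (hψ.mdifferentiableAt (by simp))
    (hψ'.mdifferentiableAt (by simp)) hψp hψψ
  have hDD' : ∀ v, D (D' v) = v := mfderiv_leftInverse (hψ'.mdifferentiableAt (by simp))
    (hψ.mdifferentiableAt (by simp)) hψq hψψ'
  -- Differentiating at the zero `p` intertwines the two derivatives by the isomorphisms `D` and
  -- `B`.
  have hL : ∀ v, dRep u₁ q.pack (D v) = B (dRep u₀ p.pack v) := by
    intro v
    have h1 := mfderiv_fiberwise (hαs.mdifferentiableAt (by simp)) hgd hpz hα0 B hαB v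
    refine Eq.trans ?_ h1
    rw [← hg.mfderiv_eq]
    exact (mfderiv_comp_apply_of_eq' ((contMDiffAt_gRep h₁).mdifferentiableAt
      (by simp)) hψd hψp v).symm
  refine hn.of_conj D'.toLinearMap ⟨Function.LeftInverse.injective hDD',
    Function.RightInverse.surjective hD'D⟩ B.toLinearMap hB fun v => ?_
  exact (congrArg (dRep u₁ q.pack) (hDD' v)).symm.trans (hL (D' v))

theorem Pt.Acts.isZero {g : 𝔉.B.Arr} {p q : 𝒮.Pt I A hA} (h : Pt.Acts g p q)
    (hp : p.IsZero) : q.IsZero := by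
  have h1 := h.hat
  have h2 : p.hat = ⟨p.base.1, 0⟩ := congrArg (TotalSpace.mk p.base.1) hp
  have h3 := 𝔉.bundle.acts_actTo g h.1 h.2.1 0
  rw [h2] at h1
  have h4 := h1.unique h3
  rw [map_zero] at h4
  exact eq_of_heq (TotalSpace.mk.inj h4).2

/-- A surjective Fredholm operator has index the dimension of its kernel. Completeness is what makes
a surjection with finite-dimensional kernel Fredholm again. -/
theorem isRegular_iff [CompleteSpace E] [CompleteSpace F] {n : ℕ}
    (hn : 𝔉.index + ∑ i ∈ I, (𝒮.k i : ℤ) = n) (p : 𝒮.Pt I A hA) :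
    p.IsRegular ↔ IsRegularOp n p.linearization := by
  constructor
  · rintro ⟨h1, h2, h3⟩
    exact ⟨h2, h1.finite_ker, by omega⟩
  · intro h
    exact ⟨h.isFredholm, h.surjective, by rw [h.finrank_ker, hn]⟩

theorem isRegularOp_linearization {n : ℕ} (p : 𝒮.Pt I A hA) :
    IsRegularOp n p.linearization ↔ IsRegularOp n (dRep p.base.1 p.pack) := by
  rw [p.linearization_eq]
  constructor
  · intro h
    exact h.of_conj (𝒮.ambEquiv I).symm.toLinearEquiv.toLinearMap (𝒮.ambEquiv I).symm.bijective
      LinearMap.id Function.bijective_id fun v =>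
        congrArg _ ((𝒮.ambEquiv I).apply_symm_apply v).symm
  · intro h
    exact h.of_conj (𝒮.ambEquiv I).toLinearEquiv.toLinearMap (𝒮.ambEquiv I).bijective
      LinearMap.id Function.bijective_id fun v => rfl

/-- The expected dimension. -/
def expDim (𝒮 : StabilizationData 𝔉 ι) (I : Finset ι) : ℕ :=
  (𝔉.index + ∑ i ∈ I, (𝒮.k i : ℤ)).toNat

/-- The expected index is the dimension of a kernel once there is a regular point, so it is
nonnegative and the truncation in `expDim` has no effect. Without regular points the truncated value
is merely a default dimension. -/
theorem Pt.IsRegular.expDim_eq {p : 𝒮.Pt I A hA} (hp : p.IsRegular) :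
    𝔉.index + ∑ i ∈ I, (𝒮.k i : ℤ) = 𝒮.expDim I := by
  have := hp.2.2
  rw [expDim, Int.toNat_of_nonneg]
  omega

/-- The identity arrow at `p`, with the trivialization at `p` on one side and the one at `u₀` on the
other. -/
theorem Pt.IsRegular.isRegularOp {p : 𝒮.Pt I A hA} (hp : p.IsRegular) {u₀ : 𝔉.B.Obj}
    (hz : p.IsZero) (h₀ : p.base.1 ∈ (trivializationAt F 𝔉.bundle.Fib u₀).baseSet) :
    IsRegularOp (𝒮.expDim I) (dRep u₀ p.pack) := by
  have h1 : IsRegularOp (𝒮.expDim I) p.linearization := by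
    have := hp.expDim_eq
    obtain ⟨h1, h2, h3⟩ := hp
    exact ⟨h2, h1.finite_ker, by omega⟩
  exact p.acts_one.isRegularOp hz (mem_baseSet_trivializationAt F 𝔉.bundle.Fib p.base.1) h₀
    ((isRegularOp_linearization p).1 h1)

theorem Pt.isRegular_of_isRegularOp [CompleteSpace E] [CompleteSpace F] {n : ℕ}
    (hn : 𝔉.index + ∑ i ∈ I, (𝒮.k i : ℤ) = n) {p : 𝒮.Pt I A hA} (hz : p.IsZero) {u₀ : 𝔉.B.Obj}
    (h₀ : p.base.1 ∈ (trivializationAt F 𝔉.bundle.Fib u₀).baseSet)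
    (h : IsRegularOp n (dRep u₀ p.pack)) : p.IsRegular :=
  (isRegular_iff hn p).2 ((isRegularOp_linearization p).2
    (p.acts_one.isRegularOp hz h₀ (mem_baseSet_trivializationAt F 𝔉.bundle.Fib p.base.1) h))

theorem Pt.Acts.isRegular [CompleteSpace E] [CompleteSpace F] {g : 𝔉.B.Arr} {p q : 𝒮.Pt I A hA}
    (h : Pt.Acts g p q) (hz : p.IsZero) (hp : p.IsRegular) : q.IsRegular := by
  have h0 := mem_baseSet_trivializationAt F 𝔉.bundle.Fib p.base.1
  have h1 := mem_baseSet_trivializationAt F 𝔉.bundle.Fib q.base.1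
  exact Pt.isRegular_of_isRegularOp hp.expDim_eq (h.isZero hz) h1
    (h.isRegularOp hz h0 h1 (hp.isRegularOp hz h0))

theorem invariant_regularZeros [CompleteSpace E] [CompleteSpace F] :
    (𝒮.sumGroupoid I A hA).Invariant {p | p.IsZero ∧ p.IsRegular} := by
  intro a
  exact ⟨fun h => ⟨a.2.isZero h.1, a.2.isRegular h.1 h.2⟩,
    fun h => ⟨(Pt.acts_inv a.2).isZero h.1, (Pt.acts_inv a.2).isRegular h.1 h.2⟩⟩

end Regular

end StabilizationData

end VirtualOrb
end

/-! ### The manifold and orbifold structure of `W_I` -/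

noncomputable section

namespace VirtualOrb
open TopGroupoid

namespace StabilizationData

variable {E : Type*} [NormedAddCommGroup E] [NormedSpace ℝ E]
  {F : Type*} [NormedAddCommGroup F] [NormedSpace ℝ F] {𝔉 : FredholmSystem.{v} E F}
  {ι : Type}

section Immersion

variable {𝒮 : StabilizationData 𝔉 ι} {I : Finset ι} {A : Opens 𝔉.B.Obj} {hA : ∀ i ∈ I, A ≤ 𝒮.U i}
  {E'' : Type*} [NormedAddCommGroup E''] [NormedSpace ℝ E''] {H'' : Type*}
  [TopologicalSpace H''] {I'' : ModelWithCorners ℝ E'' H''} {N : Type*} [TopologicalSpace N]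
  [ChartedSpace H'' N]

theorem clm_mfderiv {V R : Type*} [NormedAddCommGroup V] [NormedSpace ℝ V] [NormedAddCommGroup R]
    [NormedSpace ℝ R] {c : N → V} {x : N} (hc : MDifferentiableAt I'' 𝓘(ℝ, V) c x) (ξ : E'')
    (L : V →L[ℝ] R) : L ((mfderiv I'' 𝓘(ℝ, V) c x : E'' →L[ℝ] V) ξ) =
      (mfderiv I'' 𝓘(ℝ, R) (L ∘ c) x : E'' →L[ℝ] R) ξ := by
  rw [mfderiv_comp_apply_of_eq' ((L.contMDiff (n := ∞)).mdifferentiable (by simp) (c x)) hc rfl ξ,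
    mfderiv_eq_fderiv, L.fderiv]
  rfl

/-- A tangent vector of `O_I` vanishes if its components do. -/
theorem mfderiv_amb_eq_zero {f : N → 𝒮.Amb I A hA} {x : N} (ξ : E'')
    (hf : MDifferentiableAt I'' (𝒮.ambModel I) f x)
    (h : (mfderiv I'' 𝓘(ℝ, E) (fun y => (f y).proj.1) x : E'' →L[ℝ] E) ξ = 0)
    (h' : ∀ i : I, (mfderiv I'' (𝓘(ℝ, E).prod 𝓘(ℝ, Euc (𝒮.k i))) (fun y => Amb.tot (f y) i) x :
      E'' →L[ℝ] E × Euc (𝒮.k i)) ξ = 0) :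
    (mfderiv I'' (𝒮.ambModel I) f x : E'' →L[ℝ] E × Euc (∑ i : I, 𝒮.k i)) ξ = 0 := by
  have := amb_isManifold (𝒮 := 𝒮) (hA := hA)
  have : IsManifold (𝒮.ambModel I) 1 (𝒮.Amb I A hA) := IsManifold.of_le (n := ∞) (by simp)
  have := 𝔉.isOrbifold.isManifold
  let C := sumCore (fun i : I => 𝒮.O i) (𝒮.baseHom I A hA) (𝒮.contMDiff_baseHom I A hA)
  -- The chart at `f x` has invertible derivative, so the derivative of its composite with `f`
  -- decides. Its first component comes from the base point, the other ones are coordinates of the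
  -- components in the `O_i`.
  obtain ⟨e, he⟩ := isInvertible_mfderiv_extChartAt (I := 𝒮.ambModel I)
    (mem_extChartAt_source (I := 𝒮.ambModel I) (f x))
  have hc : MDifferentiableAt (𝒮.ambModel I) 𝓘(ℝ, E × Euc (∑ i : I, 𝒮.k i))
      (extChartAt (𝒮.ambModel I) (f x)) (f x) :=
    (contMDiffAt_extChartAt (n := ∞)).mdifferentiableAt (by simp)
  let c : N → E × Euc (∑ i : I, 𝒮.k i) := extChartAt (𝒮.ambModel I) (f x) ∘ f
  have hcd : MDifferentiableAt I'' 𝓘(ℝ, E × Euc (∑ i : I, 𝒮.k i)) c x := hc.comp x hf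
  let w : E × Euc (∑ i : I, 𝒮.k i) := (mfderiv I'' 𝓘(ℝ, E × Euc (∑ i : I, 𝒮.k i)) c x :
    E'' →L[ℝ] E × Euc (∑ i : I, 𝒮.k i)) ξ
  have hfx : c =ᶠ[𝓝 x] fun y => (extChartAt 𝓘(ℝ, E) (f x).proj.1 (f y).proj.1,
      (C.localTriv (f x).proj (f y)).2) := Eventually.of_forall fun y => by
    change extChartAt (𝒮.ambModel I) (f x) (f y) = _
    rw [FiberBundle.extChartAt]
    rfl
  have hproj : ContMDiff (𝒮.ambModel I) 𝓘(ℝ, E) ∞ (fun a : 𝒮.Amb I A hA => a.proj.1) :=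
    (contMDiff_restrict_val A).comp (contMDiff_proj _)
  have hw1 : w.1 = 0 := by
    refine (clm_mfderiv hcd ξ (ContinuousLinearMap.fst ℝ E (Euc (∑ i : I, 𝒮.k i)))).trans ?_
    have h1 : (ContinuousLinearMap.fst ℝ E (Euc (∑ i : I, 𝒮.k i))) ∘ c =ᶠ[𝓝 x]
        extChartAt 𝓘(ℝ, E) (f x).proj.1 ∘ fun y => (f y).proj.1 :=
      hfx.fun_comp Prod.fst
    have h2 : MDifferentiableAt I'' 𝓘(ℝ, E) (fun y => (f y).proj.1) x :=
      (hproj.mdifferentiable (by simp) (f x)).comp x hf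
    rw [h1.mfderiv_eq]
    refine (mfderiv_comp_apply_of_eq' ((contMDiffAt_extChartAt (n := ∞)).mdifferentiableAt
      (by simp)) h2 rfl ξ).trans ?_
    rw [h]
    exact map_zero (mfderiv 𝓘(ℝ, E) 𝓘(ℝ, E) (extChartAt 𝓘(ℝ, E) (f x).proj.1) (f x).proj.1 :
      E →L[ℝ] E)
  have hw2 : w.2 = 0 := by
    refine (eucSplit fun i : I => 𝒮.k i).injective ?_
    rw [map_zero]
    refine funext fun i => ?_
    let T := trivializationAt (Euc (𝒮.k i)) (𝒮.O i).Fib (Amb.tot (f x) i).proj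
    refine (clm_mfderiv hcd ξ ((ContinuousLinearMap.proj i).comp ((eucSplit fun i : I =>
      𝒮.k i).toContinuousLinearMap.comp
        (ContinuousLinearMap.snd ℝ E (Euc (∑ i : I, 𝒮.k i)))))).trans ?_
    have h1 : (fun y => eucSplit (fun i : I => 𝒮.k i) (c y).2 i) =ᶠ[𝓝 x]
        (fun a => (T a).2) ∘ fun y => Amb.tot (f y) i := by
      have h3 : C.baseSet (f x).proj ∈ 𝓝 (f x).proj :=
        (C.isOpen_baseSet _).mem_nhds (C.mem_baseSet_at _)
      have h4 : ContinuousAt (fun y => (f y).proj) x :=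
        ContinuousAt.comp (f := f) (FiberBundle.continuous_proj (Euc (∑ i : I, 𝒮.k i))
          C.Fiber).continuousAt hf.continuousAt
      filter_upwards [hfx, h4 h3] with y hy hy'
      rw [hy]
      exact eucSplit_localTriv (O := fun i : I => 𝒮.O i) (o := 𝒮.baseHom I A hA)
        (ho := 𝒮.contMDiff_baseHom I A hA) (f x).proj (f y) hy' i
    have h2 : MDifferentiableAt I'' (𝓘(ℝ, E).prod 𝓘(ℝ, Euc (𝒮.k i)))
        (fun y => Amb.tot (f y) i) x :=
      ((contMDiff_sumTot (O := fun i : I => 𝒮.O i) (o := 𝒮.baseHom I A hA)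
        (ho := 𝒮.contMDiff_baseHom I A hA) i).mdifferentiable (by simp) (f x)).comp x hf
    have h5 : ContMDiffAt (𝓘(ℝ, E).prod 𝓘(ℝ, Euc (𝒮.k i))) 𝓘(ℝ, Euc (𝒮.k i)) ∞
        (fun a => (T a).2) (Amb.tot (f x) i) :=
      (contMDiffAt_totalSpace.1 (contMDiffAt_id (x := Amb.tot (f x) i))).2
    change (mfderiv I'' 𝓘(ℝ, Euc (𝒮.k i)) (fun y => eucSplit (fun i : I => 𝒮.k i) (c y).2 i) x :
      E'' →L[ℝ] Euc (𝒮.k i)) ξ = 0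
    rw [h1.mfderiv_eq]
    refine (mfderiv_comp_apply_of_eq' (h5.mdifferentiableAt (by simp)) h2 rfl ξ).trans ?_
    rw [h' i]
    exact map_zero (mfderiv (𝓘(ℝ, E).prod 𝓘(ℝ, Euc (𝒮.k i))) 𝓘(ℝ, Euc (𝒮.k i))
      (fun a => (T a).2) (Amb.tot (f x) i) : E × Euc (𝒮.k i) →L[ℝ] Euc (𝒮.k i))
  have hw : w = 0 := Prod.ext hw1 hw2
  have h1 : w = (mfderiv (𝒮.ambModel I) 𝓘(ℝ, E × Euc (∑ i : I, 𝒮.k i))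
      (extChartAt (𝒮.ambModel I) (f x)) (f x) : (E × Euc (∑ i : I, 𝒮.k i)) →L[ℝ] _)
      ((mfderiv I'' (𝒮.ambModel I) f x : E'' →L[ℝ] E × Euc (∑ i : I, 𝒮.k i)) ξ) :=
    mfderiv_comp_apply_of_eq' hc hf rfl ξ
  rw [hw, ← he] at h1
  exact e.map_eq_zero_iff.1 h1.symm

end Immersion

theorem Amb.pack_unpack {𝒮 : StabilizationData 𝔉 ι} {I : Finset ι} {A : Opens 𝔉.B.Obj}
    {hA : ∀ i ∈ I, A ≤ 𝒮.U i} (a : 𝒮.Amb I A hA) : (Amb.unpack a).pack = a :=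
  sumTot_ext rfl fun i => Pt.tot_pack (Amb.unpack a) i

variable [Finite ι] (𝒮 : StabilizationData 𝔉 ι)

/-- The inclusion of `W_I` into the manifold `O_I`. -/
def wIncl (I : Finset ι) (x : (𝒮.W I).Obj) : 𝒮.Amb I (𝒮.piece I) (𝒮.piece_le I) :=
  (pt x).pack

theorem isEmbedding_wIncl (I : Finset ι) : Topology.IsEmbedding (𝒮.wIncl I) :=
  Pt.isEmbedding_pack.comp Topology.IsEmbedding.subtypeVal

theorem secondCountable_W [SecondCountableTopology 𝔉.B.Obj] (I : Finset ι) :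
    SecondCountableTopology (𝒮.W I).Obj := by
  have : SecondCountableTopology (𝔉.B.restrict (𝒮.piece I)).Obj :=
    inferInstanceAs (SecondCountableTopology (𝒮.piece I))
  have : SecondCountableTopology (𝒮.Amb I (𝒮.piece I) (𝒮.piece_le I)) :=
    totalSpace_secondCountable
  exact (𝒮.isEmbedding_wIncl I).isInducing.secondCountableTopology

variable [CompleteSpace E] [CompleteSpace F]

/-- At a regular zero `Ŝ`, read in a trivialization, is a submersion with complemented kernel, so
its zero set has a slice chart. The derivative is regular on the whole chart domain; hence every
zero in this domain is regular, and `W_I` coincides there with the zero set. -/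
theorem exists_sliceChart (I : Finset ι) (p : (𝒮.W I).Obj) :
    Nonempty (SliceChart (𝒮.ambModel I) F (𝒮.expDim I) (𝒮.wIncl I) p) := by
  have := amb_isManifold (𝒮 := 𝒮) (hA := 𝒮.piece_le I)
  obtain ⟨hz, hr⟩ : (pt p).IsZero ∧ (pt p).IsRegular := p.2
  have h0 := mem_baseSet_trivializationAt F 𝔉.bundle.Fib (pt p).base.1
  obtain ⟨Θ, h1, h2, h3, h4, h5, h6⟩ := exists_slice (isOpen_gRep_domain (pt p).base.1)
    (m₀ := 𝒮.wIncl I p) h0 (contMDiffOn_gRep (hA := 𝒮.piece_le I) (pt p).base.1)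
    (hr.isRegularOp hz h0)
  refine ⟨⟨Θ, h1, h3, h4, fun m hm => ?_⟩⟩
  have hm' : m.proj.1 ∈ (trivializationAt F 𝔉.bundle.Fib (pt p).base.1).baseSet := h2 hm
  have hm0 : (Amb.unpack m).IsZero ↔ (Θ m).1 = 0 := by
    rw [h5 m hm, Pt.isZero_iff]
    exact (((trivializationAt F 𝔉.bundle.Fib (pt p).base.1).linearEquivAt ℝ m.proj.1
      hm').map_eq_zero_iff).symm
  rw [← hm0]
  constructor
  · rintro ⟨q, rfl⟩
    have : Amb.unpack (𝒮.wIncl I q) = pt q := (pt q).unpack_pack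
    rw [this]
    exact q.2.1
  · intro hq
    have h7 : (Amb.unpack m).pack = m := Amb.pack_unpack m
    refine ⟨⟨Amb.unpack m, hq, ?_⟩, h7⟩
    -- `h6` gives regularity in the trivialization at `p`; being regular does not depend on the
    -- trivialization at a zero.
    refine Pt.isRegular_of_isRegularOp hr.expDim_eq hq (u₀ := (pt p).base.1) hm' ?_
    rw [h7]
    exact h6 m hm

instance wCharted (I : Finset ι) : ChartedSpace (Euc (𝒮.expDim I)) (𝒮.W I).Obj :=
  sliceChartedSpace (𝒮.isEmbedding_wIncl I) fun p => (𝒮.exists_sliceChart I p).some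

theorem w_isManifold (I : Finset ι) : IsManifold 𝓘(ℝ, Euc (𝒮.expDim I)) ∞ (𝒮.W I).Obj :=
  slice_isManifold (𝒮.isEmbedding_wIncl I) fun p => (𝒮.exists_sliceChart I p).some

theorem contMDiff_wIncl (I : Finset ι) :
    ContMDiff 𝓘(ℝ, Euc (𝒮.expDim I)) (𝒮.ambModel I) ∞ (𝒮.wIncl I) :=
  slice_contMDiff_incl (𝒮.isEmbedding_wIncl I) fun p => (𝒮.exists_sliceChart I p).some

theorem contMDiff_anchor (I : Finset ι) :
    ContMDiff 𝓘(ℝ, Euc (𝒮.expDim I)) 𝓘(ℝ, E) ∞ (𝒮.anchor I).obj :=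
  ((contMDiff_restrict_val (𝒮.piece I)).comp (contMDiff_proj _)).comp (𝒮.contMDiff_wIncl I)

theorem contMDiff_tot (I : Finset ι) (i : I) : ContMDiff 𝓘(ℝ, Euc (𝒮.expDim I))
    (𝓘(ℝ, E).prod 𝓘(ℝ, Euc (𝒮.k i))) ∞ (fun x : (𝒮.W I).Obj => (pt x).tot i) := by
  have h := (contMDiff_sumTot (O := fun i : I => 𝒮.O i) (o := 𝒮.baseHom I _ (𝒮.piece_le I))
    (ho := 𝒮.contMDiff_baseHom I _ (𝒮.piece_le I)) i).comp (𝒮.contMDiff_wIncl I)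
  exact h.congr fun x => ((pt x).tot_pack i).symm

variable {𝒮}

/-- A map to `W_I` is smooth if its components are. -/
theorem contMDiffAt_W {I : Finset ι} {E'' : Type*} [NormedAddCommGroup E''] [NormedSpace ℝ E'']
    {H'' : Type*} [TopologicalSpace H''] {I'' : ModelWithCorners ℝ E'' H''} {N : Type*}
    [TopologicalSpace N] [ChartedSpace H'' N] {f : N → (𝒮.W I).Obj} {x : N}
    (h : ContMDiffAt I'' 𝓘(ℝ, E) ∞ (fun y => (𝒮.anchor I).obj (f y)) x)
    (h' : ∀ i : I, ContMDiffAt I'' (𝓘(ℝ, E).prod 𝓘(ℝ, Euc (𝒮.k i))) ∞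
      (fun y => (pt (f y)).tot i) x) :
    ContMDiffAt I'' 𝓘(ℝ, Euc (𝒮.expDim I)) ∞ f x := by
  refine slice_contMDiffAt (𝒮.isEmbedding_wIncl I) (fun p => (𝒮.exists_sliceChart I p).some) ?_
  refine contMDiffAt_sum (contMDiffAt_codRestrict h) fun i => ?_
  exact (h' i).congr_of_eventuallyEq (Eventually.of_forall fun y => (pt (f y)).tot_pack i)

/-- The inclusion of `W_I` into `O_I` is an immersion. -/
theorem immersion_W {I : Finset ι} (x : (𝒮.W I).Obj) (ξ : Euc (𝒮.expDim I))
    (h : (mfderiv 𝓘(ℝ, Euc (𝒮.expDim I)) 𝓘(ℝ, E) (𝒮.anchor I).obj x :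
      Euc (𝒮.expDim I) →L[ℝ] E) ξ = 0)
    (h' : ∀ i : I, (mfderiv 𝓘(ℝ, Euc (𝒮.expDim I)) (𝓘(ℝ, E).prod 𝓘(ℝ, Euc (𝒮.k i)))
      (fun x : (𝒮.W I).Obj => (pt x).tot i) x : Euc (𝒮.expDim I) →L[ℝ] E × Euc (𝒮.k i)) ξ = 0) :
    ξ = 0 := by
  have hd := (𝒮.contMDiff_wIncl I).mdifferentiable (by simp) x
  have h0 := mfderiv_amb_eq_zero ξ hd h fun i : I => by
    have : (fun y => Amb.tot (𝒮.wIncl I y) i) = fun x : (𝒮.W I).Obj => (pt x).tot i :=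
      funext fun y => (pt y).tot_pack i
    rw [this]; exact h' i
  refine slice_immersion (𝒮.isEmbedding_wIncl I) (fun p => (𝒮.exists_sliceChart I p).some) x ξ
    fun g hg => ?_
  refine (mfderiv_comp_apply_of_eq' (hg.mdifferentiableAt (by simp)) hd rfl ξ).trans ?_
  rw [h0]
  exact map_zero (mfderiv (𝒮.ambModel I) 𝓘(ℝ, Euc (𝒮.expDim I)) g (𝒮.wIncl I x) :
    (E × Euc (∑ i : I, 𝒮.k i)) →L[ℝ] Euc (𝒮.expDim I))

/-- Étaleness and properness restrict from `O_I` to the invariant set of regular zeros. The maps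
`tgt ∘ src⁻¹` are smooth because their base points and components are, by the smooth actions on the
base and on the `O_i`. -/
theorem isOrbifold_W (I : Finset ι) : IsOrbifold (Euc (𝒮.expDim I)) (𝒮.W I) where
  isManifold := 𝒮.w_isManifold I
  t2_obj := by
    have := Pt.t2Space (𝒮 := 𝒮) (hA := 𝒮.piece_le I)
    exact inferInstanceAs (T2Space {p : 𝒮.Pt I (𝒮.piece I) (𝒮.piece_le I) // p.IsZero ∧ p.IsRegular})
  t2_arr := by
    have := Pt.t2Space (𝒮 := 𝒮) (hA := 𝒮.piece_le I)
    have := 𝔉.isOrbifold.t2_arr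
    have : T2Space (𝒮.sumGroupoid I (𝒮.piece I) (𝒮.piece_le I)).Arr := inferInstanceAs
      (T2Space {a : 𝔉.B.Arr × 𝒮.Pt I (𝒮.piece I) (𝒮.piece_le I) × 𝒮.Pt I _ (𝒮.piece_le I) //
        Pt.Acts a.1 a.2.1 a.2.2})
    exact (Topology.IsEmbedding.subtypeVal : Topology.IsEmbedding
      (Subtype.val : (𝒮.W I).Arr → (𝒮.sumGroupoid I (𝒮.piece I) (𝒮.piece_le I)).Arr)).t2Space
  src_localHomeo :=
    full_src_isLocalHomeomorph invariant_regularZeros sumGroupoid_src_isLocalHomeomorph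
  smooth a := by
    obtain ⟨e, ha, he⟩ := full_src_isLocalHomeomorph
      (invariant_regularZeros (𝒮 := 𝒮) (hA := 𝒮.piece_le I)) sumGroupoid_src_isLocalHomeomorph a
    change OpenPartialHomeomorph (𝒮.W I).Arr (𝒮.W I).Obj at e
    change (𝒮.W I).src = e at he
    have hes : ∀ h ∈ e.source, e.symm ((𝒮.W I).src h) = h := fun h hh => by rw [he, e.left_inv hh]
    have hsa : (𝒮.W I).src a ∈ e.target := by rw [he]; exact e.map_source ha
    have hsym : Tendsto e.symm (𝓝 ((𝒮.W I).src a)) (𝓝 a) := by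
      have := e.continuousAt_symm hsa
      rwa [ContinuousAt, hes a ha] at this
    have hsrc : ∀ᶠ x in 𝓝 ((𝒮.W I).src a), (𝒮.W I).src (e.symm x) = x := by
      filter_upwards [e.open_target.mem_nhds hsa] with x hx
      rw [he, e.right_inv hx]
    refine ⟨fun x => (𝒮.W I).tgt (e.symm x), ?_, ?_⟩
    · refine contMDiffAt_W ?_ fun i => ?_
      · obtain ⟨f, hf, hf'⟩ := 𝔉.isOrbifold.smooth a.1.1.1
        have h1 : (𝒮.anchor I).obj ((𝒮.W I).src a) = 𝔉.B.src a.1.1.1 := a.1.2.1.symm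
        rw [← h1] at hf
        refine (hf.comp _ (𝒮.contMDiff_anchor I _)).congr_of_eventuallyEq ?_
        have h2 : Continuous fun h : (𝒮.W I).Arr => h.1.1.1 := (𝒮.anchor I).continuous_arr
        filter_upwards [hsrc, (h2.continuousAt.tendsto.comp hsym).eventually hf'] with x hx hx'
        have h3 : (𝒮.anchor I).obj ((𝒮.W I).tgt (e.symm x)) = 𝔉.B.tgt (e.symm x).1.1.1 :=
          ((𝒮.anchor I).tgt_arr _).symm
        have h4 : (𝒮.anchor I).obj ((𝒮.W I).src (e.symm x)) = 𝔉.B.src (e.symm x).1.1.1 :=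
          ((𝒮.anchor I).src_arr _).symm
        rw [h3]
        exact hx'.symm.trans (congrArg f (h4.symm.trans (congrArg (𝒮.anchor I).obj hx)))
      · have hmem : ∀ h : (𝒮.W I).Arr, 𝔉.B.src h.1.1.1 ∈ 𝒮.U i ∧ 𝔉.B.tgt h.1.1.1 ∈ 𝒮.U i :=
          fun h => ⟨h.1.2.1 ▸ 𝒮.piece_le I i i.2 h.1.1.2.1.base.2,
            h.1.2.2.1 ▸ 𝒮.piece_le I i i.2 h.1.1.2.2.base.2⟩
        obtain ⟨Φ, hΦ, hΦ'⟩ := (𝒮.O i).exists_smooth_act ⟨a.1.1.1, hmem a⟩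
        have h1 := hΦ ((pt ((𝒮.W I).src a)).tot i) (a.1.2.2.2 i).proj_src
        refine (ContMDiffAt.comp (x := (𝒮.W I).src a) (g := Φ) h1
          (𝒮.contMDiff_tot I i _)).congr_of_eventuallyEq ?_
        have h2 : Continuous fun h : (𝒮.W I).Arr => (⟨h.1.1.1, hmem h⟩ :
            (𝔉.B.restrict (𝒮.U i)).Arr) :=
          Continuous.subtype_mk (𝒮.anchor I).continuous_arr _
        filter_upwards [hsrc, (h2.continuousAt.tendsto.comp hsym).eventually hΦ'] with x hx hx'
        have h3 := hx' _ _ ((e.symm x).1.2.2.2 i)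
        refine h3.symm.trans ?_
        change Φ ((pt ((𝒮.W I).src (e.symm x))).tot i) = _
        rw [hx]
        rfl
    · filter_upwards [e.open_source.mem_nhds ha] with h hh
      rw [hes h hh]
  proper := full_proper sumGroupoid_proper

end StabilizationData

end VirtualOrb
end

/-! ### Comparison of the linearizations for `I ⊆ J` -/

noncomputable section

namespace VirtualOrb
open TopGroupoid

namespace StabilizationData

variable {E : Type*} [NormedAddCommGroup E] [NormedSpace ℝ E]
  {F : Type*} [NormedAddCommGroup F] [NormedSpace ℝ F] {𝔉 : FredholmSystem.{v} E F}
  {ι : Type} {𝒮 : StabilizationData 𝔉 ι}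

section Coordinates

variable (k : ι → ℕ) {I J : Finset ι}

/-- Forgetting the components outside of `I`. -/
def coordProj (E : Type*) [NormedAddCommGroup E] [NormedSpace ℝ E] (h : I ⊆ J) :
    (E × ∀ j : J, Euc (k j)) →L[ℝ] E × ∀ i : I, Euc (k i) :=
  (ContinuousLinearMap.fst ℝ E _).prod (ContinuousLinearMap.pi fun i =>
    (ContinuousLinearMap.proj (⟨i, h i.2⟩ : J)).comp (ContinuousLinearMap.snd ℝ E _))

variable [DecidableEq ι]

/-- Extending by zero outside of `I`. -/
def coordExt (E : Type*) [NormedAddCommGroup E] [NormedSpace ℝ E] (I J : Finset ι) :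
    (E × ∀ i : I, Euc (k i)) →L[ℝ] E × ∀ j : J, Euc (k j) :=
  (ContinuousLinearMap.fst ℝ E _).prod (ContinuousLinearMap.pi fun j =>
    if h : j.1 ∈ I then
      (ContinuousLinearMap.proj (φ := fun i : I => Euc (k i)) (⟨j, h⟩ : I)).comp
        (ContinuousLinearMap.snd ℝ E _)
    else 0)

/-- The components outside of `I`. -/
def coordCompl (E : Type*) [NormedAddCommGroup E] [NormedSpace ℝ E] (I J : Finset ι) :
    (E × ∀ j : J, Euc (k j)) →ₗ[ℝ] ∀ j : ↥(J \ I), Euc (k j) :=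
  LinearMap.pi fun j => (LinearMap.proj (⟨j, (Finset.mem_sdiff.1 j.2).1⟩ : J)).comp
    (LinearMap.snd ℝ E _)

variable {k}

theorem coordExt_of_mem (z : E × ∀ i : I, Euc (k i)) (j : J) (h : j.1 ∈ I) :
    (coordExt k E I J z).2 j = z.2 ⟨j, h⟩ := by
  simp [coordExt, h]

theorem coordExt_of_notMem (z : E × ∀ i : I, Euc (k i)) (j : J) (h : j.1 ∉ I) :
    (coordExt k E I J z).2 j = 0 := by
  simp [coordExt, h]

theorem coordProj_coordExt (h : I ⊆ J) (z : E × ∀ i : I, Euc (k i)) :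
    coordProj k E h (coordExt k E I J z) = z :=
  Prod.ext rfl (funext fun i => coordExt_of_mem z ⟨i, h i.2⟩ i.2)

theorem coordExt_injective (h : I ⊆ J) : Function.Injective (coordExt k E I J) :=
  Function.LeftInverse.injective (coordProj_coordExt h)

theorem coordCompl_surjective : Function.Surjective (coordCompl k E I J) := by
  intro w
  refine ⟨(0, fun j => if h : j.1 ∈ J \ I then w ⟨j, h⟩ else 0), funext fun j => ?_⟩
  exact dif_pos j.2

theorem exact_coord (h : I ⊆ J) :
    Function.Exact (coordExt k E I J) (coordCompl k E I J) := by
  intro z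
  constructor
  · intro hz
    refine ⟨coordProj k E h z, Prod.ext rfl (funext fun j => ?_)⟩
    by_cases hj : j.1 ∈ I
    · rw [coordExt_of_mem _ _ hj]; rfl
    · rw [coordExt_of_notMem _ _ hj]
      exact (congrFun hz ⟨j, Finset.mem_sdiff.2 ⟨j.2, hj⟩⟩).symm
  · rintro ⟨y, rfl⟩
    exact funext fun j => coordExt_of_notMem y _ (Finset.mem_sdiff.1 j.2).2

theorem finrank_coordCompl :
    Module.finrank ℝ (∀ j : ↥(J \ I), Euc (k j)) = ∑ j ∈ J \ I, k j := by
  rw [Module.finrank_pi_fintype]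
  simp only [finrank_euclideanSpace, Fintype.card_fin]
  exact Finset.sum_coe_sort (J \ I) k

end Coordinates

/-- The map `Ŝ` near `u₀`, in terms of the base point `u`. -/
def repAt (𝒮 : StabilizationData 𝔉 ι) (I : Finset ι) (u₀ u : 𝔉.B.Obj) (h₀ : ∀ i ∈ I, u₀ ∈ 𝒮.U i)
    (h : ∀ i ∈ I, u ∈ 𝒮.U i) (y : ∀ i : I, Euc (𝒮.k i)) : F :=
  (trivializationAt F 𝔉.bundle.Fib u₀
    ⟨u, 𝔉.S u + ∑ i : I, 𝒮.s i (𝔉.B.mkObj u (h i i.2))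
      ((trivializationAt (Euc (𝒮.k i)) (𝒮.O i).Fib (𝔉.B.mkObj u₀ (h₀ i i.2))).symm
        (𝔉.B.mkObj u (h i i.2)) (y i))⟩).2

theorem sum_finset_subset {M : Type*} [AddCommMonoid M] {I J : Finset ι} (h : I ⊆ J) (f : J → M)
    (g : I → M) (h1 : ∀ i : I, g i = f ⟨i, h i.2⟩) (h2 : ∀ j : J, j.1 ∉ I → f j = 0) :
    ∑ i, g i = ∑ j, f j := by
  refine Finset.sum_of_injOn (fun i : I => (⟨i, h i.2⟩ : J))
    (fun a _ b _ hab => Subtype.ext (congrArg (fun x : J => x.1) hab)) (fun _ _ => Finset.mem_coe.2 (Finset.mem_univ _))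
    (fun j _ hj => h2 j fun hj' => hj ⟨⟨j, hj'⟩, Finset.mem_coe.2 (Finset.mem_univ _), rfl⟩) fun i _ => h1 i

/-- A summand with `j ∉ I` drops out for one of two reasons: its cut-off vanishes at the base point,
or its vector is zero. The second one asks for the base point to lie in the domain of the
trivialization, as linearity of its inverse is only available there. -/
theorem repAt_eq {I J : Finset ι} (h : I ⊆ J) {u₀ u u' : 𝔉.B.Obj} (hu : u = u')
    {h₀ : ∀ i ∈ I, u₀ ∈ 𝒮.U i} {h₀' : ∀ i ∈ J, u₀ ∈ 𝒮.U i} {hI : ∀ i ∈ I, u' ∈ 𝒮.U i}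
    {hJ : ∀ i ∈ J, u ∈ 𝒮.U i} {y : ∀ i : I, Euc (𝒮.k i)} {y' : ∀ j : J, Euc (𝒮.k j)}
    (h1 : ∀ i : I, y i = y' ⟨i, h i.2⟩)
    (h2 : ∀ j : J, j.1 ∉ I → 𝒮.η j u = 0 ∨ y' j = 0 ∧ 𝔉.B.mkObj u (hJ j j.2) ∈
      (trivializationAt (Euc (𝒮.k j)) (𝒮.O j).Fib (𝔉.B.mkObj u₀ (h₀' j j.2))).baseSet) :
    repAt 𝒮 J u₀ u h₀' hJ y' = repAt 𝒮 I u₀ u' h₀ hI y := by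
  subst hu
  unfold repAt
  refine congrArg (fun w => (trivializationAt F 𝔉.bundle.Fib u₀ ⟨u, w⟩).2) ?_
  refine congrArg (𝔉.S u + ·) ?_
  refine (sum_finset_subset h _ _ (fun i => ?_) fun j hj => ?_).symm
  · rw [h1]
  · rcases h2 j hj with h3 | h3
    · have : 𝒮.s j (𝔉.B.mkObj u (hJ j j.2)) = 0 := by
        change 𝒮.η j u • _ = _
        rw [h3, zero_smul]
      rw [this]
      rfl
    · obtain ⟨h3, hb⟩ := h3
      rw [h3]
      have h4 : (trivializationAt (Euc (𝒮.k j)) (𝒮.O j).Fib (𝔉.B.mkObj u₀ (h₀' j j.2))).symm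
          (𝔉.B.mkObj u (hJ j j.2)) 0 = 0 :=
        map_zero ((trivializationAt (Euc (𝒮.k j)) (𝒮.O j).Fib
          (𝔉.B.mkObj u₀ (h₀' j j.2))).linearEquivAt ℝ _ hb).symm
      exact (congrArg (𝒮.s j _) h4).trans (map_zero _)

/-- The charts of an open set are restrictions of those of `B`; through the latter, points of `O_J`
and `O_I` over different open sets `A` and `A'` are compared. -/
theorem eventually_val_extChartAt_symm {A : Opens 𝔉.B.Obj} (u₀ : A) :
    ∀ᶠ x in 𝓝 (extChartAt 𝓘(ℝ, E) u₀.1 u₀.1),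
      ((extChartAt 𝓘(ℝ, E) u₀).symm x).1 = (extChartAt 𝓘(ℝ, E) u₀.1).symm x :=
  A.chartAt_subtype_val_symm_eventuallyEq.mono fun _ hx => hx.symm

section Compare

variable {I J : Finset ι} {A A' : Opens 𝔉.B.Obj} {hA : ∀ i ∈ J, A ≤ 𝒮.U i}
  {hA' : ∀ i ∈ I, A' ≤ 𝒮.U i}

/-- The point `p` of `O_J` and the point `q` of `O_I` have the same components for `i ∈ I`. -/
structure Pt.Agree (h : I ⊆ J) (p : 𝒮.Pt J A hA) (q : 𝒮.Pt I A' hA') : Prop where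
  base : p.base.1 = q.base.1
  tot : ∀ i : I, p.tot ⟨i, h i.2⟩ = q.tot i

theorem Pt.Agree.hat_eq {h : I ⊆ J} {p : 𝒮.Pt J A hA} {q : 𝒮.Pt I A' hA'} (H : p.Agree h q)
    (h0 : ∀ j : J, j.1 ∉ I → 𝒮.η j p.base.1 = 0 ∨ p.vec j = 0) : p.hat = q.hat := by
  obtain ⟨⟨u, hu⟩, a⟩ := p
  obtain ⟨⟨u', hu'⟩, b⟩ := q
  obtain ⟨rfl, H⟩ := H
  refine congrArg (TotalSpace.mk u) (congrArg (𝔉.S u + ·) (Eq.symm ?_))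
  refine sum_finset_subset h _ _ (fun i => ?_) fun j hj => ?_
  · exact congrArg (𝒮.s i _) (eq_of_heq (TotalSpace.mk.inj (H i)).2).symm
  · rcases h0 j hj with h3 | h3
    · exact (congrArg (· • _) h3).trans (zero_smul ℝ _)
    · exact (congrArg (𝒮.s j _) h3).trans (map_zero _)

theorem isZero_congr {p : 𝒮.Pt J A hA} {q : 𝒮.Pt I A' hA'} (h : p.hat = q.hat) :
    p.IsZero ↔ q.IsZero :=
  Iff.of_eq (congrArg (fun a : 𝔉.bundle.Total => a.2 = 0) h)

theorem Pt.Agree.coordProj {h : I ⊆ J} {p : 𝒮.Pt J A hA} {q : 𝒮.Pt I A' hA'} (H : p.Agree h q) :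
    coordProj 𝒮.k E h p.coord = q.coord := by
  obtain ⟨⟨u, hu⟩, a⟩ := p
  obtain ⟨⟨u', hu'⟩, b⟩ := q
  obtain ⟨rfl, H⟩ := H
  refine Prod.ext rfl (funext fun i => ?_)
  exact congrArg (fun a => (trivializationAt (Euc (𝒮.k i)) (𝒮.O i).Fib _ a).2) (H i)

theorem Pt.IsRegular.isRegularOp_linearization [CompleteSpace E] [CompleteSpace F]
    {p : 𝒮.Pt J A hA} (hp : p.IsRegular) :
    IsRegularOp (𝒮.expDim J) p.linearization :=
  (isRegular_iff hp.expDim_eq p).1 hp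

variable [DecidableEq ι]

theorem Pt.Agree.coordExt {h : I ⊆ J} {p : 𝒮.Pt J A hA} {q : 𝒮.Pt I A' hA'} (H : p.Agree h q)
    (h0 : ∀ j : J, j.1 ∉ I → p.vec j = 0) : coordExt 𝒮.k E I J q.coord = p.coord := by
  rw [← H.coordProj]
  refine Prod.ext rfl (funext fun j => ?_)
  by_cases hj : j.1 ∈ I
  · rw [coordExt_of_mem _ _ hj]; rfl
  · rw [coordExt_of_notMem _ _ hj]
    have h1 : p.tot j = ⟨_, 0⟩ := congrArg (TotalSpace.mk _) (h0 j hj)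
    refine Eq.symm ((congrArg (fun a => (trivializationAt (Euc (𝒮.k j)) (𝒮.O j).Fib
      (𝔉.B.mkObj p.base.1 (hA j j.2 p.base.2)) a).2) h1).trans ?_)
    exact map_zero ((trivializationAt (Euc (𝒮.k j)) (𝒮.O j).Fib
      (𝔉.B.mkObj p.base.1 (hA j j.2 p.base.2))).linearEquivAt ℝ _
        (mem_baseSet_trivializationAt _ _ _))

/-- Near `p` the cut-offs outside `I` vanish, so `Ŝ_J` is `Ŝ_I` after forgetting the additional
components; then the chain rule applies. -/
theorem Pt.Agree.linearization_coordProj {h : I ⊆ J} {p : 𝒮.Pt J A hA} {q : 𝒮.Pt I A' hA'}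
    (H : p.Agree h q) (hη : ∀ j ∈ J, j ∉ I → ∀ᶠ x in 𝓝 p.base.1, 𝒮.η j x = 0) :
    p.linearization = q.linearization.comp (StabilizationData.coordProj 𝒮.k E h) := by
  have h1 : localRep hA p.base =ᶠ[𝓝 p.coord]
      localRep hA' q.base ∘ StabilizationData.coordProj 𝒮.k E h := by
    obtain ⟨⟨u, hu⟩, a⟩ := p
    obtain ⟨⟨u', hu'⟩, b⟩ := q
    obtain ⟨rfl, H⟩ := H
    change u ∈ A at hu
    change u ∈ A' at hu'
    have h2 : Tendsto (fun z : E × ∀ j : J, Euc (𝒮.k j) => z.1)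
        (𝓝 (Pt.coord (hA := hA) ⟨⟨u, hu⟩, a⟩)) (𝓝 (extChartAt 𝓘(ℝ, E) u u)) :=
      continuous_fst.tendsto _
    have h3 : ∀ᶠ x in 𝓝 (extChartAt 𝓘(ℝ, E) u u), ∀ j : J, j.1 ∉ I →
        𝒮.η j ((extChartAt 𝓘(ℝ, E) u).symm x) = 0 := by
      refine eventually_all.2 fun j => ?_
      by_cases hj : j.1 ∈ I
      · exact Eventually.of_forall fun x hx => absurd hj hx
      · have h4 := continuousAt_extChartAt_symm (I := 𝓘(ℝ, E)) u
        rw [ContinuousAt, extChartAt_to_inv] at h4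
        filter_upwards [h4.eventually (hη j j.2 hj)] with x hx _ using hx
    filter_upwards [h2.eventually (eventually_val_extChartAt_symm (⟨u, hu⟩ : A)),
      h2.eventually (eventually_val_extChartAt_symm (⟨u, hu'⟩ : A')), h2.eventually h3]
      with z hz hz' hz''
    refine repAt_eq h (hz.trans hz'.symm) (h₀ := fun i hi => hA' i hi hu') (h₀' := fun i hi => hA i hi hu)
      (hI := fun i hi => hA' i hi ((extChartAt 𝓘(ℝ, E) (⟨u, hu'⟩ : A')).symm z.1).2)
      (hJ := fun i hi => hA i hi ((extChartAt 𝓘(ℝ, E) (⟨u, hu⟩ : A)).symm z.1).2) (fun i => rfl) fun j hj => Or.inl ?_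
    exact (congrArg (𝒮.η j) hz).trans (hz'' j hj)
  have h2 : DifferentiableAt ℝ (localRep hA' q.base) (StabilizationData.coordProj 𝒮.k E h p.coord) := by
    rw [H.coordProj]; exact q.differentiableAt_localRep
  change fderiv ℝ (localRep hA p.base) p.coord = _
  rw [h1.fderiv_eq, fderiv_comp _ h2 (ContinuousLinearMap.differentiableAt _),
    ContinuousLinearMap.fderiv, H.coordProj]
  rfl

/-- Along zero additional components `Ŝ_J` restricts to `Ŝ_I`, whatever the cut-offs are, so the
derivative of `Ŝ_I` is a restriction of that of `Ŝ_J`. -/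
theorem Pt.Agree.linearization_coordExt {h : I ⊆ J} {p : 𝒮.Pt J A hA} {q : 𝒮.Pt I A' hA'}
    (H : p.Agree h q) (h0 : ∀ j : J, j.1 ∉ I → p.vec j = 0) :
    p.linearization.comp (StabilizationData.coordExt 𝒮.k E I J) = q.linearization := by
  have h1 : localRep hA' q.base =ᶠ[𝓝 q.coord]
      localRep hA p.base ∘ StabilizationData.coordExt 𝒮.k E I J := by
    clear h0
    obtain ⟨⟨u, hu⟩, a⟩ := p
    obtain ⟨⟨u', hu'⟩, b⟩ := q
    obtain ⟨rfl, H⟩ := H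
    change u ∈ A at hu
    change u ∈ A' at hu'
    have h2 : Tendsto (fun z : E × ∀ i : I, Euc (𝒮.k i) => z.1)
        (𝓝 (Pt.coord (hA := hA') ⟨⟨u, hu'⟩, b⟩)) (𝓝 (extChartAt 𝓘(ℝ, E) u u)) :=
      continuous_fst.tendsto _
    have h3 : ∀ᶠ x in 𝓝 (extChartAt 𝓘(ℝ, E) u u), ∀ j : J, 𝔉.B.mkObj
        ((extChartAt 𝓘(ℝ, E) (⟨u, hu⟩ : A)).symm x).1
        (hA j j.2 ((extChartAt 𝓘(ℝ, E) (⟨u, hu⟩ : A)).symm x).2) ∈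
          (trivializationAt (Euc (𝒮.k j)) (𝒮.O j).Fib (𝔉.B.mkObj u (hA j j.2 hu))).baseSet := by
      refine eventually_all.2 fun j => ?_
      have h5 : Continuous fun a : A => 𝔉.B.mkObj a.1 (hA j j.2 a.2) :=
        continuous_subtype_val.subtype_mk _
      have h4 : Tendsto (fun x => 𝔉.B.mkObj ((extChartAt 𝓘(ℝ, E) (⟨u, hu⟩ : A)).symm x).1
          (hA j j.2 ((extChartAt 𝓘(ℝ, E) (⟨u, hu⟩ : A)).symm x).2))
          (𝓝 (extChartAt 𝓘(ℝ, E) (⟨u, hu⟩ : A) (⟨u, hu⟩ : A))) (𝓝 (𝔉.B.mkObj u (hA j j.2 hu))) := by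
        have h6 := continuousAt_extChartAt_symm (I := 𝓘(ℝ, E)) (⟨u, hu⟩ : A)
        rw [ContinuousAt, extChartAt_to_inv] at h6
        exact (h5.tendsto _).comp h6
      exact h4.eventually ((trivializationAt (Euc (𝒮.k j)) (𝒮.O j).Fib _).open_baseSet.mem_nhds
        (mem_baseSet_trivializationAt _ _ _))
    filter_upwards [h2.eventually (eventually_val_extChartAt_symm (⟨u, hu⟩ : A)),
      h2.eventually (eventually_val_extChartAt_symm (⟨u, hu'⟩ : A')), h2.eventually h3]
      with z hz hz' hz''
    refine (repAt_eq h (hz.trans hz'.symm) (h₀ := fun i hi => hA' i hi hu') (h₀' := fun i hi => hA i hi hu)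
      (hI := fun i hi => hA' i hi ((extChartAt 𝓘(ℝ, E) (⟨u, hu'⟩ : A')).symm z.1).2)
      (hJ := fun i hi => hA i hi ((extChartAt 𝓘(ℝ, E) (⟨u, hu⟩ : A)).symm z.1).2)
      (fun i => ?_) fun j hj => Or.inr ?_).symm
    · exact (coordExt_of_mem z ⟨i, h i.2⟩ i.2).symm
    · exact ⟨coordExt_of_notMem z j hj, hz'' j⟩
  have h2 : DifferentiableAt ℝ (localRep hA p.base) (StabilizationData.coordExt 𝒮.k E I J q.coord) := by
    rw [H.coordExt h0]; exact p.differentiableAt_localRep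
  change _ = fderiv ℝ (localRep hA' q.base) q.coord
  rw [h1.fderiv_eq, fderiv_comp _ h2 (ContinuousLinearMap.differentiableAt _),
    ContinuousLinearMap.fderiv, H.coordExt h0]
  rfl

theorem sum_sdiff_cast (h : I ⊆ J) : ∑ j ∈ J, (𝒮.k j : ℤ) =
    ∑ i ∈ I, (𝒮.k i : ℤ) + ((∑ j ∈ J \ I, 𝒮.k j : ℕ) : ℤ) := by
  rw [← Finset.sum_sdiff h]
  push_cast
  ring

variable [CompleteSpace E] [CompleteSpace F]

/-- The linearization is already onto on the subspace of the components in `I`, and its kernel grows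
by the ranks of the remaining summands, as does the expected index. With `I` a singleton, this
passes from the stabilization at `½U_i` to all of `O_J`. -/
theorem Pt.Agree.isRegular_of_zero_ext {h : I ⊆ J} {p : 𝒮.Pt J A hA} {q : 𝒮.Pt I A' hA'}
    (H : p.Agree h q) (h0 : ∀ j : J, j.1 ∉ I → p.vec j = 0) (hq : q.IsRegular) : p.IsRegular := by
  have h1 := hq.isRegularOp_linearization.extend (L := p.linearization)
    (StabilizationData.coordExt 𝒮.k E I J).toLinearMap (coordCompl 𝒮.k E I J)
    (coordExt_injective h) coordCompl_surjective (exact_coord h)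
    (fun v => DFunLike.congr_fun (H.linearization_coordExt h0) v) finrank_coordCompl
  refine (isRegular_iff ?_ p).2 h1
  have := hq.expDim_eq
  have := sum_sdiff_cast (𝒮 := 𝒮) h
  push_cast at *
  omega

/-- The linearization at `p` factors through that at `q` by the projection forgetting `J - I`, whose
kernel has dimension the rank of `O_{J-I}`. The kernel dimension and the expected index therefore
change by the same amount. -/
theorem Pt.Agree.isRegular_iff {h : I ⊆ J} {p : 𝒮.Pt J A hA} {q : 𝒮.Pt I A' hA'}
    (H : p.Agree h q) (hη : ∀ j ∈ J, j ∉ I → ∀ᶠ x in 𝓝 p.base.1, 𝒮.η j x = 0) :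
    p.IsRegular ↔ q.IsRegular := by
  have hL := H.linearization_coordProj hη
  have hs := sum_sdiff_cast (𝒮 := 𝒮) h
  constructor
  · intro hp
    obtain ⟨h1, h2⟩ := hp.isRegularOp_linearization.descend (L' := q.linearization)
      (StabilizationData.coordExt 𝒮.k E I J).toLinearMap (coordCompl 𝒮.k E I J)
      (StabilizationData.coordProj 𝒮.k E h).toLinearMap coordCompl_surjective (exact_coord h)
      (coordProj_coordExt h) (fun v => DFunLike.congr_fun hL v) finrank_coordCompl
    refine (StabilizationData.isRegular_iff ?_ q).2 h2
    have := hp.expDim_eq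
    push_cast [h1] at *
    omega
  · intro hq
    have h1 := hq.isRegularOp_linearization.extend (L := p.linearization)
      (StabilizationData.coordExt 𝒮.k E I J).toLinearMap (coordCompl 𝒮.k E I J)
      (coordExt_injective h) coordCompl_surjective (exact_coord h)
      (fun v => (DFunLike.congr_fun hL _).trans
        (congrArg q.linearization (coordProj_coordExt h v))) finrank_coordCompl
    refine (StabilizationData.isRegular_iff ?_ p).2 h1
    have := hq.expDim_eq
    push_cast at *
    omega

end Compare

end StabilizationData

end VirtualOrb
end

/-! ### The projections `W_J → W_I` as orbifold vector bundles -/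

noncomputable section

namespace VirtualOrb
open TopGroupoid

namespace StabilizationData

variable {E : Type*} [NormedAddCommGroup E] [NormedSpace ℝ E]
  {F : Type*} [NormedAddCommGroup F] [NormedSpace ℝ F] {𝔉 : FredholmSystem.{v} E F}
  {ι : Type} {𝒮 : StabilizationData 𝔉 ι}

theorem continuous_codRestrict {G : TopGroupoid.{v}} {U : Opens G.Obj} {X : Type*}
    [TopologicalSpace X] {f : X → (G.restrict U).Obj} (h : Continuous fun x => (f x).1) :
    Continuous f :=
  continuous_induced_rng.2 h

theorem continuous_restrict_arr {G : TopGroupoid.{v}} {U : Opens G.Obj} {X : Type*}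
    [TopologicalSpace X] {f : X → (G.restrict U).Arr} (h : Continuous fun x => (f x).1) :
    Continuous f :=
  continuous_induced_rng.2 h

section SumBundle

variable {E' : Type*} [NormedAddCommGroup E'] [NormedSpace ℝ E'] {G : TopGroupoid.{v}}
  [ChartedSpace E' G.Obj] (K : Finset ι) (o : Hom G 𝔉.B) (mem : ∀ x, ∀ j ∈ K, o.obj x ∈ 𝒮.U j)
  (ho : ContMDiff 𝓘(ℝ, E') 𝓘(ℝ, E) ∞ o.obj) (hG : IsOrbifold E' G)

/-- The functor `o` as a functor to `U j`. -/
def toU (j : K) : Hom G (𝔉.B.restrict (𝒮.U j)) := o.codRestrict (𝒮.U j) fun x => mem x j j.2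

theorem contMDiff_toU (ho : ContMDiff 𝓘(ℝ, E') 𝓘(ℝ, E) ∞ o.obj) (j : K) :
    ContMDiff 𝓘(ℝ, E') 𝓘(ℝ, E) ∞ (toU K o mem j).obj :=
  fun x => contMDiffAt_codRestrict (ho x)

/-- The orbifold vector bundle `o^* ⨁_{j ∈ K} O_j`. -/
def sumBundle : OrbiBundle.{v, 0} E' G (Euc (∑ j : K, 𝒮.k j)) :=
  pullbackSum (fun j : K => 𝒮.O j) (toU K o mem) (contMDiff_toU K o mem ho) hG

/-- The components of the points of `o^* ⨁_{j ∈ K} O_j`. -/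
def sumBundleIso : 𝒮.PullbackSum K (sumBundle K o mem ho hG) o where
  mem := mem
  iso := sumIso (fun j : K => 𝒮.O j) (toU K o mem) (contMDiff_toU K o mem ho)
  smooth j := contMDiff_sumTot (O := fun j : K => 𝒮.O j) (o := toU K o mem)
    (ho := contMDiff_toU K o mem ho) j
  equivariant _ _ _ h j := OrbiBundle.Acts.sumTot _ _ _ h j

variable {K o mem ho hG}

/-- The point of `o^* ⨁_{j ∈ K} O_j` with given components. -/
def sumBundleMk (x : G.Obj) (v : ∀ j : K, (𝒮.O j).Fib (𝔉.B.mkObj (o.obj x) (mem x j j.2))) :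
    (sumBundle K o mem ho hG).Fib x :=
  (sumIso (fun j : K => 𝒮.O j) (toU K o mem) (contMDiff_toU K o mem ho) x).symm v

theorem sumBundleIso_tot_mk (x : G.Obj)
    (v : ∀ j : K, (𝒮.O j).Fib (𝔉.B.mkObj (o.obj x) (mem x j j.2))) (j : K) :
    (sumBundleIso K o mem ho hG).tot ⟨x, sumBundleMk x v⟩ j =
      ⟨𝔉.B.mkObj (o.obj x) (mem x j j.2), v j⟩ :=
  sumTot_mk (O := fun j : K => 𝒮.O j) (o := toU K o mem) (ho := contMDiff_toU K o mem ho) x v j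

theorem sumBundle_ext {a b : (sumBundle K o mem ho hG).Total} (h : a.proj = b.proj)
    (h' : ∀ j, (sumBundleIso K o mem ho hG).tot a j = (sumBundleIso K o mem ho hG).tot b j) :
    a = b :=
  sumTot_ext (O := fun j : K => 𝒮.O j) (o := toU K o mem) (ho := contMDiff_toU K o mem ho) h h'

theorem contMDiffAt_sumBundle {E'' : Type*} [NormedAddCommGroup E''] [NormedSpace ℝ E'']
    {H'' : Type*} [TopologicalSpace H''] {I'' : ModelWithCorners ℝ E'' H''} {N : Type*}
    [TopologicalSpace N] [ChartedSpace H'' N] {f : N → (sumBundle K o mem ho hG).Total} {x : N}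
    (h : ContMDiffAt I'' 𝓘(ℝ, E') ∞ (fun y => (f y).proj) x)
    (h' : ∀ j : K, ContMDiffAt I'' (𝓘(ℝ, E).prod 𝓘(ℝ, Euc (𝒮.k j))) ∞
      (fun y => (sumBundleIso K o mem ho hG).tot (f y) j) x) :
    ContMDiffAt I'' (𝓘(ℝ, E').prod 𝓘(ℝ, Euc (∑ j : K, 𝒮.k j))) ∞ f x :=
  contMDiffAt_sum (O := fun j : K => 𝒮.O j) (o := toU K o mem) (ho := contMDiff_toU K o mem ho) h h'

theorem sumBundle_acts {g : G.Arr} {a b : (sumBundle K o mem ho hG).Total}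
    (ha : a.proj = G.src g) (hb : b.proj = G.tgt g)
    (h : ∀ j : K, (𝒮.O j).Acts ((toU K o mem j).arr g)
      ((sumBundleIso K o mem ho hG).tot a j) ((sumBundleIso K o mem ho hG).tot b j)) :
    (sumBundle K o mem ho hG).Acts g a b :=
  pullbackSum_acts (fun j : K => 𝒮.O j) (toU K o mem) (contMDiff_toU K o mem ho) hG ha hb h

end SumBundle

variable [Finite ι]

section Points

variable {I : Finset ι}

theorem W_ext {x y : (𝒮.W I).Obj} (h : (𝒮.anchor I).obj x = (𝒮.anchor I).obj y)
    (h' : ∀ i, (pt x).tot i = (pt y).tot i) : x = y :=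
  Subtype.ext (Pt.ext_tot h h')

/-- The target is determined, being the source moved by the base arrow. -/
theorem W_arr_ext {a b : (𝒮.W I).Arr} (h : (𝒮.anchor I).arr a = (𝒮.anchor I).arr b)
    (h' : (𝒮.W I).src a = (𝒮.W I).src b) : a = b := by
  obtain ⟨⟨⟨g, p, q⟩, H⟩, hp, hq⟩ := a
  obtain ⟨⟨⟨g', p', q'⟩, H'⟩, hp', hq'⟩ := b
  obtain rfl : g = g' := h
  obtain rfl : p = p' := congrArg Subtype.val h'
  obtain rfl : q = q' := Pt.Acts.unique H H'
  rfl

/-- The arrow of `W_I` given by an arrow of the base. -/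
def mkArr (g : 𝔉.B.Arr) (x y : (𝒮.W I).Obj) (h : Pt.Acts g (pt x) (pt y)) : (𝒮.W I).Arr :=
  ⟨⟨(g, pt x, pt y), h⟩, x.2, y.2⟩

theorem W_arr_acts (a : (𝒮.W I).Arr) :
    Pt.Acts ((𝒮.anchor I).arr a) (pt ((𝒮.W I).src a)) (pt ((𝒮.W I).tgt a)) := a.1.2

theorem W_tendsto_iff {α : Type*} {l : Filter α} {f : α → (𝒮.W I).Obj} {x : (𝒮.W I).Obj} :
    Tendsto f l (𝓝 x) ↔ Tendsto (fun y => (𝒮.anchor I).obj (f y)) l (𝓝 ((𝒮.anchor I).obj x)) ∧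
      ∀ i, Tendsto (fun y => (pt (f y)).tot i) l (𝓝 ((pt x).tot i)) :=
  (tendsto_subtype_rng (f := f)).trans Pt.tendsto_iff

theorem continuous_W {X : Type*} [TopologicalSpace X] {f : X → (𝒮.W I).Obj}
    (h : Continuous fun y => (𝒮.anchor I).obj (f y))
    (h' : ∀ i, Continuous fun y => (pt (f y)).tot i) : Continuous f :=
  continuous_iff_continuousAt.2 fun x => W_tendsto_iff.2 ⟨h.tendsto x, fun i => (h' i).tendsto x⟩

theorem continuous_W_arr {X : Type*} [TopologicalSpace X] {f : X → (𝒮.W I).Arr}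
    (h : Continuous fun y => (𝒮.anchor I).arr (f y)) (hs : Continuous fun y => (𝒮.W I).src (f y))
    (ht : Continuous fun y => (𝒮.W I).tgt (f y)) : Continuous f :=
  Continuous.subtype_mk (Continuous.subtype_mk (h.prodMk
    ((continuous_subtype_val.comp hs).prodMk (continuous_subtype_val.comp ht))) _) _

theorem continuous_pt_tot (i : I) : Continuous fun x : (𝒮.W I).Obj => (pt x).tot i :=
  (Pt.continuous_tot i).comp continuous_subtype_val

theorem anchor_mem_piece (x : (𝒮.W I).Obj) : (𝒮.anchor I).obj x ∈ 𝒮.piece I := (pt x).base.2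

theorem invariant_piece (J : Finset ι) : 𝔉.B.Invariant (𝒮.piece J : Set 𝔉.B.Obj) := by
  intro g
  have h : ∀ j, 𝔉.B.Invariant (closure (𝒮.Umid j : Set 𝔉.B.Obj)) := fun j =>
    (𝒮.invariant_Umid j).closure 𝔉.isOrbifold.src_localHomeo.isOpenMap
  change ((∀ i ∈ J, 𝔉.B.src g ∈ 𝒮.U i) ∧ ∀ j ∉ J, 𝔉.B.src g ∉ closure (𝒮.Umid j : Set 𝔉.B.Obj)) ↔
    ((∀ i ∈ J, 𝔉.B.tgt g ∈ 𝒮.U i) ∧ ∀ j ∉ J, 𝔉.B.tgt g ∉ closure (𝒮.Umid j : Set 𝔉.B.Obj))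
  exact and_congr (forall₂_congr fun i _ => 𝒮.invariant_U i g)
    (forall₂_congr fun j _ => not_congr (h j g))

/-- The set `X_I` avoids the closure of `¾U_j`, not just `¾U_j`, so the cut-off vanishes on a
neighbourhood and its derivatives do not enter the linearization. -/
theorem eventually_η_eq_zero {J : Finset ι} {u : 𝔉.B.Obj} (hu : u ∈ 𝒮.piece I) :
    ∀ j ∈ J, j ∉ I → ∀ᶠ x in 𝓝 u, 𝒮.η j x = 0 := by
  intro j _ hj
  filter_upwards [isClosed_closure.isOpen_compl.mem_nhds (hu.2 j hj)] with x hx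
  exact 𝒮.η_eq_zero j x fun h => hx (subset_closure h)

end Points

section Drop

variable {I J : Finset ι}

/-- The point of `O_I` given by a point of `O_J` over `X_I`. -/
def dropPt (h : I ⊆ J) (x : (𝒮.W J).Obj) (hx : (𝒮.anchor J).obj x ∈ 𝒮.piece I) :
    𝒮.Pt I (𝒮.piece I) (𝒮.piece_le I) :=
  ⟨⟨(𝒮.anchor J).obj x, hx⟩, fun i => (pt x).vec ⟨i, h i.2⟩⟩

theorem agree_dropPt (h : I ⊆ J) (x : (𝒮.W J).Obj) (hx : (𝒮.anchor J).obj x ∈ 𝒮.piece I) :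
    (pt x).Agree h (dropPt h x hx) :=
  ⟨rfl, fun _ => rfl⟩

/-- The projection of an open part of `W_I` to the base. -/
abbrev anchorOn (D' : Opens (𝒮.W I).Obj) : Hom ((𝒮.W I).restrict D') 𝔉.B :=
  (𝒮.anchor I).comp (TopGroupoid.incl (𝒮.W I) (D' : Set (𝒮.W I).Obj))

theorem contMDiff_anchor_restrict [CompleteSpace E] [CompleteSpace F] (D' : Opens (𝒮.W I).Obj) :
    ContMDiff 𝓘(ℝ, Euc (𝒮.expDim I)) 𝓘(ℝ, E) ∞
      (anchorOn D').obj :=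
  (𝒮.contMDiff_anchor I).comp (contMDiff_restrict_val D')

variable [DecidableEq ι]

/-- The point of `O_J` with given components. -/
def liftPt (y : (𝒮.W I).Obj) (hy : (𝒮.anchor I).obj y ∈ 𝒮.piece J)
    (o : ∀ j : ↥(J \ I), (𝒮.O j).Fib (𝔉.B.mkObj ((𝒮.anchor I).obj y)
      (𝒮.piece_le J j (Finset.mem_sdiff.1 j.2).1 hy))) :
    𝒮.Pt J (𝒮.piece J) (𝒮.piece_le J) :=
  ⟨⟨(𝒮.anchor I).obj y, hy⟩, fun j =>
    if hj : j.1 ∈ I then (pt y).vec ⟨j, hj⟩ else o ⟨j, Finset.mem_sdiff.2 ⟨j.2, hj⟩⟩⟩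

theorem liftPt_tot_of_mem {y : (𝒮.W I).Obj} {hy : (𝒮.anchor I).obj y ∈ 𝒮.piece J}
    {o : ∀ j : ↥(J \ I), (𝒮.O j).Fib (𝔉.B.mkObj ((𝒮.anchor I).obj y)
      (𝒮.piece_le J j (Finset.mem_sdiff.1 j.2).1 hy))}
    (j : J) (hj : j.1 ∈ I) : (liftPt y hy o).tot j = (pt y).tot ⟨j, hj⟩ :=
  congrArg (TotalSpace.mk _) (dif_pos hj)

theorem liftPt_tot_of_notMem {y : (𝒮.W I).Obj} {hy : (𝒮.anchor I).obj y ∈ 𝒮.piece J}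
    {o : ∀ j : ↥(J \ I), (𝒮.O j).Fib (𝔉.B.mkObj ((𝒮.anchor I).obj y)
      (𝒮.piece_le J j (Finset.mem_sdiff.1 j.2).1 hy))} (j : J) (hj : j.1 ∉ I) :
    (liftPt y hy o).tot j = ⟨_, o ⟨j, Finset.mem_sdiff.2 ⟨j.2, hj⟩⟩⟩ :=
  congrArg (TotalSpace.mk _) (dif_neg hj)

variable [CompleteSpace E] [CompleteSpace F]

/-- A point of `O_J` over `X_I ∩ X_J` lies in `W_J` if and only if its projection lies in `W_I`. -/
theorem Pt.Agree.mem_W_iff {h : I ⊆ J} {p : 𝒮.Pt J (𝒮.piece J) (𝒮.piece_le J)}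
    {q : 𝒮.Pt I (𝒮.piece I) (𝒮.piece_le I)} (H : p.Agree h q) :
    (p.IsZero ∧ p.IsRegular) ↔ (q.IsZero ∧ q.IsRegular) := by
  have hu : p.base.1 ∈ 𝒮.piece I := by rw [H.base]; exact q.base.2
  have hη := eventually_η_eq_zero (J := J) hu
  refine and_congr (isZero_congr (H.hat_eq fun j hj => Or.inl ?_)) (H.isRegular_iff hη)
  exact (hη j j.2 hj).self_of_nhds

/-- The projection `W_J → W_I`, on the part over `X_I`. -/
def drop (h : I ⊆ J) (x : (𝒮.W J).Obj) (hx : (𝒮.anchor J).obj x ∈ 𝒮.piece I) : (𝒮.W I).Obj :=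
  ⟨dropPt h x hx, (agree_dropPt h x hx).mem_W_iff.1 x.2⟩

/-- The point of `W_J` over a point of `W_I` with given additional components. -/
def lift (h : I ⊆ J) (y : (𝒮.W I).Obj) (hy : (𝒮.anchor I).obj y ∈ 𝒮.piece J)
    (o : ∀ j : ↥(J \ I), (𝒮.O j).Fib (𝔉.B.mkObj ((𝒮.anchor I).obj y)
      (𝒮.piece_le J j (Finset.mem_sdiff.1 j.2).1 hy))) : (𝒮.W J).Obj :=
  ⟨liftPt y hy o, (Pt.Agree.mem_W_iff (h := h) (q := pt y)
    ⟨rfl, fun i : I => liftPt_tot_of_mem (y := y) (hy := hy) (o := o) ⟨i, h i.2⟩ i.2⟩).2 y.2⟩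

theorem drop_lift {h : I ⊆ J} {y : (𝒮.W I).Obj} {hy : (𝒮.anchor I).obj y ∈ 𝒮.piece J}
    {o : ∀ j : ↥(J \ I), (𝒮.O j).Fib (𝔉.B.mkObj ((𝒮.anchor I).obj y)
      (𝒮.piece_le J j (Finset.mem_sdiff.1 j.2).1 hy))}
    (hx : (𝒮.anchor J).obj (lift h y hy o) ∈ 𝒮.piece I) : drop h (lift h y hy o) hx = y :=
  W_ext rfl fun i : I => liftPt_tot_of_mem (y := y) (hy := hy) (o := o) ⟨i, h i.2⟩ i.2

theorem drop_acts (h : I ⊆ J) {a : (𝒮.W J).Arr}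
    (hs : (𝒮.anchor J).obj ((𝒮.W J).src a) ∈ 𝒮.piece I)
    (ht : (𝒮.anchor J).obj ((𝒮.W J).tgt a) ∈ 𝒮.piece I) :
    Pt.Acts ((𝒮.anchor J).arr a) (pt (drop h ((𝒮.W J).src a) hs))
      (pt (drop h ((𝒮.W J).tgt a) ht)) :=
  ⟨(W_arr_acts a).1, (W_arr_acts a).2.1, fun i => (W_arr_acts a).2.2 ⟨i, h i.2⟩⟩

variable {D : Opens (𝒮.W J).Obj} {D' : Opens (𝒮.W I).Obj}

theorem continuous_drop (h : I ⊆ J) (hD : ∀ x ∈ D, (𝒮.anchor J).obj x ∈ 𝒮.piece I) :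
    Continuous fun x : ((𝒮.W J).restrict D).Obj => drop h x.1 (hD x.1 x.2) := by
  have hv : Continuous fun x : ((𝒮.W J).restrict D).Obj => x.1 := continuous_subtype_val
  exact continuous_W ((𝒮.anchor J).continuous_obj.comp hv)
    fun i => (continuous_pt_tot (⟨i, h i.2⟩ : J)).comp hv

/-- The projection `W_J → W_I` as a functor between open suborbifolds. -/
def dropHom (h : I ⊆ J) (hD : ∀ x ∈ D, (𝒮.anchor J).obj x ∈ 𝒮.piece I)
    (hDD' : ∀ x y, (𝒮.anchor J).obj x = (𝒮.anchor I).obj y → (x ∈ D ↔ y ∈ D')) :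
    Hom ((𝒮.W J).restrict D) ((𝒮.W I).restrict D') where
  obj x := ⟨drop h x.1 (hD x.1 x.2), (hDD' x.1 _ rfl).1 x.2⟩
  arr a := ⟨mkArr _ _ _ (drop_acts h (hD _ a.2.1) (hD _ a.2.2)),
    (hDD' _ _ rfl).1 a.2.1, (hDD' _ _ rfl).1 a.2.2⟩
  continuous_obj := continuous_codRestrict (continuous_drop h hD)
  continuous_arr := continuous_restrict_arr (continuous_W_arr
    ((𝒮.anchor J).continuous_arr.comp continuous_subtype_val)
    ((continuous_drop h hD).comp ((𝒮.W J).restrict D).continuous_src)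
    ((continuous_drop h hD).comp ((𝒮.W J).restrict D).continuous_tgt))
  src_arr _ := rfl
  tgt_arr _ := rfl
  map_one _ := rfl
  map_comp _ _ _ := rfl

theorem contMDiff_dropHom (h : I ⊆ J) (hD : ∀ x ∈ D, (𝒮.anchor J).obj x ∈ 𝒮.piece I)
    (hDD' : ∀ x y, (𝒮.anchor J).obj x = (𝒮.anchor I).obj y → (x ∈ D ↔ y ∈ D')) :
    ContMDiff 𝓘(ℝ, Euc (𝒮.expDim J)) 𝓘(ℝ, Euc (𝒮.expDim I)) ∞ (dropHom h hD hDD').obj :=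
  fun x => contMDiffAt_codRestrict (contMDiffAt_W
    (((𝒮.contMDiff_anchor J).comp (contMDiff_restrict_val D)) x)
    fun i => ((𝒮.contMDiff_tot J ⟨i, h i.2⟩).comp (contMDiff_restrict_val D)) x)

/-- The bundle `𝔬^* O_{J-I}` over an open part of `W_I`. -/
abbrev complBundle (I J : Finset ι) (D' : Opens (𝒮.W I).Obj)
    (hD' : ∀ y ∈ D', (𝒮.anchor I).obj y ∈ 𝒮.piece J) :
    OrbiBundle.{v, 0} (Euc (𝒮.expDim I)) ((𝒮.W I).restrict D') (Euc (∑ j : ↥(J \ I), 𝒮.k j)) :=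
  sumBundle (J \ I) (anchorOn D')
    (fun x j hj => 𝒮.piece_le J j (Finset.mem_sdiff.1 hj).1 (hD' x.1 x.2))
    (contMDiff_anchor_restrict D') ((isOrbifold_W I).restrict D')

/-- The components in `𝔬^* O_{J-I}`. -/
abbrev complIso (I J : Finset ι) (D' : Opens (𝒮.W I).Obj)
    (hD' : ∀ y ∈ D', (𝒮.anchor I).obj y ∈ 𝒮.piece J) :
    𝒮.PullbackSum (J \ I) (complBundle I J D' hD') (anchorOn D') :=
  sumBundleIso (J \ I) (anchorOn D')
    (fun x j hj => 𝒮.piece_le J j (Finset.mem_sdiff.1 hj).1 (hD' x.1 x.2))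
    (contMDiff_anchor_restrict D') ((isOrbifold_W I).restrict D')

/-- The point of `𝔬^* O_{J-I}` given by a point of `W_J`. -/
def dropTotal (h : I ⊆ J) (hD : ∀ x ∈ D, (𝒮.anchor J).obj x ∈ 𝒮.piece I)
    (hD' : ∀ y ∈ D', (𝒮.anchor I).obj y ∈ 𝒮.piece J)
    (hDD' : ∀ x y, (𝒮.anchor J).obj x = (𝒮.anchor I).obj y → (x ∈ D ↔ y ∈ D'))
    (x : ((𝒮.W J).restrict D).Obj) : (complBundle I J D' hD').Total :=
  ⟨(dropHom h hD hDD').obj x, sumBundleMk _ fun j => (pt x.1).vec ⟨j, (Finset.mem_sdiff.1 j.2).1⟩⟩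

theorem dropTotal_tot (h : I ⊆ J) (hD : ∀ x ∈ D, (𝒮.anchor J).obj x ∈ 𝒮.piece I)
    (hD' : ∀ y ∈ D', (𝒮.anchor I).obj y ∈ 𝒮.piece J)
    (hDD' : ∀ x y, (𝒮.anchor J).obj x = (𝒮.anchor I).obj y → (x ∈ D ↔ y ∈ D'))
    (x : ((𝒮.W J).restrict D).Obj) (j : ↥(J \ I)) :
    (complIso I J D' hD').tot (dropTotal h hD hD' hDD' x) j =
      (pt x.1).tot ⟨j, (Finset.mem_sdiff.1 j.2).1⟩ :=
  sumBundleIso_tot_mk _ _ _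

/-- The point of `W_J` given by a point of `𝔬^* O_{J-I}`. -/
def liftTotal (h : I ⊆ J)
    (hD' : ∀ y ∈ D', (𝒮.anchor I).obj y ∈ 𝒮.piece J)
    (hDD' : ∀ x y, (𝒮.anchor J).obj x = (𝒮.anchor I).obj y → (x ∈ D ↔ y ∈ D'))
    (a : (complBundle I J D' hD').Total) : ((𝒮.W J).restrict D).Obj :=
  ⟨lift h a.proj.1 (hD' _ a.proj.2) ((complIso I J D' hD').iso a.proj a.2),
    (hDD' _ a.proj.1 rfl).2 a.proj.2⟩

/-- An arrow of `W_I` lives over a base arrow; move `x` along that arrow. By equivariance the result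
is again a regular zero, and it stays in `D` because membership in `D` and `D'` is decided by the
base point. -/
theorem existsUnique_dropHom_arr (h : I ⊆ J) (hD : ∀ x ∈ D, (𝒮.anchor J).obj x ∈ 𝒮.piece I)
    (hD' : ∀ y ∈ D', (𝒮.anchor I).obj y ∈ 𝒮.piece J)
    (hDD' : ∀ x y, (𝒮.anchor J).obj x = (𝒮.anchor I).obj y → (x ∈ D ↔ y ∈ D'))
    (g : ((𝒮.W I).restrict D').Arr) (x : ((𝒮.W J).restrict D).Obj)
    (hx : (dropHom h hD hDD').obj x = ((𝒮.W I).restrict D').src g) :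
    ∃! a : ((𝒮.W J).restrict D).Arr,
      ((𝒮.W J).restrict D).src a = x ∧ (dropHom h hD hDD').arr a = g := by
  have hx' : drop h x.1 (hD x.1 x.2) = (𝒮.W I).src g.1 := congrArg Subtype.val hx
  have hs : 𝔉.B.src ((𝒮.anchor I).arr g.1) = (pt x.1).base.1 :=
    ((𝒮.anchor I).src_arr g.1).trans (congrArg (𝒮.anchor I).obj hx').symm
  have ht' : 𝔉.B.tgt ((𝒮.anchor I).arr g.1) = (𝒮.anchor I).obj ((𝒮.W I).tgt g.1) :=
    (𝒮.anchor I).tgt_arr g.1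
  have ht : 𝔉.B.tgt ((𝒮.anchor I).arr g.1) ∈ 𝒮.piece J := ht' ▸ hD' _ g.2.2
  have hm := (pt x.1).acts_move _ hs ht
  let y : (𝒮.W J).Obj := ⟨_, hm.isZero x.1.2.1, hm.isRegular x.1.2.1 x.1.2.2⟩
  have hy : y ∈ D := (hDD' y _ ht').2 g.2.2
  refine ⟨⟨mkArr ((𝒮.anchor I).arr g.1) x.1 y hm, x.2, hy⟩, ⟨rfl, ?_⟩, ?_⟩
  · exact Subtype.ext (W_arr_ext rfl hx')
  · rintro a ⟨h1, h2⟩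
    exact Subtype.ext (W_arr_ext (congrArg (fun b : ((𝒮.W I).restrict D').Arr =>
      (𝒮.anchor I).arr b.1) h2) (congrArg Subtype.val h1))

/-- The projection `W_J → W_I` is the bundle `𝔬^* O_{J-I}`. -/
def dropBundle (h : I ⊆ J) (hD : ∀ x ∈ D, (𝒮.anchor J).obj x ∈ 𝒮.piece I)
    (hD' : ∀ y ∈ D', (𝒮.anchor I).obj y ∈ 𝒮.piece J)
    (hDD' : ∀ x y, (𝒮.anchor J).obj x = (𝒮.anchor I).obj y → (x ∈ D ↔ y ∈ D')) :
    BundleStr.{v} (E' := Euc (𝒮.expDim J)) (E := Euc (𝒮.expDim I)) (dropHom h hD hDD') where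
  rank := ∑ j : ↥(J \ I), 𝒮.k j
  V := complBundle I J D' hD'
  e :=
    { toFun := dropTotal h hD hD' hDD'
      invFun := liftTotal h hD' hDD'
      left_inv := fun x => by
        refine Subtype.ext (W_ext rfl fun j => ?_)
        by_cases hj : j.1 ∈ I
        · exact liftPt_tot_of_mem j hj
        · refine (liftPt_tot_of_notMem j hj).trans ?_
          exact dropTotal_tot h hD hD' hDD' x ⟨j, Finset.mem_sdiff.2 ⟨j.2, hj⟩⟩
      right_inv := fun a => by
        refine sumBundle_ext (Subtype.ext (drop_lift _)) fun j => ?_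
        refine (dropTotal_tot h hD hD' hDD' _ j).trans ?_
        exact liftPt_tot_of_notMem (y := a.proj.1) (hy := hD' _ a.proj.2)
          (o := (complIso I J D' hD').iso a.proj a.2) (⟨j, (Finset.mem_sdiff.1 j.2).1⟩ : J)
          (Finset.mem_sdiff.1 j.2).2
      contMDiff_toFun := fun x => by
        refine contMDiffAt_sumBundle (contMDiff_dropHom h hD hDD' x) fun j => ?_
        refine (((𝒮.contMDiff_tot J ⟨j, (Finset.mem_sdiff.1 j.2).1⟩).comp
          (contMDiff_restrict_val D)) x).congr_of_eventuallyEq (Eventually.of_forall fun y => ?_)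
        exact dropTotal_tot h hD hD' hDD' y j
      contMDiff_invFun := fun a => by
        have hp : ContMDiff (𝓘(ℝ, Euc (𝒮.expDim I)).prod 𝓘(ℝ, Euc (∑ j : ↥(J \ I), 𝒮.k j)))
            𝓘(ℝ, Euc (𝒮.expDim I)) ∞
            (fun a : (complBundle I J D' hD').Total => a.proj.1) :=
          (contMDiff_restrict_val D').comp (contMDiff_proj _)
        refine contMDiffAt_codRestrict (contMDiffAt_W (((𝒮.contMDiff_anchor I).comp hp) a)
          fun j => ?_)
        by_cases hj : j.1 ∈ I
        · exact (((𝒮.contMDiff_tot I ⟨j, hj⟩).comp hp) a).congr_of_eventuallyEq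
            (Eventually.of_forall fun b => liftPt_tot_of_mem j hj)
        · exact ((complIso I J D' hD').smooth
            ⟨j, Finset.mem_sdiff.2 ⟨j.2, hj⟩⟩ a).congr_of_eventuallyEq
              (Eventually.of_forall fun b => liftPt_tot_of_notMem j hj) }
  proj_e _ := rfl
  lift g x hx := existsUnique_dropHom_arr h hD hD' hDD' g x hx
  equivariant a := by
    refine sumBundle_acts rfl rfl fun j => ?_
    have h1 := (W_arr_acts a.1).2.2 ⟨j, (Finset.mem_sdiff.1 j.2).1⟩
    have h2 := dropTotal_tot h hD hD' hDD' (((𝒮.W J).restrict D).src a) j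
    have h3 := dropTotal_tot h hD hD' hDD' (((𝒮.W J).restrict D).tgt a) j
    exact (congrArg₂ ((𝒮.O j).Acts _) h2 h3).mpr h1

end Drop

end StabilizationData

end VirtualOrb
end

/-! ### Overlaps, fibre products and the virtual orbifold -/

noncomputable section

namespace VirtualOrb
open TopGroupoid

namespace StabilizationData

variable {E : Type*} [NormedAddCommGroup E] [NormedSpace ℝ E]
  {F : Type*} [NormedAddCommGroup F] [NormedSpace ℝ F] {𝔉 : FredholmSystem.{v} E F}
  {ι : Type} (𝒮 : StabilizationData 𝔉 ι) [Finite ι]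

/-- The overlap `W_{I,J} ⊆ W_I`. -/
def overlap (I J : Finset ι) : Opens (𝒮.W I).Obj :=
  ⟨(𝒮.anchor I).obj ⁻¹' (𝒮.piece J : Set 𝔉.B.Obj),
    (𝒮.piece J).isOpen.preimage (𝒮.anchor I).continuous_obj⟩

variable {𝒮}

theorem mem_overlap {I J : Finset ι} {x : (𝒮.W I).Obj} :
    x ∈ 𝒮.overlap I J ↔ (𝒮.anchor I).obj x ∈ 𝒮.piece J := Iff.rfl

theorem invariant_overlap (I J : Finset ι) :
    (𝒮.W I).Invariant (𝒮.overlap I J : Set (𝒮.W I).Obj) := fun g => by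
  have h := invariant_piece (𝒮 := 𝒮) J ((𝒮.anchor I).arr g)
  rw [(𝒮.anchor I).src_arr, (𝒮.anchor I).tgt_arr] at h
  exact h

theorem overlap_self (I : Finset ι) : 𝒮.overlap I I = ⊤ :=
  eq_top_iff.2 fun x _ => anchor_mem_piece x

theorem overlap_iff_overlap {I J : Finset ι} (x : (𝒮.W J).Obj) (y : (𝒮.W I).Obj)
    (h : (𝒮.anchor J).obj x = (𝒮.anchor I).obj y) : x ∈ 𝒮.overlap J I ↔ y ∈ 𝒮.overlap I J :=
  iff_of_true (by rw [mem_overlap, h]; exact anchor_mem_piece y)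
    (by rw [mem_overlap, ← h]; exact anchor_mem_piece x)

/-- On all of `W_I` this is `immersion_W`; the inclusion of an open part has injective derivative
because it has a smooth local left inverse. -/
theorem immersion_restrict_W [CompleteSpace E] [CompleteSpace F] {I : Finset ι} {D : Opens (𝒮.W I).Obj}
    (x : ((𝒮.W I).restrict D).Obj) (ξ : Euc (𝒮.expDim I))
    (h : (mfderiv 𝓘(ℝ, Euc (𝒮.expDim I)) 𝓘(ℝ, E)
      (fun x : ((𝒮.W I).restrict D).Obj => (𝒮.anchor I).obj x.1) x :
      Euc (𝒮.expDim I) →L[ℝ] E) ξ = 0)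
    (h' : ∀ i : I, (mfderiv 𝓘(ℝ, Euc (𝒮.expDim I)) (𝓘(ℝ, E).prod 𝓘(ℝ, Euc (𝒮.k i)))
      (fun x : ((𝒮.W I).restrict D).Obj => (pt x.1).tot i) x :
      Euc (𝒮.expDim I) →L[ℝ] E × Euc (𝒮.k i)) ξ = 0) :
    ξ = 0 := by
  classical
  have hv : MDifferentiableAt 𝓘(ℝ, Euc (𝒮.expDim I)) 𝓘(ℝ, Euc (𝒮.expDim I))
      (fun x : ((𝒮.W I).restrict D).Obj => x.1) x :=
    (contMDiff_restrict_val D).mdifferentiable (by simp) x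
  have h1 : (mfderiv 𝓘(ℝ, Euc (𝒮.expDim I)) 𝓘(ℝ, Euc (𝒮.expDim I))
      (fun x : ((𝒮.W I).restrict D).Obj => x.1) x :
      Euc (𝒮.expDim I) →L[ℝ] Euc (𝒮.expDim I)) ξ = 0 := by
    refine immersion_W x.1 _ ?_ fun i => ?_
    · exact (mfderiv_comp_apply_of_eq' ((𝒮.contMDiff_anchor I).mdifferentiable (by simp) x.1)
        hv rfl ξ).symm.trans h
    · exact (mfderiv_comp_apply_of_eq' ((𝒮.contMDiff_tot I i).mdifferentiable (by simp) x.1)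
        hv rfl ξ).symm.trans (h' i)
  -- A left inverse of the inclusion, smooth at `x` since it is the identity on `D`; its value off
  -- `D` plays no role.
  let r : (𝒮.W I).Obj → ((𝒮.W I).restrict D).Obj := fun y => if hy : y ∈ D then ⟨y, hy⟩ else x
  have hr : ∀ y, y ∈ D → (r y).1 = y := fun y hy => congrArg Subtype.val (dif_pos hy)
  have hr' : ContMDiffAt 𝓘(ℝ, Euc (𝒮.expDim I)) 𝓘(ℝ, Euc (𝒮.expDim I)) ∞ r x.1 := by
    refine contMDiffAt_codRestrict (contMDiffAt_id.congr_of_eventuallyEq ?_)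
    filter_upwards [D.isOpen.mem_nhds x.2] with y hy using hr y hy
  have h2 := mfderiv_comp_apply_of_eq' (hr'.mdifferentiableAt (by simp)) hv rfl ξ
  have h3 : r ∘ (fun x : ((𝒮.W I).restrict D).Obj => x.1) = id :=
    funext fun y => Subtype.ext (hr y.1 y.2)
  rw [h1, h3, mfderiv_id] at h2
  exact h2.trans (map_zero _)

variable [DecidableEq ι]

/-- Both sides say that `u` lies in `U_i` for all `i ∈ I ∪ J` and outside the closure of `¾U_j` for
all `j ∉ I ∩ J`. All the set-theoretic axioms on the overlaps are instances of this. -/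
theorem mem_piece_and_mem_piece {I J : Finset ι} {u : 𝔉.B.Obj} :
    u ∈ 𝒮.piece I ∧ u ∈ 𝒮.piece J ↔ u ∈ 𝒮.piece (I ∪ J) ∧ u ∈ 𝒮.piece (I ∩ J) := by
  constructor
  · rintro ⟨⟨h1, h2⟩, h3, h4⟩
    refine ⟨⟨fun i hi => (Finset.mem_union.1 hi).elim (h1 i) (h3 i),
      fun j hj => h2 j fun h => hj (Finset.mem_union_left _ h)⟩,
      fun i hi => h1 i (Finset.mem_inter.1 hi).1, fun j hj => ?_⟩
    by_cases hI : j ∈ I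
    · exact h4 j fun hJ => hj (Finset.mem_inter.2 ⟨hI, hJ⟩)
    · exact h2 j hI
  · rintro ⟨⟨h1, h2⟩, h3, h4⟩
    exact ⟨⟨fun i hi => h1 i (Finset.mem_union_left _ hi),
      fun j hj => h4 j fun h => hj (Finset.mem_inter.1 h).1⟩,
      fun i hi => h1 i (Finset.mem_union_right _ hi),
      fun j hj => h4 j fun h => hj (Finset.mem_inter.1 h).2⟩

theorem overlap_union_inter (I J : Finset ι) :
    𝒮.overlap (I ∪ J) (I ∩ J) = 𝒮.overlap (I ∪ J) I ⊓ 𝒮.overlap (I ∪ J) J :=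
  Opens.ext (Set.ext fun x =>
    ⟨fun h => mem_piece_and_mem_piece.2 ⟨anchor_mem_piece x, h⟩,
      fun h => (mem_piece_and_mem_piece.1 h).2⟩)

theorem overlap_inter_union (I J : Finset ι) :
    𝒮.overlap (I ∩ J) (I ∪ J) = 𝒮.overlap (I ∩ J) I ⊓ 𝒮.overlap (I ∩ J) J :=
  Opens.ext (Set.ext fun x =>
    ⟨fun h => mem_piece_and_mem_piece.2 ⟨h, anchor_mem_piece x⟩,
      fun h => (mem_piece_and_mem_piece.1 h).1⟩)

theorem anchor_mem_inter {I J : Finset ι} (x : (𝒮.W I).Obj) (hx : x ∈ 𝒮.overlap I J) :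
    (𝒮.anchor I).obj x ∈ 𝒮.piece (I ∩ J) :=
  (mem_piece_and_mem_piece.1 ⟨anchor_mem_piece x, hx⟩).2

theorem anchor_mem_union {I J : Finset ι} (x : (𝒮.W I).Obj) (hx : x ∈ 𝒮.overlap I J) :
    (𝒮.anchor I).obj x ∈ 𝒮.piece (I ∪ J) :=
  (mem_piece_and_mem_piece.1 ⟨anchor_mem_piece x, hx⟩).1

theorem anchor_mem_left {I J : Finset ι} (y : (𝒮.W (I ∩ J)).Obj)
    (hy : y ∈ 𝒮.overlap (I ∩ J) (I ∪ J)) : (𝒮.anchor (I ∩ J)).obj y ∈ 𝒮.piece I :=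
  (mem_piece_and_mem_piece.2 ⟨hy, anchor_mem_piece y⟩).1

theorem overlap_iff_overlap_inter {I J : Finset ι} (x : (𝒮.W I).Obj) (y : (𝒮.W (I ∩ J)).Obj)
    (h : (𝒮.anchor I).obj x = (𝒮.anchor (I ∩ J)).obj y) :
    x ∈ 𝒮.overlap I J ↔ y ∈ 𝒮.overlap (I ∩ J) (I ∪ J) := by
  refine ⟨fun hx => ?_, fun hy => ?_⟩
  · rw [mem_overlap, ← h]; exact anchor_mem_union x hx
  · rw [mem_overlap, h]; exact (mem_piece_and_mem_piece.2 ⟨hy, anchor_mem_piece y⟩).2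

variable [CompleteSpace E] [CompleteSpace F]

section FiberProduct

variable (𝒮) in
/-- The map `W_{I∪J,I∩J} → W_I × W_J`. -/
def fiberProductMap (I J : Finset ι) (x : ((𝒮.W (I ∪ J)).restrict (𝒮.overlap (I ∪ J) (I ∩ J))).Obj) :
    (𝒮.W I).Obj × (𝒮.W J).Obj :=
  (drop Finset.subset_union_left x.1 ((overlap_union_inter I J).le x.2).1,
    drop Finset.subset_union_right x.1 ((overlap_union_inter I J).le x.2).2)

variable (I J : Finset ι)

theorem contMDiff_fiberProductMap : ContMDiff 𝓘(ℝ, Euc (𝒮.expDim (I ∪ J)))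
    (𝓘(ℝ, Euc (𝒮.expDim I)).prod 𝓘(ℝ, Euc (𝒮.expDim J))) ∞ (𝒮.fiberProductMap I J) := by
  have hv := contMDiff_restrict_val (𝒮.overlap (I ∪ J) (I ∩ J))
    (E := Euc (𝒮.expDim (I ∪ J)))
  refine ContMDiff.prodMk (fun x => ?_) fun x => ?_
  · exact contMDiffAt_W (((𝒮.contMDiff_anchor _).comp hv) x) fun i =>
      ((𝒮.contMDiff_tot _ ⟨i, Finset.mem_union_left _ i.2⟩).comp hv) x
  · exact contMDiffAt_W (((𝒮.contMDiff_anchor _).comp hv) x) fun i =>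
      ((𝒮.contMDiff_tot _ ⟨i, Finset.mem_union_right _ i.2⟩).comp hv) x

/-- Every index of `I ∪ J` lies in `I` or in `J`, so each component of a point is a component of one
of its two images. This gives injectivity and the topology at once. -/
theorem isEmbedding_fiberProductMap : Topology.IsEmbedding (𝒮.fiberProductMap I J) := by
  have htot : ∀ i : ↥(I ∪ J), (∃ hi : i.1 ∈ I, ∀ x, (pt x.1).tot i =
      (pt (𝒮.fiberProductMap I J x).1).tot ⟨i, hi⟩) ∨ (∃ hi : i.1 ∈ J, ∀ x, (pt x.1).tot i =
      (pt (𝒮.fiberProductMap I J x).2).tot ⟨i, hi⟩) := fun i =>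
    (Finset.mem_union.1 i.2).imp (fun hi => ⟨hi, fun _ => rfl⟩) fun hi => ⟨hi, fun _ => rfl⟩
  refine ⟨(Topology.isInducing_iff_nhds).2 fun x => le_antisymm ?_ ?_, fun x y hxy => ?_⟩
  · exact ((contMDiff_fiberProductMap I J).continuous.tendsto x).le_comap
  · have h : Tendsto (𝒮.fiberProductMap I J) (comap (𝒮.fiberProductMap I J)
        (𝓝 (𝒮.fiberProductMap I J x))) (𝓝 (𝒮.fiberProductMap I J x)) := tendsto_comap
    have h1 := W_tendsto_iff.1 ((continuous_fst.tendsto _).comp h)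
    have h2 := W_tendsto_iff.1 ((continuous_snd.tendsto _).comp h)
    refine tendsto_id'.1 (tendsto_subtype_rng.2 (W_tendsto_iff.2 ⟨h1.1, fun i => ?_⟩))
    obtain ⟨hi, H⟩ | ⟨hi, H⟩ := htot i
    · exact h1.2 ⟨i, hi⟩
    · exact h2.2 ⟨i, hi⟩
  · refine Subtype.ext (W_ext (congrArg (fun p : (𝒮.W I).Obj × (𝒮.W J).Obj =>
      (𝒮.anchor I).obj p.1) hxy) fun i => ?_)
    obtain ⟨hi, H⟩ | ⟨hi, H⟩ := htot i
    · exact (H x).trans ((congrArg (fun p : (𝒮.W I).Obj × (𝒮.W J).Obj =>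
        (pt p.1).tot ⟨i, hi⟩) hxy).trans (H y).symm)
    · exact (H x).trans ((congrArg (fun p : (𝒮.W I).Obj × (𝒮.W J).Obj =>
        (pt p.2).tot ⟨i, hi⟩) hxy).trans (H y).symm)

/-- A tangent vector killed by both projections has vanishing base part and vanishing components for
the indices in `I` and in `J`, hence for all of them. -/
theorem injective_mfderiv_fiberProductMap
    (x : ((𝒮.W (I ∪ J)).restrict (𝒮.overlap (I ∪ J) (I ∩ J))).Obj) :
    Function.Injective (mfderiv 𝓘(ℝ, Euc (𝒮.expDim (I ∪ J)))
      (𝓘(ℝ, Euc (𝒮.expDim I)).prod 𝓘(ℝ, Euc (𝒮.expDim J))) (𝒮.fiberProductMap I J) x) := by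
  have hd := (contMDiff_fiberProductMap I J (𝒮 := 𝒮)).mdifferentiable (by simp) x
  refine (injective_iff_map_eq_zero (mfderiv 𝓘(ℝ, Euc (𝒮.expDim (I ∪ J)))
      (𝓘(ℝ, Euc (𝒮.expDim I)).prod 𝓘(ℝ, Euc (𝒮.expDim J))) (𝒮.fiberProductMap I J) x)).2
      fun ξ hξ => immersion_restrict_W x ξ ?_ fun i => ?_
  · have h1 := mfderiv_comp_apply_of_eq' (((𝒮.contMDiff_anchor I).comp
      (contMDiff_fst (J := 𝓘(ℝ, Euc (𝒮.expDim J))) (N := (𝒮.W J).Obj))).mdifferentiable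
        (by simp) (𝒮.fiberProductMap I J x)) hd rfl ξ
    exact h1.trans ((congrArg _ hξ).trans (map_zero _))
  · obtain hi | hi := Finset.mem_union.1 i.2
    · have h1 := mfderiv_comp_apply_of_eq' (((𝒮.contMDiff_tot I ⟨i, hi⟩).comp
        (contMDiff_fst (J := 𝓘(ℝ, Euc (𝒮.expDim J))) (N := (𝒮.W J).Obj))).mdifferentiable
          (by simp) (𝒮.fiberProductMap I J x)) hd rfl ξ
      exact h1.trans ((congrArg _ hξ).trans (map_zero _))
    · have h1 := mfderiv_comp_apply_of_eq' (((𝒮.contMDiff_tot J ⟨i, hi⟩).comp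
        (contMDiff_snd (I := 𝓘(ℝ, Euc (𝒮.expDim I))) (M := (𝒮.W I).Obj))).mdifferentiable
          (by simp) (𝒮.fiberProductMap I J x)) hd rfl ξ
      exact h1.trans ((congrArg _ hξ).trans (map_zero _))

theorem range_fiberProductMap : Set.range (𝒮.fiberProductMap I J) =
    {p | p.1 ∈ 𝒮.overlap I J ∧ p.2 ∈ 𝒮.overlap J I ∧
      ∃ (h₁ : p.1 ∈ 𝒮.overlap I (I ∩ J)) (h₂ : p.2 ∈ 𝒮.overlap J (I ∩ J)),
        drop Finset.inter_subset_left p.1 h₁ = drop Finset.inter_subset_right p.2 h₂} := by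
  apply Subset.antisymm
  · rintro _ ⟨x, rfl⟩
    have h := (overlap_union_inter I J).le x.2
    exact ⟨h.2, h.1, x.2, x.2, rfl⟩
  · rintro ⟨y, z⟩ ⟨hy, hz, h₁, h₂, h⟩
    have hb : (𝒮.anchor I).obj y = (𝒮.anchor J).obj z :=
      congrArg (𝒮.anchor (I ∩ J)).obj h
    have hyu : (𝒮.anchor I).obj y ∈ 𝒮.piece (I ∪ J) := anchor_mem_union y hy
    have hJ : ∀ j : ↥((I ∪ J) \ I), j.1 ∈ J := fun j =>
      (Finset.mem_union.1 (Finset.mem_sdiff.1 j.2).1).resolve_left (Finset.mem_sdiff.1 j.2).2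
    -- The preimage is glued from the base point and components of `y` and the components of `z`
    -- with index outside `I`.
    have hex : ∀ j : ↥((I ∪ J) \ I), ∃ o : (𝒮.O j).Fib (𝔉.B.mkObj ((𝒮.anchor I).obj y)
        (𝒮.piece_le (I ∪ J) j (Finset.mem_sdiff.1 j.2).1 hyu)), (pt z).tot ⟨j, hJ j⟩ = ⟨_, o⟩ :=
      fun j => (𝒮.O j).exists_fib _ _ (Subtype.ext hb.symm)
    choose o ho using hex
    have hl : lift Finset.subset_union_left y hyu o ∈ 𝒮.overlap (I ∪ J) (I ∩ J) := h₁
    refine ⟨⟨lift Finset.subset_union_left y hyu o, hl⟩, Prod.ext (drop_lift _) ?_⟩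
    refine W_ext hb fun j => ?_
    by_cases hj : j.1 ∈ I
    -- For `j ∈ I ∩ J` the glued component is that of `y`; it equals that of `z` since `y` and `z`
    -- have the same image in `W_{I∩J}`.
    · refine (liftPt_tot_of_mem (y := y) (hy := hyu) (o := o)
        ⟨j, Finset.mem_union_right _ j.2⟩ hj).trans ?_
      exact congrArg (fun w : (𝒮.W (I ∩ J)).Obj =>
        (pt w).tot ⟨j, Finset.mem_inter.2 ⟨hj, j.2⟩⟩) h
    · refine (liftPt_tot_of_notMem (y := y) (hy := hyu) (o := o)
        ⟨j, Finset.mem_union_right _ j.2⟩ hj).trans ?_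
      exact (ho ⟨j, Finset.mem_sdiff.2 ⟨Finset.mem_union_right _ j.2, hj⟩⟩).symm

end FiberProduct

/-- The transition map `W_{J,I} → W_{I,J}`. -/
abbrev transition {I J : Finset ι} (h : I ⊆ J) :
    Hom ((𝒮.W J).restrict (𝒮.overlap J I)) ((𝒮.W I).restrict (𝒮.overlap I J)) :=
  dropHom h (fun _ hx => hx) overlap_iff_overlap

variable (𝒮) in
/-- The family of the `W_I` is a virtual orbifold. -/
@[reducible] def virtualOrbifold : VirtualOrbifold 𝒮.W where
  dim := 𝒮.expDim
  charted I := wCharted 𝒮 I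
  isOrbifold := isOrbifold_W
  dom := 𝒮.overlap
  dom_invariant := invariant_overlap
  φ h := transition h
  -- The additional components are free, so zero vectors will do.
  surjective_φ h y :=
    ⟨⟨lift h y.1 y.2 0, (overlap_iff_overlap (lift h y.1 y.2 0) y.1 rfl).2 y.2⟩,
      Subtype.ext (drop_lift _)⟩
  dom_self := overlap_self
  φ_self_obj _ _ := W_ext rfl fun _ => rfl
  φ_self_arr _ _ := W_arr_ext rfl (W_ext rfl fun _ => rfl)
  bundle h := dropBundle h (fun _ hx => hx) (fun _ hx => hx) overlap_iff_overlap
  P1 := overlap_union_inter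
  P2 := overlap_inter_union
  P3_obj _ _ _ _ _ _ := W_ext rfl fun _ => rfl
  P3_arr _ _ _ _ _ _ := W_arr_ext rfl (W_ext rfl fun _ => rfl)
  P4 I J y := by
    constructor
    · intro hy
      exact ⟨⟨lift Finset.subset_union_left y (anchor_mem_union y hy) 0, anchor_mem_piece y⟩,
        anchor_mem_inter y hy, drop_lift _⟩
    · rintro ⟨x, hx, rfl⟩
      exact ((overlap_union_inter I J).le hx).2
  P4' I J y :=
    ⟨fun hy => ⟨anchor_mem_inter y hy, anchor_mem_union y hy⟩,
      fun ⟨h, h'⟩ => (mem_piece_and_mem_piece.2 ⟨h', h⟩).2⟩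
  bundle_inter I J := ⟨dropHom Finset.inter_subset_left anchor_mem_inter overlap_iff_overlap_inter,
    fun _ _ => rfl, fun _ _ => rfl,
    ⟨dropBundle Finset.inter_subset_left anchor_mem_inter anchor_mem_left
      overlap_iff_overlap_inter⟩⟩
  fiberProduct I J := ⟨isEmbedding_fiberProductMap I J, contMDiff_fiberProductMap I J,
    injective_mfderiv_fiberProductMap I J, range_fiberProductMap I J⟩

end StabilizationData

end VirtualOrb
end

/-! ### Obstruction bundles, the section `σ` and its zeros -/

noncomputable section

namespace VirtualOrb
open TopGroupoid

/-- Splitting a product over `J` into the products over `J - I` and over `I ⊆ J`. -/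
def piSplit {ι : Type*} [DecidableEq ι] {I J : Finset ι} (h : I ⊆ J) (M : J → Type*)
    [∀ j, AddCommGroup (M j)] [∀ j, Module ℝ (M j)] :
    (∀ j, M j) ≃ₗ[ℝ] (∀ j : ↥(J \ I), M ⟨j, (Finset.mem_sdiff.1 j.2).1⟩) ×
      (∀ i : I, M ⟨i, h i.2⟩) where
  toFun f := (fun j => f ⟨j, (Finset.mem_sdiff.1 j.2).1⟩, fun i => f ⟨i, h i.2⟩)
  invFun p j := if hj : j.1 ∈ I then p.2 ⟨j, hj⟩ else p.1 ⟨j, Finset.mem_sdiff.2 ⟨j.2, hj⟩⟩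
  map_add' _ _ := rfl
  map_smul' _ _ := rfl
  left_inv f := funext fun j => by by_cases hj : j.1 ∈ I <;> simp [hj]
  right_inv p := Prod.ext (funext fun j => dif_neg (Finset.mem_sdiff.1 j.2).2)
    (funext fun i => dif_pos i.2)

namespace StabilizationData

section Zeros

variable {E : Type*} [NormedAddCommGroup E] [NormedSpace ℝ E]
  {F : Type*} [NormedAddCommGroup F] [NormedSpace ℝ F] {𝔉 : FredholmSystem.{v} E F}
  {ι : Type} {𝒮 : StabilizationData 𝔉 ι}

theorem Pt.isZero_iff_of_vec_eq_zero {I : Finset ι} {A : Opens 𝔉.B.Obj}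
    {hA : ∀ i ∈ I, A ≤ 𝒮.U i} {p : 𝒮.Pt I A hA} (hp : p.vec = 0) :
    p.IsZero ↔ 𝔉.S p.base.1 = 0 := by
  have h : ∀ i : I, 𝒮.s i (𝔉.B.mkObj p.base.1 (hA i i.2 p.base.2)) (p.vec i) = 0 := fun i => by
    rw [hp]; exact (𝒮.s i _).map_zero
  have h1 := Finset.sum_eq_zero (M := 𝔉.bundle.Fib p.base.1) (s := Finset.univ)
    (f := fun i : I => 𝒮.s i (𝔉.B.mkObj p.base.1 (hA i i.2 p.base.2)) (p.vec i)) fun i _ => h i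
  exact Iff.of_eq (congrArg (· = (0 : 𝔉.bundle.Fib p.base.1))
    ((congrArg (𝔉.S p.base.1 + ·) h1).trans (add_zero _)))

end Zeros

variable {E : Type*} [NormedAddCommGroup E] [NormedSpace ℝ E] [CompleteSpace E]
  {F : Type*} [NormedAddCommGroup F] [NormedSpace ℝ F] [CompleteSpace F]
  {𝔉 : FredholmSystem.{v} E F} {ι : Type} (𝒮 : StabilizationData 𝔉 ι) [Finite ι]

/-- The obstruction bundle `𝔬^* O_I` over `W_I`. -/
abbrev obstruction (I : Finset ι) :
    OrbiBundle.{v, 0} (Euc (𝒮.expDim I)) (𝒮.W I) (Euc (∑ j : I, 𝒮.k j)) :=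
  sumBundle I (𝒮.anchor I) (fun x j hj => 𝒮.piece_le I j hj (anchor_mem_piece x))
    (𝒮.contMDiff_anchor I) (isOrbifold_W I)

/-- The components in `𝔬^* O_I`. -/
abbrev obstructionIso (I : Finset ι) : 𝒮.PullbackSum I (𝒮.obstruction I) (𝒮.anchor I) :=
  sumBundleIso I (𝒮.anchor I) (fun x j hj => 𝒮.piece_le I j hj (anchor_mem_piece x))
    (𝒮.contMDiff_anchor I) (isOrbifold_W I)

/-- The section `σ : (u, o) ↦ (u, o, o)` of `𝔬^* O_I`. -/
def diagonal (I : Finset ι) (x : (𝒮.W I).Obj) : (𝒮.obstruction I).Fib x :=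
  sumBundleMk x (pt x).vec

variable {𝒮}

theorem diagonal_tot (I : Finset ι) (x : (𝒮.W I).Obj) (i : I) :
    (𝒮.obstructionIso I).tot ⟨x, 𝒮.diagonal I x⟩ i = (pt x).tot i :=
  sumBundleIso_tot_mk _ _ _

theorem contMDiff_diagonal (I : Finset ι) : ContMDiff 𝓘(ℝ, Euc (𝒮.expDim I))
    (𝓘(ℝ, Euc (𝒮.expDim I)).prod 𝓘(ℝ, Euc (∑ j : I, 𝒮.k j))) ∞
    (fun x => (⟨x, 𝒮.diagonal I x⟩ : (𝒮.obstruction I).Total)) := fun x =>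
  contMDiffAt_sumBundle contMDiffAt_id fun j =>
    (𝒮.contMDiff_tot I j x).congr_of_eventuallyEq
      (Eventually.of_forall fun y => diagonal_tot I y j)

theorem act_diagonal (I : Finset ι) (g : (𝒮.W I).Arr) :
    (𝒮.obstruction I).act g (𝒮.diagonal I ((𝒮.W I).src g)) = 𝒮.diagonal I ((𝒮.W I).tgt g) := by
  have h : (𝒮.obstruction I).Acts g ⟨_, 𝒮.diagonal I ((𝒮.W I).src g)⟩
      ⟨_, 𝒮.diagonal I ((𝒮.W I).tgt g)⟩ := by
    refine sumBundle_acts rfl rfl fun j => ?_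
    have h1 := (W_arr_acts g).2.2 j
    exact (congrArg₂ ((𝒮.O j).Acts _) (diagonal_tot I _ j) (diagonal_tot I _ j)).mpr h1
  obtain ⟨y, hy, hy'⟩ := h
  have h1 : 𝒮.diagonal I ((𝒮.W I).src g) = y := eq_of_heq (TotalSpace.mk.inj hy).2
  rw [h1]
  exact (eq_of_heq (TotalSpace.mk.inj hy').2).symm

/-- At a zero of `σ` the vector `o` vanishes, so `Ŝ = S` there. In the other direction the covering
property and the stabilization at `½U_i` enter: they show that a point of `M` over `X_I`, with zero
vector, is a regular zero and thus a point of `W_I`. -/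
theorem image_zeros_diagonal (h𝒮 : 𝒮.IsLocalStabilizationSystem) (I : Finset ι) :
    (𝒮.anchor I).obj '' {x | 𝒮.diagonal I x = 0} = {u | u ∈ 𝒮.piece I ∧ 𝔉.S u = 0} := by
  classical
  apply Subset.antisymm
  · rintro _ ⟨x, hx, rfl⟩
    refine ⟨anchor_mem_piece x, ?_⟩
    have hv : (pt x).vec = 0 := (LinearEquiv.map_eq_zero_iff _).1 hx
    exact (Pt.isZero_iff_of_vec_eq_zero hv).1 x.2.1
  · rintro u ⟨hu, hS⟩
    obtain ⟨i, hi⟩ := h𝒮.covers u hS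
    -- `X_I` avoids the closure of `¾U_j`, hence `½U_j`, for every `j ∉ I`.
    have hiI : i ∈ I := by
      by_contra hn
      exact hu.2 i hn (subset_closure (𝒮.closure_Uhalf i (subset_closure hi)))
    let q : 𝒮.Pt {i} (𝒮.Uhalf i) (𝒮.Uhalf_le i) := ⟨⟨u, hi⟩, 0⟩
    let p : 𝒮.Pt I (𝒮.piece I) (𝒮.piece_le I) := ⟨⟨u, hu⟩, 0⟩
    have hq : q.IsZero := (Pt.isZero_iff_of_vec_eq_zero rfl).2 hS
    have hp : p.IsZero := (Pt.isZero_iff_of_vec_eq_zero rfl).2 hS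
    -- The point `q` is regular for `O_i` alone; `p` is its extension by zero to `O_I`.
    have hA : p.Agree (Finset.singleton_subset_iff.2 hiI) q := ⟨rfl, fun _ => rfl⟩
    have hr : p.IsRegular :=
      hA.isRegular_of_zero_ext (fun _ _ => rfl) (h𝒮.stabilizes i q hq)
    let x : (𝒮.W I).Obj := ⟨p, hp, hr⟩
    have h0 : 𝒮.diagonal I x = 0 := LinearEquiv.map_zero _
    exact ⟨x, h0, rfl⟩

section Split

variable {I J : Finset ι}

variable (𝒮 I J) in
/-- The part of the total space of `𝔬^* O_J` over `W_{J,I}`. -/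
abbrev obstructionOver : Opens (𝒮.obstruction J).Total :=
  ⟨{a | a.proj ∈ 𝒮.overlap J I}, (𝒮.overlap J I).isOpen.preimage
    (FiberBundle.continuous_proj (Euc (∑ j : J, 𝒮.k j)) (𝒮.obstruction J).Fib)⟩

theorem contMDiff_proj_obstructionOver : ContMDiff
    (𝓘(ℝ, Euc (𝒮.expDim J)).prod 𝓘(ℝ, Euc (∑ j : J, 𝒮.k j))) 𝓘(ℝ, Euc (𝒮.expDim J)) ∞
    (fun a : 𝒮.obstructionOver I J => a.1.proj) :=
  (contMDiff_proj (𝒮.obstruction J).Fib).comp contMDiff_subtype_val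

variable [DecidableEq ι]

variable (𝒮 I J) in
/-- The part of `𝔬^* O_{J-I}` over the overlap `W_{I,J}`. -/
abbrev overlapBundle : OrbiBundle.{v, 0} (Euc (𝒮.expDim I)) ((𝒮.W I).restrict (𝒮.overlap I J))
    (Euc (∑ j : ↥(J \ I), 𝒮.k j)) :=
  complBundle I J (𝒮.overlap I J) fun _ hx => hx

variable (𝒮 I J) in
/-- The components in `𝔬^* O_{J-I}`. -/
abbrev overlapIso : 𝒮.PullbackSum (J \ I) (𝒮.overlapBundle I J)
    (anchorOn (𝒮.overlap I J)) :=
  complIso I J (𝒮.overlap I J) fun _ hx => hx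

/-- The isomorphism `𝔬^* O_J = 𝔬^* O_{J-I} ⊕ 𝔬^* O_I`. -/
def obstructionSplit (h : I ⊆ J) (x : ((𝒮.W J).restrict (𝒮.overlap J I)).Obj) :
    (𝒮.obstruction J).Fib x.1 ≃ₗ[ℝ]
      (𝒮.overlapBundle I J).Fib ((transition h).obj x) ×
        (𝒮.obstruction I).Fib ((transition h).obj x).1 :=
  ((𝒮.obstructionIso J).iso x.1).trans <| (piSplit h _).trans <|
    (((𝒮.overlapIso I J).iso ((transition h).obj x)).prodCongr
      ((𝒮.obstructionIso I).iso ((transition h).obj x).1)).symm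

theorem obstructionSplit_fst_tot (h : I ⊆ J) (x : ((𝒮.W J).restrict (𝒮.overlap J I)).Obj)
    (a : (𝒮.obstruction J).Fib x.1) (j : ↥(J \ I)) :
    (𝒮.overlapIso I J).tot ⟨(transition h).obj x, (obstructionSplit h x a).1⟩ j =
      (𝒮.obstructionIso J).tot ⟨x.1, a⟩ ⟨j, (Finset.mem_sdiff.1 j.2).1⟩ :=
  sumBundleIso_tot_mk _ _ _

theorem obstructionSplit_snd_tot (h : I ⊆ J) (x : ((𝒮.W J).restrict (𝒮.overlap J I)).Obj)
    (a : (𝒮.obstruction J).Fib x.1) (i : I) :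
    (𝒮.obstructionIso I).tot ⟨((transition h).obj x).1, (obstructionSplit h x a).2⟩ i =
      (𝒮.obstructionIso J).tot ⟨x.1, a⟩ ⟨i, h i.2⟩ :=
  sumBundleIso_tot_mk _ _ _

theorem contMDiff_transition_proj (h : I ⊆ J) : ContMDiff
    (𝓘(ℝ, Euc (𝒮.expDim J)).prod 𝓘(ℝ, Euc (∑ j : J, 𝒮.k j))) 𝓘(ℝ, Euc (𝒮.expDim I)) ∞
    (fun a : 𝒮.obstructionOver I J => ((transition h).obj ⟨a.1.proj, a.2⟩).1) := fun a =>
  contMDiffAt_W (((𝒮.contMDiff_anchor J).comp contMDiff_proj_obstructionOver) a)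
    fun i => ((𝒮.contMDiff_tot J ⟨i, h i.2⟩).comp contMDiff_proj_obstructionOver) a

theorem contMDiff_obstructionSplit_fst (h : I ⊆ J) : ContMDiff
    (𝓘(ℝ, Euc (𝒮.expDim J)).prod 𝓘(ℝ, Euc (∑ j : J, 𝒮.k j)))
    (𝓘(ℝ, Euc (𝒮.expDim I)).prod 𝓘(ℝ, Euc (∑ j : ↥(J \ I), 𝒮.k j))) ∞
    (fun a : 𝒮.obstructionOver I J => (⟨(transition h).obj ⟨a.1.proj, a.2⟩,
      (obstructionSplit h ⟨a.1.proj, a.2⟩ a.1.2).1⟩ : (𝒮.overlapBundle I J).Total)) := fun a => by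
  refine contMDiffAt_sumBundle (contMDiffAt_codRestrict (contMDiff_transition_proj h a))
    fun j => ?_
  exact ((((𝒮.obstructionIso J).smooth ⟨j, (Finset.mem_sdiff.1 j.2).1⟩).comp
    contMDiff_subtype_val) a).congr_of_eventuallyEq
      (Eventually.of_forall fun b => obstructionSplit_fst_tot h ⟨b.1.proj, b.2⟩ b.1.2 j)

theorem contMDiff_obstructionSplit_snd (h : I ⊆ J) : ContMDiff
    (𝓘(ℝ, Euc (𝒮.expDim J)).prod 𝓘(ℝ, Euc (∑ j : J, 𝒮.k j)))
    (𝓘(ℝ, Euc (𝒮.expDim I)).prod 𝓘(ℝ, Euc (∑ j : I, 𝒮.k j))) ∞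
    (fun a : 𝒮.obstructionOver I J => (⟨((transition h).obj ⟨a.1.proj, a.2⟩).1,
      (obstructionSplit h ⟨a.1.proj, a.2⟩ a.1.2).2⟩ : (𝒮.obstruction I).Total)) := fun a => by
  refine contMDiffAt_sumBundle (contMDiff_transition_proj h a) fun i => ?_
  exact ((((𝒮.obstructionIso J).smooth ⟨i, h i.2⟩).comp
    contMDiff_subtype_val) a).congr_of_eventuallyEq
      (Eventually.of_forall fun b => obstructionSplit_snd_tot h ⟨b.1.proj, b.2⟩ b.1.2 i)

theorem obstructionSplit_fst_acts (h : I ⊆ J) (g : ((𝒮.W J).restrict (𝒮.overlap J I)).Arr)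
    (a : (𝒮.obstruction J).Fib ((𝒮.W J).src g.1)) (b : (𝒮.obstruction J).Fib ((𝒮.W J).tgt g.1))
    (hab : (𝒮.obstruction J).Acts g.1 ⟨_, a⟩ ⟨_, b⟩) :
    (𝒮.overlapBundle I J).Acts ((transition h).arr g)
      ⟨_, (obstructionSplit h (((𝒮.W J).restrict (𝒮.overlap J I)).src g) a).1⟩
      ⟨_, (obstructionSplit h (((𝒮.W J).restrict (𝒮.overlap J I)).tgt g) b).1⟩ := by
  refine sumBundle_acts rfl rfl fun j => ?_
  have h1 := (𝒮.obstructionIso J).equivariant g.1 a b hab ⟨j, (Finset.mem_sdiff.1 j.2).1⟩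
  exact (congrArg₂ ((𝒮.O j).Acts _) (obstructionSplit_fst_tot h _ a j)
    (obstructionSplit_fst_tot h _ b j)).mpr h1

theorem obstructionSplit_snd_acts (h : I ⊆ J) (g : ((𝒮.W J).restrict (𝒮.overlap J I)).Arr)
    (a : (𝒮.obstruction J).Fib ((𝒮.W J).src g.1)) (b : (𝒮.obstruction J).Fib ((𝒮.W J).tgt g.1))
    (hab : (𝒮.obstruction J).Acts g.1 ⟨_, a⟩ ⟨_, b⟩) :
    (𝒮.obstruction I).Acts ((transition h).arr g).1
      ⟨_, (obstructionSplit h (((𝒮.W J).restrict (𝒮.overlap J I)).src g) a).2⟩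
      ⟨_, (obstructionSplit h (((𝒮.W J).restrict (𝒮.overlap J I)).tgt g) b).2⟩ := by
  refine sumBundle_acts rfl rfl fun i => ?_
  have h1 := (𝒮.obstructionIso J).equivariant g.1 a b hab ⟨i, h i.2⟩
  exact (congrArg₂ ((𝒮.O i).Acts _) (obstructionSplit_snd_tot h _ a i)
    (obstructionSplit_snd_tot h _ b i)).mpr h1

/-- Both points have the components `o_{J-I}`: the fibre coordinate of `W_{J,I}` over `W_{I,J}` is
tautologically the `J - I` part of `σ`. -/
theorem obstructionSplit_fst_diagonal (h : I ⊆ J)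
    (x : ((𝒮.W J).restrict (𝒮.overlap J I)).Obj) :
    (⟨(transition h).obj x, (obstructionSplit h x (𝒮.diagonal J x.1)).1⟩ :
      (𝒮.overlapBundle I J).Total) =
      dropTotal h (fun _ hx => hx) (fun _ hx => hx) overlap_iff_overlap x := by
  refine sumBundle_ext rfl fun j => ?_
  exact ((obstructionSplit_fst_tot h x _ j).trans (diagonal_tot J x.1 _)).trans
    (dropTotal_tot h (fun _ hx => hx) (fun _ hx => hx) overlap_iff_overlap x j).symm

theorem obstructionSplit_snd_diagonal (h : I ⊆ J)
    (x : ((𝒮.W J).restrict (𝒮.overlap J I)).Obj) :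
    (obstructionSplit h x (𝒮.diagonal J x.1)).2 = 𝒮.diagonal I ((transition h).obj x).1 := by
  have h1 : (⟨((transition h).obj x).1, (obstructionSplit h x (𝒮.diagonal J x.1)).2⟩ :
      (𝒮.obstruction I).Total) = ⟨_, 𝒮.diagonal I ((transition h).obj x).1⟩ := by
    refine sumBundle_ext rfl fun i => ?_
    exact ((obstructionSplit_snd_tot h x _ i).trans (diagonal_tot J x.1 _)).trans
      (diagonal_tot I ((transition h).obj x).1 i).symm
  exact eq_of_heq (TotalSpace.mk.inj h1).2

variable (𝒮) in
/-- The obstruction bundles form a virtual bundle. -/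
@[reducible] def virtualBundle : VirtualBundle 𝒮.virtualOrbifold where
  rank I := ∑ j : I, 𝒮.k j
  bundle := 𝒮.obstruction
  split := obstructionSplit
  smooth_split_fst := contMDiff_obstructionSplit_fst
  smooth_split_snd := contMDiff_obstructionSplit_snd
  equivariant h g a b hab :=
    ⟨obstructionSplit_fst_acts h g a b hab, obstructionSplit_snd_acts h g a b hab⟩

variable (𝒮) in
/-- The sections `σ` form a section of the virtual bundle of the obstruction bundles. -/
def virtualSection : VirtualSection 𝒮.virtualBundle where
  sec := 𝒮.diagonal
  smooth := contMDiff_diagonal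
  equivariant := act_diagonal
  compat_fst := obstructionSplit_fst_diagonal
  compat_snd := obstructionSplit_snd_diagonal

end Split

end StabilizationData

end VirtualOrb
end

/-! ### The proposition -/

theorem proposition6p1
    {E : Type*} [NormedAddCommGroup E] [NormedSpace ℝ E] [CompleteSpace E]
    {F : Type*} [NormedAddCommGroup F] [NormedSpace ℝ F] [CompleteSpace F]
    (𝔉 : VirtualOrb.FredholmSystem.{v} E F)
    {ι : Type} [Finite ι] [DecidableEq ι] (𝒮 : VirtualOrb.StabilizationData 𝔉 ι)
    (h𝒮 : 𝒮.IsLocalStabilizationSystem) :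
    -- if `(O_I, s_I)` stabilizes the system at `X_I`, then `W_I` consists of all zeros of `S + s_I`
    (∀ I, 𝒮.StabilizesAt I (𝒮.piece I) (𝒮.piece_le I) →
      ∀ p : 𝒮.Pt I (𝒮.piece I) (𝒮.piece_le I), p.IsZero →
        ∃ x : (𝒮.W I).Obj, VirtualOrb.StabilizationData.pt x = p) ∧
    -- the family of the `W_I` is a virtual orbifold
    ∃ 𝒱 : VirtualOrb.VirtualOrbifold 𝒮.W,
      -- the dimension of `W_I`
      (∀ I : Finset ι, Nonempty (𝒮.W I).Obj →
        (𝒱.dim I : ℤ) = 𝔉.index + ∑ i ∈ I, (𝒮.k i : ℤ)) ∧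
      (∀ I, SecondCountableTopology 𝔉.B.Obj → SecondCountableTopology (𝒮.W I).Obj) ∧
      -- `W_I` carries the smooth structure of a submanifold of `O_I`: the inclusion is an immersion
      (∀ I, ContMDiff 𝓘(ℝ, VirtualOrb.Euc (𝒱.dim I)) 𝓘(ℝ, E) ∞ (𝒮.anchor I).obj) ∧
      (∀ (I : Finset ι) (i : I), ContMDiff 𝓘(ℝ, VirtualOrb.Euc (𝒱.dim I))
        (𝓘(ℝ, E).prod 𝓘(ℝ, VirtualOrb.Euc (𝒮.k i))) ∞
        (fun x : (𝒮.W I).Obj => (VirtualOrb.StabilizationData.pt x).tot i)) ∧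
      (∀ I, ∀ (x : (𝒮.W I).Obj)
        (ξ : TangentSpace 𝓘(ℝ, VirtualOrb.Euc (𝒱.dim I)) x),
        mfderiv 𝓘(ℝ, VirtualOrb.Euc (𝒱.dim I)) 𝓘(ℝ, E) (𝒮.anchor I).obj x ξ = 0 →
        (∀ i : I, mfderiv 𝓘(ℝ, VirtualOrb.Euc (𝒱.dim I))
          (𝓘(ℝ, E).prod 𝓘(ℝ, VirtualOrb.Euc (𝒮.k i)))
          (fun x : (𝒮.W I).Obj => (VirtualOrb.StabilizationData.pt x).tot i) x ξ = 0) →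
        ξ = 0) ∧
      -- `W_{I,J}` is the part of `W_I` over `X_I ∩ X_J`
      (∀ I J, ∀ x : (𝒮.W I).Obj, x ∈ 𝒱.dom I J ↔ (𝒮.anchor I).obj x ∈ 𝒮.piece J) ∧
      -- the transition maps are the projections `(u, o_J) ↦ (u, o_I)`
      (∀ {I J : Finset ι} (h : I ⊆ J) (x : ((𝒮.W J).restrict (𝒱.dom J I)).Obj),
        (𝒮.anchor I).obj ((𝒱.φ h).obj x).1 = (𝒮.anchor J).obj x.1 ∧
        ∀ i : I, (VirtualOrb.StabilizationData.pt ((𝒱.φ h).obj x).1).tot i =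
          (VirtualOrb.StabilizationData.pt x.1).tot ⟨i, h i.2⟩) ∧
      (∀ {I J : Finset ι} (h : I ⊆ J) (a : ((𝒮.W J).restrict (𝒱.dom J I)).Arr),
        (𝒮.anchor I).arr ((𝒱.φ h).arr a).1 = (𝒮.anchor J).arr a.1) ∧
      -- as a bundle over `W_{I,J}`, `W_{J,I}` is `𝔬^* O_{J−I}`, by `(u, o_J) ↦ o_{J−I}`
      ∃ c : ∀ {I J : Finset ι} (h : I ⊆ J), 𝒮.PullbackSum (J \ I) (𝒱.bundle h).V
          ((𝒮.anchor I).comp (VirtualOrb.TopGroupoid.incl _ _)),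
        (∀ {I J : Finset ι} (h : I ⊆ J) (x : ((𝒮.W J).restrict (𝒱.dom J I)).Obj)
          (j : ↥(J \ I)), (c h).tot ((𝒱.bundle h).e x) j =
            (VirtualOrb.StabilizationData.pt x.1).tot ⟨j, (Finset.mem_sdiff.1 j.2).1⟩) ∧
        -- the bundles `𝔬_I^* O_I` form a virtual bundle with the section `σ : (u, o) ↦ (u, o, o)`
        ∃ (𝒪 : VirtualOrb.VirtualBundle 𝒱) (σ : VirtualOrb.VirtualSection 𝒪)
          (d : ∀ I, 𝒮.PullbackSum I (𝒪.bundle I) (𝒮.anchor I)),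
          (∀ {I J : Finset ι} (h : I ⊆ J) (x : ((𝒮.W J).restrict (𝒱.dom J I)).Obj)
            (a : (𝒪.bundle J).Fib x.1),
            (∀ j : ↥(J \ I), (c h).tot ⟨(𝒱.φ h).obj x, (𝒪.split h x a).1⟩ j =
              (d J).tot ⟨x.1, a⟩ ⟨j, (Finset.mem_sdiff.1 j.2).1⟩) ∧
            ∀ i : I, (d I).tot ⟨((𝒱.φ h).obj x).1, (𝒪.split h x a).2⟩ i =
              (d J).tot ⟨x.1, a⟩ ⟨i, h i.2⟩) ∧
          (∀ (I : Finset ι) (x : (𝒮.W I).Obj) (i : I), (d I).tot ⟨x, σ.sec I x⟩ i =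
            (VirtualOrb.StabilizationData.pt x).tot i) ∧
          -- the zeros of `σ` form the moduli space
          (∀ I, (𝒮.anchor I).obj '' {x | σ.sec I x = 0} =
            {u | u ∈ 𝒮.piece I ∧ 𝔉.S u = 0}) := by
  refine ⟨fun I hI p hp => ⟨⟨p, hp, hI p hp⟩, rfl⟩, 𝒮.virtualOrbifold, ?_,
    fun I _ => 𝒮.secondCountable_W I,
    𝒮.contMDiff_anchor, 𝒮.contMDiff_tot, fun I => VirtualOrb.StabilizationData.immersion_W,
    fun _ _ _ => Iff.rfl, fun _ _ => ⟨rfl, fun _ => rfl⟩, fun _ _ => rfl,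
    fun {I J} _ => 𝒮.overlapIso I J, ?_, 𝒮.virtualBundle, 𝒮.virtualSection, 𝒮.obstructionIso,
    ?_, VirtualOrb.StabilizationData.diagonal_tot,
    VirtualOrb.StabilizationData.image_zeros_diagonal h𝒮⟩
  -- A point of `W_I` is a regular zero, which rules out truncation in `expDim`.
  · rintro I ⟨x⟩
    exact x.2.2.expDim_eq.symm
  · intro I J h x j
    exact VirtualOrb.StabilizationData.dropTotal_tot h (fun _ hx => hx) (fun _ hx => hx)
      VirtualOrb.StabilizationData.overlap_iff_overlap x j
  · intro I J h x a
    exact ⟨VirtualOrb.StabilizationData.obstructionSplit_fst_tot h x a,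
      VirtualOrb.StabilizationData.obstructionSplit_snd_tot h x a⟩
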